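/- **Setting.** For $m\ge 1$ and integers $q_1,\dots,q_m$ let $P=P(q_1,\dots,q_m)$ be the pretzel link whose standard diagram has $m$ vertical twist regions placed side by side, the $i$-th with $|q_i|$ half twists (crossings) whose handedness is given by the sign of $q_i$; indices are read cyclically modulo $m$. (In each of the three cases below $P$ is a knot.) For a group $G$, a $G$-coloring of $P$ is a homomorphism from the link group $\pi_1(S^3\setminus P)$ to $G$; equivalently, a labelling of the strands of the diagram by elements of $G$ satisfying the Wirtinger relations. A *simple $S_n$-coloring* is an $S_n$-coloring sending every meridian to a transposition; a *tricoloring* is a simple $S_3$-coloring. A *simple $B_n$-coloring* is a coloring by the braid group $B_n$ sending every meridian to a half twist, i.e. to a conjugate of $\sigma_i^{\pm1}$ for a standard generator $\sigma_i$. A simple $S_n$-coloring *lifts to a simple $B_n$-coloring* if it is the composition of a simple $B_n$-coloring with the canonical projection $B_n\to S_n$. A coloring is *constant* (*constant on a twist region*) if all strands (all strands of that region) have the same color. **Theorem.** 1. Suppose that $m$ and all $q_i$ are odd, and that either (a) $q_j=\pm q_{j+1}$ for some $j$ with $|q_j|\ge 3$, and $|q_p|>3$ for some $p$, or (b) all $q_i$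 have the same sign, and it is not the case that $3\mid m$ and $|q_i|=1$ for all $i$. Then no non-constant tricoloring of $P$ lifts to a simple $B_3$-coloring. 2. Suppose that $m$ and $q_1$ are even, the other $q_i$ are odd, and some $q_i$ is a multiple of $3$. Then every tricoloring of $P$ lifts to a simple $B_3$-coloring. 3. Suppose that $q_1$ is even and that $m$ and the other $q_i$ are odd. (a) If $q_1=0$, then every tricoloring of $P$ lifts to a simple $B_3$-coloring. For arbitrary $q_1$, every tricoloring that is constant on the first twist region lifts to a simple $B_3$-coloring. The same two statements hold for simple $S_4$-colorings and lifts to simple $B_4$-colorings. (b) If $q_1\ne 0$ and every $q_i$ is a multiple of $3$, then no tricoloring that is non-constant on every twist region lifts to a simple $B_3$-coloring. (c) If $q_j=q_{j+1}=\pm3$ for some $j$, then a tricoloring of $P$ lifts to a simple $B_3$-coloring if and only if $q_1=0$ or it is constant on the first twist region. -/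

import Mathlib

/-! ### Pretzel links and their link groups -/

/-- The two positions (left, right) in a vertical twist region. -/
inductive StrandSide : Type
  | left
  | right

/-- The strand segments of the standard diagram of the pretzel link `P(q₁, …, q_m)`.
The `i`-th of the `m` vertical twist regions consists of two strands twisted around each other,
with `|q i|` crossings stacked from bottom to top. These crossings cut the region into the levels
`0, 1, …, |q i|` (`0` at the bottom), and at each level there are a left and a right segment. -/
structure PretzelStrand {m : ℕ} (q : Fin m → ℤ) : Type where
  region : Fin m
  level : Fin ((q region).natAbs + 1)
  side : StrandSide

/-- The free generator belonging to the left segment of region `i` at level `t`. It stands for the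
meridian of this segment, where the segment is directed from bottom to top. -/
def pretzelLeft {m : ℕ} (q : Fin m → ℤ) (i : Fin m) (t : Fin ((q i).natAbs + 1)) :
    FreeGroup (PretzelStrand q) :=
  FreeGroup.of ⟨i, t, StrandSide.left⟩

/-- The free generator belonging to the right segment of region `i` at level `t`. It stands for the
meridian of this segment, where the segment is directed from bottom to top. -/
def pretzelRight {m : ℕ} (q : Fin m → ℤ) (i : Fin m) (t : Fin ((q i).natAbs + 1)) :
    FreeGroup (PretzelStrand q) :=
  FreeGroup.of ⟨i, t, StrandSide.right⟩

/-- The Wirtinger relators of the standard diagram of the pretzel link `P(q₁, …, q_m)`. All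
meridians are those of segments directed from bottom to top, whatever the orientation of the link.
* At a crossing of a region with `q i > 0`, the over-strand runs from the lower left to the upper
  right; at a crossing of a region with `q i < 0`, it runs from the lower right to the upper left.
  The over-strand keeps its meridian, and the meridian of the under-strand is conjugated by that
  of the over-strand, so that the product of the two meridians is the same below and above.
* At the bottom, and likewise at the top, the right strand of each region is joined to the left
  strand of the next region by an arc without crossings; the last region is joined to the first
  one (addition in `Fin m` is cyclic). Following such an arc reverses the vertical direction, so
  the two meridians are inverse to each other. -/
inductive PretzelRelator {m : ℕ} [NeZero m] (q : Fin m → ℤ) :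
    FreeGroup (PretzelStrand q) → Prop
  | overPos (i : Fin m) (t : Fin (q i).natAbs) (h : 0 < q i) :
      PretzelRelator q (pretzelRight q i t.succ * (pretzelLeft q i t.castSucc)⁻¹)
  | underPos (i : Fin m) (t : Fin (q i).natAbs) (h : 0 < q i) :
      PretzelRelator q (pretzelLeft q i t.succ *
        (pretzelLeft q i t.castSucc * pretzelRight q i t.castSucc *
          (pretzelLeft q i t.castSucc)⁻¹)⁻¹)
  | overNeg (i : Fin m) (t : Fin (q i).natAbs) (h : q i < 0) :
      PretzelRelator q (pretzelLeft q i t.succ * (pretzelRight q i t.castSucc)⁻¹)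
  | underNeg (i : Fin m) (t : Fin (q i).natAbs) (h : q i < 0) :
      PretzelRelator q (pretzelRight q i t.succ *
        ((pretzelRight q i t.castSucc)⁻¹ * pretzelLeft q i t.castSucc *
          pretzelRight q i t.castSucc)⁻¹)
  | bottom (i : Fin m) :
      PretzelRelator q (pretzelRight q i 0 * pretzelLeft q (i + 1) 0)
  | top (i : Fin m) :
      PretzelRelator q (pretzelRight q i (Fin.last _) * pretzelLeft q (i + 1) (Fin.last _))

/-- The link group of the pretzel link `P(q₁, …, q_m)` (the fundamental group of its complement),
given by the Wirtinger presentation of its standard diagram. A homomorphism from it to a group `G`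
is a `G`-coloring of the link. -/
abbrev PretzelGroup {m : ℕ} [NeZero m] (q : Fin m → ℤ) : Type :=
  PresentedGroup {r : FreeGroup (PretzelStrand q) | PretzelRelator q r}

/-- The meridian of a strand segment, directed from bottom to top. -/
def pretzelMeridian {m : ℕ} [NeZero m] (q : Fin m → ℤ) (s : PretzelStrand q) : PretzelGroup q :=
  PresentedGroup.of s

/-! ### Braid groups -/

/-- The Artin relators; the generator with index `i : Fin (n - 1)` is the `(i+1)`-st standard
generator. -/
inductive BraidRelator (n : ℕ) : FreeGroup (Fin (n - 1)) → Prop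
  | comm (i j : Fin (n - 1)) (h : (i : ℕ) + 1 < j) :
      BraidRelator n (FreeGroup.of i * FreeGroup.of j *
        (FreeGroup.of j * FreeGroup.of i)⁻¹)
  | braid (i j : Fin (n - 1)) (h : (i : ℕ) + 1 = j) :
      BraidRelator n (FreeGroup.of i * FreeGroup.of j * FreeGroup.of i *
        (FreeGroup.of j * FreeGroup.of i * FreeGroup.of j)⁻¹)

/-- The braid group `B_n` on `n` strands, in Artin's presentation. -/
abbrev BraidGroup (n : ℕ) : Type :=
  PresentedGroup {r : FreeGroup (Fin (n - 1)) | BraidRelator n r}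

/-- The standard generators of the braid group. -/
def braidGen {n : ℕ} (i : Fin (n - 1)) : BraidGroup n :=
  PresentedGroup.of i

/-- The transposition of the neighbours `i` and `i + 1`. -/
def adjacentSwap {n : ℕ} (i : Fin (n - 1)) : Equiv.Perm (Fin n) :=
  Equiv.swap ⟨i, by omega⟩ ⟨i + 1, by omega⟩

theorem adjacentSwap_relations {n : ℕ} :
    ∀ r ∈ {r : FreeGroup (Fin (n - 1)) | BraidRelator n r},
      FreeGroup.lift (adjacentSwap (n := n)) r = 1 := by
  rintro r (⟨i, j, h⟩ | ⟨i, j, h⟩)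
  · simp only [map_mul, map_inv, FreeGroup.lift_apply_of, mul_inv_eq_one]
    apply Equiv.Perm.Disjoint.commute
    intro x
    by_cases hx : (x : ℕ) = i ∨ (x : ℕ) = i + 1
    · right
      apply Equiv.swap_apply_of_ne_of_ne <;> simp only [ne_eq, Fin.ext_iff] <;> omega
    · left
      apply Equiv.swap_apply_of_ne_of_ne <;> simp only [ne_eq, Fin.ext_iff] <;> omega
  · simp only [map_mul, map_inv, FreeGroup.lift_apply_of, mul_inv_eq_one]
    have key : ∀ a b c : Fin n, a ≠ b → b ≠ c → a ≠ c →
        Equiv.swap a b * Equiv.swap b c * Equiv.swap a b =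
          Equiv.swap b c * Equiv.swap a b * Equiv.swap b c := by
      intro a b c hab hbc hac
      rw [Equiv.swap_mul_swap_mul_swap hab hac, Equiv.swap_comm a b, Equiv.swap_comm b c,
        Equiv.swap_mul_swap_mul_swap hbc.symm hac.symm, Equiv.swap_comm]
    have hj : (⟨i + 1, by omega⟩ : Fin n) = ⟨j, by omega⟩ := Fin.ext h
    unfold adjacentSwap
    rw [hj]
    apply key <;> simp only [ne_eq, Fin.ext_iff] <;> omega

/-- The canonical projection `B_n → S_n`. -/
def braidToPerm (n : ℕ) : BraidGroup n →* Equiv.Perm (Fin n) :=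
  PresentedGroup.toGroup (adjacentSwap_relations (n := n))

/-- Half twists: the conjugates of the standard generators and of their inverses. -/
def IsHalfTwist {n : ℕ} (b : BraidGroup n) : Prop :=
  ∃ i : Fin (n - 1), IsConj (braidGen i) b ∨ IsConj (braidGen i)⁻¹ b

/-! ### Colorings -/

/-- A simple `S_n`-coloring of a pretzel link: every meridian goes to a transposition.
For `n = 3` this is a tricoloring. -/
def IsSimplePermColoring {m : ℕ} [NeZero m] {q : Fin m → ℤ} {n : ℕ}
    (φ : PretzelGroup q →* Equiv.Perm (Fin n)) : Prop :=
  ∀ s : PretzelStrand q, (φ (pretzelMeridian q s)).IsSwap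

/-- A simple `B_n`-coloring of a pretzel link: every meridian goes to a half twist. -/
def IsSimpleBraidColoring {m : ℕ} [NeZero m] {q : Fin m → ℤ} {n : ℕ}
    (ψ : PretzelGroup q →* BraidGroup n) : Prop :=
  ∀ s : PretzelStrand q, IsHalfTwist (ψ (pretzelMeridian q s))

/-- The `S_n`-coloring `φ` lifts to a simple `B_n`-coloring. -/
def LiftsToSimpleBraidColoring {m : ℕ} [NeZero m] {q : Fin m → ℤ} {n : ℕ}
    (φ : PretzelGroup q →* Equiv.Perm (Fin n)) : Prop :=
  ∃ ψ : PretzelGroup q →* BraidGroup n,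
    IsSimpleBraidColoring ψ ∧ (braidToPerm n).comp ψ = φ

/-- All strands have the same color. -/
def IsConstantColoring {m : ℕ} [NeZero m] {q : Fin m → ℤ} {n : ℕ}
    (φ : PretzelGroup q →* Equiv.Perm (Fin n)) : Prop :=
  ∀ s s' : PretzelStrand q, φ (pretzelMeridian q s) = φ (pretzelMeridian q s')

/-- All strands of the `i`-th twist region have the same color. -/
def IsConstantOnRegion {m : ℕ} [NeZero m] {q : Fin m → ℤ} {n : ℕ}
    (φ : PretzelGroup q →* Equiv.Perm (Fin n)) (i : Fin m) : Prop :=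
  ∀ s s' : PretzelStrand q, s.region = i → s'.region = i →
    φ (pretzelMeridian q s) = φ (pretzelMeridian q s')

/-! ### Colorings of pretzel links -/

/-! With all meridians directed upwards, the product `d` of the two colors of a twist region is the
same at every level. A coloring is therefore determined by the colors `x i` of the left bottom
segments, and the only condition on them is that `(x i)⁻¹ * topColor q x i` does not depend on `i`
(`coloring_top`, `exists_coloring`).

Existence of lifts. If one region of a simple `S_n`-coloring has the same colors at the top as at
the bottom, the closing condition forces this on all regions. Choose a half twist over each
transposition so that non-commuting transpositions get braided half twists, and use these with
exponents `±1` alternating along the regions. Each region then carries equal or braided colors;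
braided ones occur only for `3 ∣ q i`, and three half twists fix a braided pair
(`twist_eq_self_of_braided`), so the lift closes up. Alternation is possible for even `m`; for odd
`m` the one repetition is put at region `0`, where `q 0 = 0` or the coloring is constant.

Obstructions. The map `B₃ → SL(2, ℤ)` sends half twists to transvections along primitive vectors,
and its reduction modulo 2 is `B₃ → S₃`. A lift yields vectors `v i` at the bottom and `w i` at the
top. Along a region the vectors obey a Lucas recursion with parameter `κ = ±ω(v i, v (i+1))`
(`twist_transvection`), and `κ` is odd where the tricoloring is not constant. The closing condition
makes `|κ F_{q i}(κ)|` one constant `C`. Modulo `F_{q i}(κ)` the vector `w i` is a multiple of `v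
i`, and `w (i+1)` is the same multiple of `v (i+1)` up to sign. The contradictions come from
following this ratio along the knot.

With one even region, only that region negates the ratio. If `3 ∣ q i` for all `i`, every modulus is
divisible by 4, and going around once gives `r ≡ -r`, although `r` is odd. Two adjacent regions with
`q = ±3` contradict each other modulo `κ² - 1`.

With all entries odd, the Lucas polynomials are Fibonacci polynomials. If all signs agree, the
region maps preserve a cone and push its boundary ray inside, so the cycle cannot close. If `|q p| ≥
5`, arithmetic of Fibonacci polynomials (`fib_index_eq`, `fib_not_dvd_add`) shows that the regions
with more than one crossing all have the size of region `p` and alternate in sign. All region maps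
have a common eigenvector; the logarithms of its eigenvalues sum to zero around the knot, and the
alternating regions cancel except for a multiple of the crossing sign. Hence the signs of the `q i`
sum to zero, which is impossible for odd `m`. -/

/-- The color of the left segment after `n` half twists, if `a` is the color of the left segment
and `d` the product of the colors of both segments at the beginning. -/
def twist {G : Type*} [Group G] (a d : G) (n : ℤ) : G :=
  if Even n then d ^ (n / 2) * a * d ^ (-(n / 2)) else d ^ (n / 2 + 1) * a⁻¹ * d ^ (-(n / 2))

section twist

variable {G : Type*} [Group G] (a d : G)

theorem twist_two_mul (n : ℤ) : twist a d (2 * n) = d ^ n * a * d ^ (-n) := by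
  simp [twist]

theorem twist_two_mul_add_one (n : ℤ) :
    twist a d (2 * n + 1) = d ^ (n + 1) * a⁻¹ * d ^ (-n) := by
  have h : (2 * n + 1) / 2 = n := by omega
  rw [twist, if_neg (by simp), h]

theorem twist_zero : twist a d 0 = a := by simp [twist]

theorem twist_succ (n : ℤ) : twist a d (n + 1) = d * (twist a d n)⁻¹ := by
  obtain ⟨k, rfl | rfl⟩ := Int.even_or_odd' n
  · rw [twist_two_mul, twist_two_mul_add_one, zpow_add, zpow_one, zpow_neg]
    group
  · rw [show 2 * k + 1 + 1 = 2 * (k + 1) by ring, twist_two_mul, twist_two_mul_add_one]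
    group

theorem twist_pred (n : ℤ) : twist a d (n - 1) = (twist a d n)⁻¹ * d := by
  have h := twist_succ a d (n - 1)
  rw [sub_add_cancel] at h
  rw [h]
  group

theorem twist_neg_one : twist a d (-1) = a⁻¹ * d := by
  simpa [twist_zero] using twist_pred a d 0

/-- The two strands of a twist region alternate, so each color of the region is conjugate to one
of the two colors at the bottom. -/
theorem isConj_twist (n : ℤ) : IsConj a (twist a d n) ∨ IsConj (a⁻¹ * d) (twist a d n) := by
  obtain ⟨k, rfl | rfl⟩ := Int.even_or_odd' n
  · left
    rw [twist_two_mul, isConj_iff]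
    exact ⟨d ^ k, by rw [zpow_neg]⟩
  · right
    rw [twist_two_mul_add_one, isConj_iff]
    exact ⟨d ^ (k + 1), by group⟩

theorem twist_one (n : ℤ) (h : a * a = 1) : twist a 1 n = a := by
  have h' : a⁻¹ = a := inv_eq_of_mul_eq_one_left h
  unfold twist
  split_ifs <;> simp [h']

/-- The dihedral case: the involution `a` inverts `d`, so all powers of `d` can be collected on the
left. -/
theorem twist_eq_pow_mul (n : ℤ) (h : a * a = 1) (hd : a * d * a = d⁻¹) :
    twist a d n = d ^ n * a := by
  have h' : a⁻¹ = a := inv_eq_of_mul_eq_one_left h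
  have key : ∀ k : ℤ, a * d ^ (-k) = d ^ k * a := by
    intro k
    have : a * d ^ (-k) * a⁻¹ = d ^ k := by
      rw [← conj_zpow, h', hd, inv_zpow, zpow_neg, inv_inv]
    rw [← this, inv_mul_cancel_right]
  obtain ⟨k, rfl | rfl⟩ := Int.even_or_odd' n
  · rw [twist_two_mul, mul_assoc, key, ← mul_assoc, ← zpow_add]
    congr 2; ring
  · rw [twist_two_mul_add_one, h', mul_assoc, key, ← mul_assoc, ← zpow_add]
    congr 2; ring

end twist

/-- The colors of all segments of the standard diagram, expressed by the colors `x i` of the left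
segments at the bottom. -/
def strandColor {m : ℕ} [NeZero m] (q : Fin m → ℤ) {G : Type*} [Group G] (x : Fin m → G) :
    PretzelStrand q → G
  | ⟨i, t, StrandSide.left⟩ => twist (x i) (x i * (x (i + 1))⁻¹) ((q i).sign * t)
  -- Left times right is `d` at every level, so by `twist_pred` the right color is the left color
  -- one half twist earlier.
  | ⟨i, t, StrandSide.right⟩ => twist (x i) (x i * (x (i + 1))⁻¹) ((q i).sign * t - 1)

section Coloring

variable {m : ℕ} [NeZero m] {q : Fin m → ℤ} {G : Type*} [Group G]

/-- The color of the left segment at the bottom of region `i`. -/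
def bottomColor (φ : PretzelGroup q →* G) (i : Fin m) : G :=
  φ (pretzelMeridian q ⟨i, 0, StrandSide.left⟩)

/-- The color of the left segment at the top of region `i`. -/
def topColor (q : Fin m → ℤ) (x : Fin m → G) (i : Fin m) : G :=
  twist (x i) (x i * (x (i + 1))⁻¹) (q i)

theorem coloring_relator (φ : PretzelGroup q →* G) {r : FreeGroup (PretzelStrand q)}
    (h : PretzelRelator q r) : FreeGroup.lift (fun s => φ (pretzelMeridian q s)) r = 1 := by
  have h1 : (FreeGroup.lift fun s => φ (pretzelMeridian q s)) =
      φ.comp (PresentedGroup.mk {r | PretzelRelator q r}) := by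
    ext s
    simp [pretzelMeridian, PresentedGroup.of]
  have h2 : r ∈ {r | PretzelRelator q r} := h
  rw [h1, MonoidHom.comp_apply, PresentedGroup.one_of_mem h2, map_one]

theorem coloring_bottom (φ : PretzelGroup q →* G) (i : Fin m) :
    φ (pretzelMeridian q ⟨i, 0, StrandSide.right⟩) = (bottomColor φ (i + 1))⁻¹ := by
  have h := coloring_relator φ (PretzelRelator.bottom i)
  simp only [pretzelRight, pretzelLeft, map_mul, FreeGroup.lift_apply_of] at h
  exact eq_inv_of_mul_eq_one_left h

theorem coloring_level (φ : PretzelGroup q →* G) (i : Fin m) (t : ℕ) (ht : t < (q i).natAbs + 1) :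
    φ (pretzelMeridian q ⟨i, ⟨t, ht⟩, StrandSide.left⟩) =
        twist (bottomColor φ i) (bottomColor φ i * (bottomColor φ (i + 1))⁻¹) ((q i).sign * t) ∧
      φ (pretzelMeridian q ⟨i, ⟨t, ht⟩, StrandSide.right⟩) =
        twist (bottomColor φ i) (bottomColor φ i * (bottomColor φ (i + 1))⁻¹)
          ((q i).sign * t - 1) := by
  induction t with
  | zero =>
    refine ⟨by simp [twist_zero]; rfl, ?_⟩
    simp only [Nat.cast_zero, mul_zero, zero_sub, twist_neg_one, inv_mul_cancel_left]
    exact coloring_bottom φ i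
  | succ t ih =>
    obtain ⟨hl, hr⟩ := ih (by omega)
    set a := bottomColor φ i
    set d := a * (bottomColor φ (i + 1))⁻¹
    have ht' : t < (q i).natAbs := by omega
    rcases lt_trichotomy (q i) 0 with h | h | h
    · have h1 := coloring_relator φ (PretzelRelator.overNeg i ⟨t, ht'⟩ h)
      have h2 := coloring_relator φ (PretzelRelator.underNeg i ⟨t, ht'⟩ h)
      simp only [pretzelRight, pretzelLeft, map_mul, map_inv, FreeGroup.lift_apply_of,
        mul_inv_eq_one, Fin.succ_mk, Fin.castSucc_mk] at h1 h2
      rw [hr] at h1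
      rw [hr, hl] at h2
      rw [Int.sign_eq_neg_one_of_neg h] at *
      have e1 : (-1 : ℤ) * ((t + 1 : ℕ) : ℤ) = -1 * t - 1 := by push_cast; ring
      rw [e1]
      refine ⟨h1, h2.trans ?_⟩
      rw [twist_pred a d (-1 * t - 1), twist_pred a d (-1 * t)]
      group
    · simp [h] at ht'
    · have h1 := coloring_relator φ (PretzelRelator.overPos i ⟨t, ht'⟩ h)
      have h2 := coloring_relator φ (PretzelRelator.underPos i ⟨t, ht'⟩ h)
      simp only [pretzelRight, pretzelLeft, map_mul, map_inv, FreeGroup.lift_apply_of,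
        mul_inv_eq_one, Fin.succ_mk, Fin.castSucc_mk] at h1 h2
      rw [hl] at h1
      rw [hr, hl] at h2
      rw [Int.sign_eq_one_of_pos h] at *
      have e1 : (1 : ℤ) * ((t + 1 : ℕ) : ℤ) = 1 * t + 1 := by push_cast; ring
      rw [e1, add_sub_cancel_right]
      refine ⟨h2.trans ?_, h1⟩
      rw [twist_succ, twist_pred]
      group

theorem coloring_eq_strandColor (φ : PretzelGroup q →* G) (s : PretzelStrand q) :
    φ (pretzelMeridian q s) = strandColor q (bottomColor φ) s := by
  obtain ⟨i, t, side⟩ := s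
  cases side
  · exact (coloring_level φ i t t.2).1
  · exact (coloring_level φ i t t.2).2

/-- The compatibility of the colors at the top. -/
theorem coloring_top (φ : PretzelGroup q →* G) (i : Fin m) :
    (bottomColor φ (i + 1))⁻¹ * topColor q (bottomColor φ) (i + 1) =
      (bottomColor φ i)⁻¹ * topColor q (bottomColor φ) i := by
  have h := coloring_relator φ (PretzelRelator.top i)
  simp only [pretzelRight, pretzelLeft, map_mul, FreeGroup.lift_apply_of] at h
  rw [coloring_eq_strandColor, coloring_eq_strandColor] at h
  simp only [strandColor, Fin.val_last, Int.sign_mul_natAbs] at h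
  rw [twist_pred] at h
  unfold topColor
  rw [← mul_right_inj ((twist (bottomColor φ i)
    (bottomColor φ i * (bottomColor φ (i + 1))⁻¹) (q i))⁻¹ * bottomColor φ i)]
  rw [show ∀ a b c : G, a⁻¹ * b * (b⁻¹ * a) = 1 by intro a b c; group]
  · rw [← h]; group
  · exact 1

/-- The relators of the crossings and of the bottom arcs hold identically for `strandColor`; only
the top arcs impose a condition. -/
theorem exists_coloring (x : Fin m → G)
    (hx : ∀ i, (x (i + 1))⁻¹ * topColor q x (i + 1) = (x i)⁻¹ * topColor q x i) :
    ∃ ψ : PretzelGroup q →* G, ∀ s, ψ (pretzelMeridian q s) = strandColor q x s := by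
  have h : ∀ r ∈ {r | PretzelRelator q r}, FreeGroup.lift (strandColor q x) r = 1 := by
    rintro r (⟨i, t, h⟩ | ⟨i, t, h⟩ | ⟨i, t, h⟩ | ⟨i, t, h⟩ | ⟨i⟩ | ⟨i⟩) <;>
      simp only [pretzelRight, pretzelLeft, map_mul, map_inv, FreeGroup.lift_apply_of,
        mul_inv_eq_one, strandColor, Fin.val_succ, Fin.val_castSucc]
    · rw [Int.sign_eq_one_of_pos h]
      congr 1; push_cast; ring
    · rw [Int.sign_eq_one_of_pos h]
      push_cast
      rw [mul_add, mul_one, twist_succ, twist_pred]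
      group
    · rw [Int.sign_eq_neg_one_of_neg h]
      congr 1; push_cast; ring
    · rw [Int.sign_eq_neg_one_of_neg h]
      have e1 : (-1 : ℤ) * ((t + 1 : ℕ) : ℤ) = -1 * t - 1 := by push_cast; ring
      rw [e1, twist_pred, twist_pred]
      group
    · simp only [Fin.val_zero, Nat.cast_zero, mul_zero, zero_sub, twist_neg_one, twist_zero]
      group
    · simp only [Fin.val_last, Int.sign_mul_natAbs]
      have h1 := hx i
      unfold topColor at h1
      rw [twist_pred, ← mul_right_inj (x (i + 1))⁻¹, mul_one, mul_assoc]
      rw [inv_mul_eq_iff_eq_mul] at h1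
      rw [h1]
      group
  exact ⟨PresentedGroup.toGroup h, fun s => by simp [pretzelMeridian]⟩

theorem strandColor_eq_twist (x : Fin m → G) (s : PretzelStrand q) :
    ∃ n, strandColor q x s = twist (x s.region) (x s.region * (x (s.region + 1))⁻¹) n := by
  obtain ⟨i, t, side⟩ := s
  cases side
  · exact ⟨_, rfl⟩
  · exact ⟨_, rfl⟩

theorem coloring_ext {φ φ' : PretzelGroup q →* G}
    (h : ∀ i, bottomColor φ i = bottomColor φ' i) : φ = φ' := by
  ext s
  have h1 := coloring_eq_strandColor φ s
  have h2 := coloring_eq_strandColor φ' s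
  rw [funext h] at h1
  exact h1.trans h2.symm

theorem bottomColor_of_strandColor {ψ : PretzelGroup q →* G} {x : Fin m → G}
    (h : ∀ s, ψ (pretzelMeridian q s) = strandColor q x s) (i : Fin m) :
    bottomColor ψ i = x i := by
  unfold bottomColor
  rw [h]
  simp [strandColor, twist_zero]

end Coloring

theorem Fin.ofNat_succ {m : ℕ} [NeZero m] (t : ℕ) : Fin.ofNat m (t + 1) = Fin.ofNat m t + 1 := by
  ext
  simp [Fin.val_add]

theorem Fin.cyclic_induction {m : ℕ} [NeZero m] {p : Fin m → Prop} (i₀ : Fin m) (h₀ : p i₀)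
    (h : ∀ i, p i → p (i + 1)) (i : Fin m) : p i := by
  have h1 : ∀ t : ℕ, p (i₀ + Fin.ofNat m t) := by
    intro t
    induction t with
    | zero =>
      have : Fin.ofNat m 0 = 0 := rfl
      rwa [this, add_zero]
    | succ t ih =>
      rw [Fin.ofNat_succ, ← add_assoc]
      exact h _ ih
  have h2 := h1 (i - i₀).val
  rw [Fin.ofNat_val_eq_self] at h2
  rwa [add_sub_cancel] at h2

/-! ### Lifting colorings -/

section Braided

variable {G : Type*} [Group G] {a b : G}

/-- Three half twists fix a braided pair. Since `(a * b) ^ 3` commutes with `a`, even multiples of 3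
act trivially, and odd ones reduce to the three half twists computed in `h4`. -/
theorem twist_eq_self_of_braided (h : a * b * a = b * a * b) {q : ℤ} (hq : 3 ∣ q) :
    twist a (a * b) q = a := by
  have h1 : (a * b) * a = b * (a * b) := by simpa [mul_assoc] using h
  have h2 : (a * b) ^ (3 : ℤ) * a = a * (a * b) ^ (3 : ℤ) := by
    have e : (a * b) ^ (3 : ℤ) = (a * b * a) * (b * a * b) := by
      simp [zpow_ofNat, pow_succ, mul_assoc]
    have h3 : (a * b * a) * b = a * (a * b * a) :=
      calc (a * b * a) * b = a * (b * a * b) := by simp only [mul_assoc]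
        _ = a * (a * b * a) := by rw [h]
    have h4 : (a * b * a) * a = b * (a * b * a) :=
      calc (a * b * a) * a = b * a * b * a := by rw [h]
        _ = b * (a * b * a) := by simp only [mul_assoc]
    rw [e, ← h, mul_assoc, h4, ← mul_assoc, h3, mul_assoc]
  obtain ⟨k, rfl⟩ := hq
  obtain ⟨j, rfl | rfl⟩ := Int.even_or_odd' k
  · rw [show 3 * (2 * j) = 2 * (3 * j) by ring, twist_two_mul, zpow_neg, mul_inv_eq_iff_eq_mul,
      zpow_mul]
    exact (Commute.zpow_left (h := (h2 : Commute _ _)) j).eq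
  · have h3 : (a * b) ^ (3 * j) * a = a * (a * b) ^ (3 * j) := by
      rw [zpow_mul]
      exact (Commute.zpow_left (h := (h2 : Commute _ _)) j).eq
    have h4 : (a * b) ^ (2 : ℤ) * a⁻¹ * (a * b)⁻¹ = a := by
      rw [mul_inv_eq_iff_eq_mul, mul_inv_eq_iff_eq_mul]
      have : (a * b) ^ (2 : ℤ) = a * (b * a * b) := by simp [zpow_ofNat, pow_succ, mul_assoc]
      rw [this, ← h]
      simp [mul_assoc]
    rw [show 3 * (2 * j + 1) = 2 * (3 * j + 1) + 1 by ring, twist_two_mul_add_one]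
    rw [show 3 * j + 1 + 1 = 3 * j + 2 by ring, zpow_add, neg_add, zpow_add, zpow_neg, zpow_neg,
      zpow_one, (((Commute.refl (a * b)).zpow_left (3 * j)).inv_left.inv_right.eq)]
    calc _ = (a * b) ^ (3 * j) * ((a * b) ^ (2 : ℤ) * a⁻¹ * (a * b)⁻¹) * ((a * b) ^ (3 * j))⁻¹ := by
          simp [mul_assoc]
      _ = a := by rw [h4, h3, mul_inv_cancel_right]

theorem twist_mul_self (q : ℤ) : twist a (a * a) q = a := by
  obtain ⟨k, rfl | rfl⟩ := Int.even_or_odd' q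
  · rw [twist_two_mul, ← sq, ← zpow_natCast, ← zpow_mul, ← zpow_mul]
    group
  · rw [twist_two_mul_add_one, ← sq, ← zpow_natCast, ← zpow_mul, ← zpow_mul]
    group

theorem braided_inv (h : a * b * a = b * a * b) : a⁻¹ * b⁻¹ * a⁻¹ = b⁻¹ * a⁻¹ * b⁻¹ := by
  have := congrArg (·⁻¹) h
  simpa [mul_assoc] using this

theorem braided_conj (g : G) (h : a * b * a = b * a * b) :
    (g * a * g⁻¹) * (g * b * g⁻¹) * (g * a * g⁻¹) =
      (g * b * g⁻¹) * (g * a * g⁻¹) * (g * b * g⁻¹) := by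
  have : g * (a * b * a) * g⁻¹ = g * (b * a * b) * g⁻¹ := by rw [h]
  simpa [mul_assoc] using this

theorem conj_eq_of_braided (h : a * b * a = b * a * b) : b * a * b⁻¹ = a⁻¹ * b * a := by
  rw [mul_inv_eq_iff_eq_mul, mul_assoc, mul_assoc, eq_inv_mul_iff_mul_eq]
  simpa [mul_assoc] using h

theorem braided_conj_left (h : a * b * a = b * a * b) :
    a * (b * a * b⁻¹) * a = (b * a * b⁻¹) * a * (b * a * b⁻¹) := by
  rw [conj_eq_of_braided h]
  have := braided_conj a⁻¹ h
  simpa using this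

theorem braided_conj_right (h : a * b * a = b * a * b) :
    b * (b * a * b⁻¹) * b = (b * a * b⁻¹) * b * (b * a * b⁻¹) := by
  have := braided_conj b h
  simpa using this.symm

end Braided

/-! ### Half twists, and a choice of them over the transpositions -/

theorem IsHalfTwist.of_isConj {n : ℕ} {a b : BraidGroup n} (h : IsHalfTwist a)
    (hab : IsConj a b) : IsHalfTwist b := by
  obtain ⟨i, h | h⟩ := h
  · exact ⟨i, Or.inl (h.trans hab)⟩
  · exact ⟨i, Or.inr (h.trans hab)⟩

theorem IsHalfTwist.inv {n : ℕ} {a : BraidGroup n} (h : IsHalfTwist a) : IsHalfTwist a⁻¹ := by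
  have key : ∀ x y : BraidGroup n, IsConj x y → IsConj x⁻¹ y⁻¹ := by
    intro x y hxy
    rw [isConj_iff] at hxy ⊢
    obtain ⟨c, rfl⟩ := hxy
    exact ⟨c, by group⟩
  obtain ⟨i, h | h⟩ := h
  · exact ⟨i, Or.inr (key _ _ h)⟩
  · exact ⟨i, Or.inl (by simpa using key _ _ h)⟩

theorem isHalfTwist_braidGen {n : ℕ} (i : Fin (n - 1)) : IsHalfTwist (braidGen (n := n) i) :=
  ⟨i, Or.inl (IsConj.refl _)⟩

theorem isHalfTwist_conj {n : ℕ} {a : BraidGroup n} (h : IsHalfTwist a) (g : BraidGroup n) :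
    IsHalfTwist (g * a * g⁻¹) :=
  h.of_isConj (isConj_iff.2 ⟨g, rfl⟩)

theorem braidToPerm_braidGen {n : ℕ} (i : Fin (n - 1)) :
    braidToPerm n (braidGen i) = adjacentSwap i := by
  simp [braidToPerm, braidGen]

theorem braidGen_braided {n : ℕ} (i j : Fin (n - 1)) (h : (i : ℕ) + 1 = j) :
    (braidGen i * braidGen j * braidGen i : BraidGroup n) = braidGen j * braidGen i * braidGen j :=
  mul_inv_eq_one.1 <| PresentedGroup.one_of_mem (rels := {r | BraidRelator n r})
    (show _ ∈ {r | BraidRelator n r} from BraidRelator.braid i j h)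

theorem braidGen_comm {n : ℕ} (i j : Fin (n - 1)) (h : (i : ℕ) + 1 < j) :
    (braidGen i * braidGen j : BraidGroup n) = braidGen j * braidGen i :=
  mul_inv_eq_one.1 <| PresentedGroup.one_of_mem (rels := {r | BraidRelator n r})
    (show _ ∈ {r | BraidRelator n r} from BraidRelator.comm i j h)

/-- A choice of a half twist over each transposition, such that the half twists over two
transpositions which do not commute satisfy the braid relation. -/
def IsBraidSection {n : ℕ} (h : Equiv.Perm (Fin n) → BraidGroup n) : Prop :=
  ∀ τ : Equiv.Perm (Fin n), τ.IsSwap → IsHalfTwist (h τ) ∧ braidToPerm n (h τ) = τ ∧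
    ∀ τ' : Equiv.Perm (Fin n), τ'.IsSwap → (τ * τ') ^ 2 ≠ 1 → h τ * h τ' * h τ = h τ' * h τ * h τ'

theorem exists_braidSection_three : ∃ h : Equiv.Perm (Fin 3) → BraidGroup 3, IsBraidSection h := by
  let s : Fin 2 → BraidGroup 3 := fun i => braidGen (n := 3) i
  have h01 : s 0 * s 1 * s 0 = s 1 * s 0 * s 1 := braidGen_braided (n := 3) 0 1 rfl
  refine ⟨fun τ => if τ = Equiv.swap 0 1 then s 0 else if τ = Equiv.swap 1 2 then s 1
    else s 1 * s 0 * (s 1)⁻¹, ?_⟩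
  have hs : ∀ τ : Equiv.Perm (Fin 3), τ.IsSwap →
      τ = Equiv.swap 0 1 ∨ τ = Equiv.swap 1 2 ∨ τ = Equiv.swap 0 2 := by
    rintro τ ⟨x, y, hxy, rfl⟩
    revert x y; decide
  have e1 : (Equiv.swap 1 2 : Equiv.Perm (Fin 3)) ≠ Equiv.swap 0 1 := by decide
  have e2 : (Equiv.swap 0 2 : Equiv.Perm (Fin 3)) ≠ Equiv.swap 0 1 := by decide
  have e3 : (Equiv.swap 0 2 : Equiv.Perm (Fin 3)) ≠ Equiv.swap 1 2 := by decide
  have p0 : braidToPerm 3 (s 0) = Equiv.swap 0 1 := braidToPerm_braidGen (n := 3) 0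
  have p1 : braidToPerm 3 (s 1) = Equiv.swap 1 2 := braidToPerm_braidGen (n := 3) 1
  have t0 : IsHalfTwist (s 0) := isHalfTwist_braidGen (n := 3) 0
  have t1 : IsHalfTwist (s 1) := isHalfTwist_braidGen (n := 3) 1
  intro τ hτ
  refine ⟨?_, ?_, ?_⟩
  · rcases hs τ hτ with rfl | rfl | rfl
    · simpa using t0
    · simpa [e1] using t1
    · simpa [e2, e3] using isHalfTwist_conj t0 (s 1)
  · rcases hs τ hτ with rfl | rfl | rfl
    · simpa using p0
    · simpa [e1] using p1
    · simp only [e2, e3, if_false, map_mul, map_inv, p0, p1]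
      decide
  · intro τ' hτ' _
    rcases hs τ hτ with rfl | rfl | rfl <;> rcases hs τ' hτ' with rfl | rfl | rfl <;>
      simp only [e1, e2, e3, if_true, if_false]
    · exact h01
    · exact braided_conj_left h01
    · exact h01.symm
    · exact braided_conj_right h01
    · exact (braided_conj_left h01).symm
    · exact (braided_conj_right h01).symm

/-- The six band generators do it: they are half twists along the sides and diagonals of a convex
quadrilateral, and two of these arcs with one common endpoint give braided half twists. -/
theorem exists_braidSection_four : ∃ h : Equiv.Perm (Fin 4) → BraidGroup 4, IsBraidSection h := by
  let s : Fin 3 → BraidGroup 4 := fun i => braidGen (n := 4) i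
  have h01 : s 0 * s 1 * s 0 = s 1 * s 0 * s 1 := braidGen_braided (n := 4) 0 1 rfl
  have h12 : s 1 * s 2 * s 1 = s 2 * s 1 * s 2 := braidGen_braided (n := 4) 1 2 rfl
  have h02 : s 0 * s 2 = s 2 * s 0 := braidGen_comm (n := 4) 0 2 (by decide)
  have h02' : s 2 * s 0 * (s 2)⁻¹ = s 0 := by rw [← h02, mul_inv_cancel_right]
  have h20' : (s 0)⁻¹ * s 2 * s 0 = s 2 := by rw [mul_assoc, ← h02, inv_mul_cancel_left]
  obtain ⟨u, hu⟩ : ∃ u, u = s 1 * s 0 * (s 1)⁻¹ := ⟨_, rfl⟩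
  obtain ⟨v, hv⟩ : ∃ v, v = s 2 * s 1 * (s 2)⁻¹ := ⟨_, rfl⟩
  have h2u : u * s 2 * u = s 2 * u * s 2 := by
    rw [hu, conj_eq_of_braided h01]
    have := braided_conj (s 0)⁻¹ h12
    simpa [h20'] using this
  have h0v : s 0 * v * s 0 = v * s 0 * v := by
    have := braided_conj (s 2) h01
    rwa [h02', ← hv] at this
  obtain ⟨w, hw⟩ : ∃ w, w = v * s 0 * v⁻¹ := ⟨_, rfl⟩
  -- The definition of `w` braids it with `s 0` and `v`; this second description braids it with `s
  -- 2` and `u`.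
  have hw' : w = s 2 * u * (s 2)⁻¹ := by
    have : s 2 * u * (s 2)⁻¹ = (s 2 * s 1 * (s 2)⁻¹) * (s 2 * s 0 * (s 2)⁻¹) *
        (s 2 * s 1 * (s 2)⁻¹)⁻¹ := by rw [hu]; group
    rw [this, h02', ← hv, hw]
  have p0 : braidToPerm 4 (s 0) = Equiv.swap 0 1 := braidToPerm_braidGen (n := 4) 0
  have p1 : braidToPerm 4 (s 1) = Equiv.swap 1 2 := braidToPerm_braidGen (n := 4) 1
  have p2 : braidToPerm 4 (s 2) = Equiv.swap 2 3 := braidToPerm_braidGen (n := 4) 2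
  have pu : braidToPerm 4 u = Equiv.swap 0 2 := by
    rw [hu]; simp only [map_mul, map_inv, p0, p1]; decide
  have pv : braidToPerm 4 v = Equiv.swap 1 3 := by
    rw [hv]; simp only [map_mul, map_inv, p2, p1]; decide
  have pw : braidToPerm 4 w = Equiv.swap 0 3 := by
    rw [hw]; simp only [map_mul, map_inv, pv, p0]; decide
  have t0 : IsHalfTwist (s 0) := isHalfTwist_braidGen (n := 4) 0
  have t1 : IsHalfTwist (s 1) := isHalfTwist_braidGen (n := 4) 1
  have t2 : IsHalfTwist (s 2) := isHalfTwist_braidGen (n := 4) 2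
  have tu : IsHalfTwist u := hu ▸ isHalfTwist_conj t0 _
  have tv : IsHalfTwist v := hv ▸ isHalfTwist_conj t1 _
  have tw : IsHalfTwist w := hw ▸ isHalfTwist_conj t0 _
  have h0u : s 0 * u * s 0 = u * s 0 * u := hu ▸ braided_conj_left h01
  have h1u : s 1 * u * s 1 = u * s 1 * u := hu ▸ braided_conj_right h01
  have h1v : s 1 * v * s 1 = v * s 1 * v := hv ▸ braided_conj_left h12
  have h2v : s 2 * v * s 2 = v * s 2 * v := hv ▸ braided_conj_right h12
  have h0w : s 0 * w * s 0 = w * s 0 * w := hw ▸ braided_conj_left h0v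
  have hvw : v * w * v = w * v * w := hw ▸ braided_conj_right h0v
  have huw : u * w * u = w * u * w := hw' ▸ braided_conj_left h2u
  have h2w : s 2 * w * s 2 = w * s 2 * w := hw' ▸ braided_conj_right h2u
  let h : Equiv.Perm (Fin 4) → BraidGroup 4 := fun τ =>
    if τ = Equiv.swap 0 1 then s 0 else if τ = Equiv.swap 1 2 then s 1
    else if τ = Equiv.swap 2 3 then s 2 else if τ = Equiv.swap 0 2 then u
    else if τ = Equiv.swap 1 3 then v else w
  have e0 : h (Equiv.swap 0 1) = s 0 := if_pos rfl
  have e1 : h (Equiv.swap 1 2) = s 1 := (if_neg (by decide)).trans (if_pos rfl)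
  have e2 : h (Equiv.swap 2 3) = s 2 :=
    (if_neg (by decide)).trans <| (if_neg (by decide)).trans (if_pos rfl)
  have eu : h (Equiv.swap 0 2) = u := (if_neg (by decide)).trans <|
    (if_neg (by decide)).trans <| (if_neg (by decide)).trans (if_pos rfl)
  have ev : h (Equiv.swap 1 3) = v := (if_neg (by decide)).trans <| (if_neg (by decide)).trans <|
    (if_neg (by decide)).trans <| (if_neg (by decide)).trans (if_pos rfl)
  have ew : h (Equiv.swap 0 3) = w := (if_neg (by decide)).trans <| (if_neg (by decide)).trans <|
    (if_neg (by decide)).trans <| (if_neg (by decide)).trans (if_neg (by decide))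
  clear_value h s
  have hs : ∀ τ : Equiv.Perm (Fin 4), τ.IsSwap →
      τ = Equiv.swap 0 1 ∨ τ = Equiv.swap 1 2 ∨ τ = Equiv.swap 2 3 ∨ τ = Equiv.swap 0 2 ∨
        τ = Equiv.swap 1 3 ∨ τ = Equiv.swap 0 3 := by
    rintro τ ⟨x, y, hxy, rfl⟩
    revert x y; decide
  refine ⟨h, fun τ hτ => ⟨?_, ?_, fun τ' hτ' hc => ?_⟩⟩
  · rcases hs τ hτ with rfl | rfl | rfl | rfl | rfl | rfl <;> simpa only [e0, e1, e2, eu, ev, ew]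
  · rcases hs τ hτ with rfl | rfl | rfl | rfl | rfl | rfl <;> simpa only [e0, e1, e2, eu, ev, ew]
  · rcases hs τ hτ with rfl | rfl | rfl | rfl | rfl | rfl <;>
      rcases hs τ' hτ' with rfl | rfl | rfl | rfl | rfl | rfl <;>
      simp only [e0, e1, e2, eu, ev, ew] <;>
      first
        | assumption
        | (symm; assumption)
        | exact absurd (by decide) hc

/-- In `S_n`, the half twists of a section are equal or braided along a twist region which
permutes its two strands trivially. -/
theorem IsBraidSection.eq_or_braided {n : ℕ} {h : Equiv.Perm (Fin n) → BraidGroup n}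
    (hh : IsBraidSection h) {a b : Equiv.Perm (Fin n)} (ha : a.IsSwap) (hb : b.IsSwap) {q : ℤ}
    (hq : (a * b) ^ q = 1) (hab : Odd q ∨ ((a * b) ^ 2 = 1 → a = b)) :
    a = b ∨ 3 ∣ q ∧ h a * h b * h a = h b * h a * h b := by
  obtain ⟨x, y, _, rfl⟩ := ha
  have haa := Equiv.swap_mul_self x y
  have ha : (Equiv.swap x y).IsSwap := ⟨x, y, ‹_›, rfl⟩
  generalize Equiv.swap x y = a at *
  have hbb : b * b = 1 := by
    obtain ⟨x, y, _, rfl⟩ := hb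
    exact Equiv.swap_mul_self x y
  have ha' : a⁻¹ = a := inv_eq_of_mul_eq_one_left haa
  have hb' : b⁻¹ = b := inv_eq_of_mul_eq_one_left hbb
  have eq_of : a * b = 1 → a = b := fun h => by rw [mul_eq_one_iff_eq_inv.1 h, hb']
  by_cases h2 : (a * b) ^ 2 = 1
  · left
    rcases hab with ⟨k, rfl⟩ | hab
    · apply eq_of
      rw [zpow_add, zpow_mul, zpow_one] at hq
      have : (a * b) ^ (2 : ℤ) = 1 := by exact_mod_cast h2
      rwa [this, one_zpow, one_mul] at hq
    · exact hab h2
  · right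
    have hbr := (hh a ha).2.2 b hb h2
    refine ⟨?_, hbr⟩
    -- Projected to `S_n`, the braid relation says that `a * b` has order 3.
    have h3 := congrArg (braidToPerm n) hbr
    simp only [map_mul, (hh a ha).2.1, (hh b hb).2.1] at h3
    have h4 : (a * b) ^ 3 = 1 := by
      calc (a * b) ^ 3 = (a * b * a) * (b * a * b) := by simp [pow_succ, mul_assoc]
        _ = a * b * (a * a) * b * a := by rw [← h3]; simp only [mul_assoc]
        _ = 1 := by rw [haa, mul_one, mul_assoc a, hbb, mul_one, haa]
    have : Fact (Nat.Prime 3) := ⟨Nat.prime_three⟩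
    have h5 : orderOf (a * b) = 3 := by
      apply orderOf_eq_prime h4
      intro h1
      exact h2 (by rw [h1, one_pow])
    have h6 := orderOf_dvd_iff_zpow_eq_one.2 hq
    rw [h5] at h6
    exact_mod_cast h6

/-! ### Lifts in which every twist region returns its bottom colors -/

section Lift

variable {m : ℕ} [NeZero m] {q : Fin m → ℤ} {n : ℕ}

theorem lifts_of_topColor_eq {φ : PretzelGroup q →* Equiv.Perm (Fin n)} (x : Fin m → BraidGroup n)
    (h1 : ∀ i, IsHalfTwist (x i)) (h2 : ∀ i, braidToPerm n (x i) = bottomColor φ i)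
    (h3 : ∀ i, topColor q x i = x i) : LiftsToSimpleBraidColoring φ := by
  obtain ⟨ψ, hψ⟩ := exists_coloring (q := q) x (fun i => by simp [h3])
  refine ⟨ψ, fun s => ?_, ?_⟩
  · rw [hψ]
    obtain ⟨k, hk⟩ := strandColor_eq_twist x s
    rw [hk]
    rcases isConj_twist (x s.region) (x s.region * (x (s.region + 1))⁻¹) k with h | h
    · exact (h1 _).of_isConj h
    · rw [inv_mul_cancel_left] at h
      exact (h1 _).inv.of_isConj h
  · apply coloring_ext
    intro i
    rw [← h2, ← bottomColor_of_strandColor hψ]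
    rfl

theorem IsSimplePermColoring.mul_self {φ : PretzelGroup q →* Equiv.Perm (Fin n)}
    (hφ : IsSimplePermColoring φ) (i : Fin m) : bottomColor φ i * bottomColor φ i = 1 := by
  obtain ⟨x, y, _, h⟩ := hφ ⟨i, 0, StrandSide.left⟩
  unfold bottomColor
  rw [h]
  exact Equiv.swap_mul_self x y

theorem IsSimplePermColoring.inv_eq {φ : PretzelGroup q →* Equiv.Perm (Fin n)}
    (hφ : IsSimplePermColoring φ) (i : Fin m) : (bottomColor φ i)⁻¹ = bottomColor φ i :=
  inv_eq_of_mul_eq_one_left (hφ.mul_self i)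

theorem IsSimplePermColoring.topColor_eq {φ : PretzelGroup q →* Equiv.Perm (Fin n)}
    (hφ : IsSimplePermColoring φ) (i : Fin m) :
    topColor q (bottomColor φ) i =
      (bottomColor φ i * bottomColor φ (i + 1)) ^ (q i) * bottomColor φ i := by
  unfold topColor
  rw [hφ.inv_eq (i + 1)]
  apply twist_eq_pow_mul _ _ _ (hφ.mul_self i)
  rw [mul_inv_rev, hφ.inv_eq, hφ.inv_eq, ← mul_assoc, hφ.mul_self, one_mul]

/-- If one twist region permutes its two strands trivially, so do all of them. -/
theorem IsSimplePermColoring.pow_eq_one {φ : PretzelGroup q →* Equiv.Perm (Fin n)}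
    (hφ : IsSimplePermColoring φ) (i₀ : Fin m)
    (h₀ : (bottomColor φ i₀ * bottomColor φ (i₀ + 1)) ^ (q i₀) = 1) (i : Fin m) :
    (bottomColor φ i * bottomColor φ (i + 1)) ^ (q i) = 1 := by
  have key : ∀ i, (bottomColor φ i)⁻¹ * topColor q (bottomColor φ) i = 1 ↔
      (bottomColor φ i * bottomColor φ (i + 1)) ^ (q i) = 1 := by
    intro i
    rw [hφ.topColor_eq, inv_mul_eq_one]
    exact ⟨fun h => (mul_eq_right.1 h.symm), fun h => by rw [h, one_mul]⟩
  refine (key i).1 ?_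
  refine Fin.cyclic_induction (p := fun i => (bottomColor φ i)⁻¹ * topColor q (bottomColor φ) i = 1)
    i₀ ((key i₀).2 h₀) (fun j hj => ?_) i
  rw [coloring_top, hj]

/-- If the exponents at `i` and `i + 1` are opposite, the two bottom strands of region `i` carry `h
a` and `h b` with the same exponent, and `IsBraidSection.eq_or_braided` applies. If they agree,
either there is no crossing or `d = 1`, and then an even number of half twists does nothing. -/
theorem lifts_of_section {φ : PretzelGroup q →* Equiv.Perm (Fin n)} (hφ : IsSimplePermColoring φ)
    {h : Equiv.Perm (Fin n) → BraidGroup n} (hh : IsBraidSection h) (s : Fin m → ℤˣ)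
    (hq : ∀ i, (bottomColor φ i * bottomColor φ (i + 1)) ^ (q i) = 1)
    (hs : ∀ i, (s (i + 1) = -s i ∧ (Odd (q i) ∨ n = 3)) ∨
      (s (i + 1) = s i ∧ Even (q i) ∧ (q i = 0 ∨ bottomColor φ i = bottomColor φ (i + 1)))) :
    LiftsToSimpleBraidColoring φ := by
  have hsw : ∀ i, (bottomColor φ i).IsSwap := fun i => hφ _
  have hsign : ∀ i, s i = 1 ∨ s i = -1 := fun i => Int.units_eq_one_or _
  refine lifts_of_topColor_eq (fun i => h (bottomColor φ i) ^ (s i : ℤ)) (fun i => ?_)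
    (fun i => ?_) (fun i => ?_)
  · have h1 := (hh _ (hsw i)).1
    rcases hsign i with h2 | h2 <;> simp only [h2]
    · simpa using h1
    · simpa using h1.inv
  · have h1 := (hh _ (hsw i)).2.1
    rcases hsign i with h2 | h2 <;> simp [h2, h1, hφ.inv_eq]
  · unfold topColor
    rcases hs i with ⟨h1, h2⟩ | ⟨h1, h2, h3⟩
    · have h3 : bottomColor φ i = bottomColor φ (i + 1) ∨ 3 ∣ q i ∧
          h (bottomColor φ i) * h (bottomColor φ (i + 1)) * h (bottomColor φ i) =
          h (bottomColor φ (i + 1)) * h (bottomColor φ i) * h (bottomColor φ (i + 1)) := by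
        apply hh.eq_or_braided (hsw _) (hsw _) (hq i)
        refine h2.imp id ?_
        rintro rfl
        have : ∀ a b : Equiv.Perm (Fin 3), a.IsSwap → b.IsSwap → (a * b) ^ 2 = 1 → a = b := by
          rintro a b ⟨x, y, hxy, rfl⟩ ⟨x', y', hxy', rfl⟩
          revert x y x' y'; decide
        exact this _ _ (hsw _) (hsw _)
      rcases h3 with h3 | ⟨h3, h4⟩
      · simp only [← h3, h1]
        simp only [Units.val_neg, zpow_neg, inv_inv]
        exact twist_mul_self _
      · rcases hsign i with h5 | h5 <;> simp only [h1, h5]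
        · simpa using twist_eq_self_of_braided h4 h3
        · simpa using twist_eq_self_of_braided (braided_inv h4) h3
    · rcases h3 with h3 | h3
      · rw [h3, twist_zero]
      · obtain ⟨k, hk⟩ := h2
        simp only [← h3, h1]
        rw [hk, ← two_mul, twist_two_mul]
        simp

end Lift

/-! ### Half twists of three strands as transvections -/

/-- The standard symplectic form on `ℤ²`. -/
def symp (v w : ℤ × ℤ) : ℤ := v.1 * w.2 - v.2 * w.1

/-- The transvection `x ↦ x + ε ω(v, x) v`. -/
def transvection (v : ℤ × ℤ) (ε : ℤ) : Matrix.SpecialLinearGroup (Fin 2) ℤ :=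
  ⟨!![1 - ε * v.1 * v.2, ε * v.1 ^ 2; -(ε * v.2 ^ 2), 1 + ε * v.1 * v.2], by
    rw [Matrix.det_fin_two_of]; ring⟩

theorem transvection_coe (v : ℤ × ℤ) (ε : ℤ) :
    (transvection v ε : Matrix (Fin 2) (Fin 2) ℤ) =
      !![1 - ε * v.1 * v.2, ε * v.1 ^ 2; -(ε * v.2 ^ 2), 1 + ε * v.1 * v.2] := rfl

theorem transvection_ext_iff {v w : ℤ × ℤ} {ε δ : ℤ} :
    transvection v ε = transvection w δ ↔ ε * (v.1 * v.2) = δ * (w.1 * w.2) ∧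
      ε * v.1 ^ 2 = δ * w.1 ^ 2 ∧ ε * v.2 ^ 2 = δ * w.2 ^ 2 := by
  rw [Matrix.SpecialLinearGroup.ext_iff]
  simp only [transvection_coe, Fin.forall_fin_two, Matrix.of_apply,
    Matrix.cons_val_zero, Matrix.cons_val_one]
  constructor
  · rintro ⟨⟨h1, h2⟩, h3, h4⟩
    exact ⟨by linarith, h2, by linarith⟩
  · rintro ⟨h1, h2, h3⟩
    exact ⟨⟨by linarith, h2⟩, by linarith, by linarith⟩

theorem transvection_mul_neg (v : ℤ × ℤ) (ε : ℤ) : transvection v ε * transvection v (-ε) = 1 := by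
  refine Matrix.SpecialLinearGroup.ext _ _ fun i j => ?_
  rw [Matrix.SpecialLinearGroup.coe_mul, transvection_coe, transvection_coe]
  fin_cases i <;> fin_cases j <;> simp [Matrix.mul_apply, Fin.sum_univ_two] <;> ring

theorem transvection_inv (v : ℤ × ℤ) (ε : ℤ) : (transvection v ε)⁻¹ = transvection v (-ε) :=
  inv_eq_of_mul_eq_one_right (transvection_mul_neg v ε)

theorem transvection_conj (v w : ℤ × ℤ) (ε δ : ℤ) :
    transvection v ε * transvection w δ * (transvection v ε)⁻¹ =
      transvection (w + (ε * symp v w) • v) δ := by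
  rw [transvection_inv]
  refine Matrix.SpecialLinearGroup.ext _ _ fun i j => ?_
  simp only [Matrix.SpecialLinearGroup.coe_mul, transvection_coe]
  fin_cases i <;> fin_cases j <;> simp [Matrix.mul_apply, Fin.sum_univ_two, symp] <;> ring

theorem transvection_smul {e : ℤ} (he : e = 1 ∨ e = -1) (v : ℤ × ℤ) (ε : ℤ) :
    transvection (e • v) ε = transvection v ε := by
  rw [transvection_ext_iff]
  rcases he with rfl | rfl <;> simp

/-- The matrix entries are `ε` times the products of two coordinates of `v`: the sign of the squares
gives `ε`, and the products then give `v` up to sign. -/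
theorem eq_of_transvection_eq {v w : ℤ × ℤ} {ε δ : ℤ} (hε : ε = 1 ∨ ε = -1)
    (hδ : δ = 1 ∨ δ = -1) (hv : IsCoprime v.1 v.2) (h : transvection v ε = transvection w δ) :
    ε = δ ∧ ∃ μ : ℤ, (μ = 1 ∨ μ = -1) ∧ v = μ • w := by
  rw [transvection_ext_iff] at h
  obtain ⟨h1, h2, h3⟩ := h
  have h0 : 0 < v.1 ^ 2 + v.2 ^ 2 := by
    by_contra hc
    have ha : v.1 = 0 := by nlinarith [sq_nonneg v.1, sq_nonneg v.2]
    have hb : v.2 = 0 := by nlinarith [sq_nonneg v.1, sq_nonneg v.2]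
    rw [ha, hb] at hv
    exact not_isCoprime_zero_zero hv
  have hεδ : ε = δ := by
    rcases hε with rfl | rfl <;> rcases hδ with rfl | rfl
    · rfl
    · nlinarith [sq_nonneg w.1, sq_nonneg w.2]
    · nlinarith [sq_nonneg w.1, sq_nonneg w.2]
    · rfl
  refine ⟨hεδ, ?_⟩
  subst hεδ
  have hne : ε ≠ 0 := by rcases hε with rfl | rfl <;> simp
  replace h1 := mul_left_cancel₀ hne h1
  replace h2 := mul_left_cancel₀ hne h2
  replace h3 := mul_left_cancel₀ hne h3
  obtain ⟨a, b⟩ := v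
  obtain ⟨c, d⟩ := w
  dsimp only at h1 h2 h3 h0 ⊢
  clear hv
  rcases sq_eq_sq_iff_eq_or_eq_neg.1 h2 with rfl | rfl
  · by_cases ha : a = 0
    · subst ha
      rcases sq_eq_sq_iff_eq_or_eq_neg.1 h3 with rfl | rfl
      · exact ⟨1, by simp, by simp⟩
      · exact ⟨-1, by simp, by simp⟩
    · exact ⟨1, by simp, by simp [mul_left_cancel₀ ha h1]⟩
  · by_cases hc : c = 0
    · subst hc
      rcases sq_eq_sq_iff_eq_or_eq_neg.1 h3 with rfl | rfl
      · exact ⟨1, by simp, by simp⟩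
      · exact ⟨-1, by simp, by simp⟩
    · refine ⟨-1, by simp, ?_⟩
      have : -b = d := mul_left_cancel₀ hc (by linarith)
      simp [← this]

/-- The action of `SL(2, ℤ)` on `B₃`-colors. -/
def braidToSL : BraidGroup 3 →* Matrix.SpecialLinearGroup (Fin 2) ℤ :=
  PresentedGroup.toGroup
    (f := fun i : Fin (3 - 1) => if i.val = 0 then transvection (1, 0) 1 else transvection (0, 1) 1)
    (by
      rintro r (⟨i, j, h⟩ | ⟨i, j, h⟩)
      · omega
      · have hi : i.val = 0 := by omega
        have hj : j.val ≠ 0 := by omega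
        simp only [map_mul, map_inv, FreeGroup.lift_apply_of, mul_inv_eq_one, hi, hj, if_true,
          if_false]
        refine Matrix.SpecialLinearGroup.ext _ _ fun i j => ?_
        simp only [Matrix.SpecialLinearGroup.coe_mul, transvection_coe]
        fin_cases i <;> fin_cases j <;> simp [Matrix.mul_apply, Fin.sum_univ_two])

theorem braidToSL_braidGen (i : Fin (3 - 1)) :
    braidToSL (braidGen (n := 3) i) =
      if i.val = 0 then transvection (1, 0) 1 else transvection (0, 1) 1 := by
  simp [braidToSL, braidGen]

theorem exists_conj_transvection (g : Matrix.SpecialLinearGroup (Fin 2) ℤ) {v : ℤ × ℤ}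
    (hv : IsCoprime v.1 v.2) : ∃ w : ℤ × ℤ, IsCoprime w.1 w.2 ∧
      ∀ ε, g * transvection v ε * g⁻¹ = transvection w ε := by
  have hd := Matrix.det_fin_two g.1
  rw [g.2] at hd
  refine ⟨(g 0 0 * v.1 + g 0 1 * v.2, g 1 0 * v.1 + g 1 1 * v.2), ?_, fun ε => ?_⟩
  · obtain ⟨a, b, h⟩ := hv
    refine ⟨a * g 1 1 - b * g 1 0, b * g 0 0 - a * g 0 1, ?_⟩
    linear_combination h - (a * v.1 + b * v.2) * hd
  · rw [mul_inv_eq_iff_eq_mul]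
    refine Matrix.SpecialLinearGroup.ext _ _ fun i j => ?_
    simp only [Matrix.SpecialLinearGroup.coe_mul, transvection_coe]
    fin_cases i <;> fin_cases j <;>
      simp [Matrix.mul_apply, Fin.sum_univ_two]
    · linear_combination -ε * (g 0 0 * v.1 + g 0 1 * v.2) * v.2 * hd
    · linear_combination ε * (g 0 0 * v.1 + g 0 1 * v.2) * v.1 * hd
    · linear_combination -ε * (g 1 0 * v.1 + g 1 1 * v.2) * v.2 * hd
    · linear_combination ε * (g 1 0 * v.1 + g 1 1 * v.2) * v.1 * hd

theorem IsHalfTwist.exists_transvection {b : BraidGroup 3} (h : IsHalfTwist b) :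
    ∃ (v : ℤ × ℤ) (ε : ℤ), (ε = 1 ∨ ε = -1) ∧ IsCoprime v.1 v.2 ∧
      braidToSL b = transvection v ε := by
  have h1 : ∀ i : Fin (3 - 1), ∃ v : ℤ × ℤ, IsCoprime v.1 v.2 ∧
      braidToSL (braidGen (n := 3) i) = transvection v 1 := by
    intro i
    rw [braidToSL_braidGen]
    split_ifs
    · exact ⟨(1, 0), isCoprime_one_left, rfl⟩
    · exact ⟨(0, 1), isCoprime_one_right, rfl⟩
  obtain ⟨i, h | h⟩ := h <;> obtain ⟨c, rfl⟩ := isConj_iff.1 h <;>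
    obtain ⟨v, hv, hi⟩ := h1 i <;>
    obtain ⟨w, hw, hc⟩ := exists_conj_transvection (braidToSL c) hv
  · exact ⟨w, 1, by simp, hw, by rw [map_mul, map_mul, map_inv, hi, hc]⟩
  · exact ⟨w, -1, by simp, hw, by
      rw [map_mul, map_mul, map_inv, map_inv, hi, transvection_inv, hc]⟩

/-- The isomorphism `S₃ ≅ SL(2, 𝔽₂)` as a homomorphism. -/
def permToMatrix : Equiv.Perm (Fin 3) →* Matrix (Fin 2) (Fin 2) (ZMod 2) where
  -- The action on the sum-zero vectors of `𝔽₂³` in the basis `e₀ + e₁`, `e₁ + e₂`; the coordinates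
  -- of such a vector are its entries `0` and `2`.
  toFun p := !![(if p 0 = 0 then 1 else 0) + (if p 1 = 0 then 1 else 0),
      (if p 1 = 0 then 1 else 0) + (if p 2 = 0 then 1 else 0);
      (if p 0 = 2 then 1 else 0) + (if p 1 = 2 then 1 else 0),
      (if p 1 = 2 then 1 else 0) + (if p 2 = 2 then 1 else 0)]
  map_one' := by decide
  map_mul' := by decide

theorem permToMatrix_injective : Function.Injective permToMatrix := by
  intro a b
  revert a b
  decide

/-- Reduction modulo 2. -/
def reduceModTwo : Matrix.SpecialLinearGroup (Fin 2) ℤ →* Matrix (Fin 2) (Fin 2) (ZMod 2) where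
  toFun g := (g : Matrix (Fin 2) (Fin 2) ℤ).map (Int.castRingHom (ZMod 2))
  map_one' := by simp
  map_mul' g h := by rw [Matrix.SpecialLinearGroup.coe_mul, Matrix.map_mul]

theorem reduceModTwo_transvection (v : ℤ × ℤ) {ε : ℤ} (hε : ε = 1 ∨ ε = -1) :
    reduceModTwo (transvection v ε) =
      !![1 + (v.1 : ZMod 2) * v.2, (v.1 : ZMod 2) ^ 2; (v.2 : ZMod 2) ^ 2, 1 + v.1 * v.2] := by
  have e1 : ((ε : ℤ) : ZMod 2) = 1 := by rcases hε with rfl | rfl <;> simp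
  have e2 : ∀ x : ZMod 2, -x = x := by decide
  change (transvection v ε : Matrix (Fin 2) (Fin 2) ℤ).map (Int.castRingHom (ZMod 2)) = _
  rw [transvection_coe]
  ext i j
  fin_cases i <;> fin_cases j <;> simp [e1, e2, sub_eq_add_neg]

theorem permToMatrix_braidToPerm (b : BraidGroup 3) :
    permToMatrix (braidToPerm 3 b) = reduceModTwo (braidToSL b) := by
  -- Matrices form only a monoid; passing to units makes the comparison on generators available.
  have : (permToMatrix.comp (braidToPerm 3)).toHomUnits =
      (reduceModTwo.comp braidToSL).toHomUnits := by
    refine PresentedGroup.ext fun i => Units.ext ?_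
    have h1 := braidToPerm_braidGen (n := 3) i
    have h2 := braidToSL_braidGen i
    simp only [braidGen] at h1 h2
    simp only [MonoidHom.coe_toHomUnits, MonoidHom.comp_apply, h1, h2]
    have hi : i = (0 : Fin 2) ∨ i = (1 : Fin 2) := by
      revert i; decide
    rcases hi with rfl | rfl
    · rw [if_pos (by decide), reduceModTwo_transvection _ (Or.inl rfl)]
      decide
    · rw [if_neg (by decide), reduceModTwo_transvection _ (Or.inl rfl)]
      decide
  simpa using congrArg Units.val (DFunLike.congr_fun this b)

/-- Two nonzero vectors of `𝔽₂²` with vanishing symplectic product are equal, and modulo 2 a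
transvection depends only on its vector modulo 2. -/
theorem braidToPerm_eq_of_even {b b' : BraidGroup 3} {v v' : ℤ × ℤ} {ε ε' : ℤ}
    (hε : ε = 1 ∨ ε = -1) (hε' : ε' = 1 ∨ ε' = -1) (hv : IsCoprime v.1 v.2)
    (hv' : IsCoprime v'.1 v'.2) (hb : braidToSL b = transvection v ε)
    (hb' : braidToSL b' = transvection v' ε') (h : Even (symp v v')) :
    braidToPerm 3 b = braidToPerm 3 b' := by
  apply permToMatrix_injective
  rw [permToMatrix_braidToPerm, permToMatrix_braidToPerm, hb, hb',
    reduceModTwo_transvection _ hε, reduceModTwo_transvection _ hε']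
  have key : ∀ v : ℤ × ℤ, IsCoprime v.1 v.2 → ¬ ((v.1 : ZMod 2) = 0 ∧ (v.2 : ZMod 2) = 0) := by
    rintro v ⟨x, y, hxy⟩ ⟨h1, h2⟩
    have := congrArg (Int.cast : ℤ → ZMod 2) hxy
    push_cast at this
    rw [h1, h2] at this
    simp at this
  have h1 := key v hv
  have h2 := key v' hv'
  have h3 : ((symp v v' : ℤ) : ZMod 2) = 0 := (ZMod.intCast_eq_zero_iff_even).2 h
  simp only [symp, Int.cast_sub, Int.cast_mul] at h3
  have h4 : (v.1 : ZMod 2) = v'.1 ∧ (v.2 : ZMod 2) = v'.2 := by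
    generalize (v.1 : ZMod 2) = a at *
    generalize (v.2 : ZMod 2) = b at *
    generalize (v'.1 : ZMod 2) = c at *
    generalize (v'.2 : ZMod 2) = d at *
    clear hb hb'
    revert a b c d
    decide
  rw [h4.1, h4.2]

/-! ### Lucas sequences -/

/-- The Lucas sequence with `F₀ = 0`, `F₁ = 1`, `Fₙ₊₂ = κ Fₙ₊₁ + e Fₙ`. -/
def lucasNat (e κ : ℤ) : ℕ → ℤ
  | 0 => 0
  | 1 => 1
  | n + 2 => κ * lucasNat e κ (n + 1) + e * lucasNat e κ n

/-- The extension of `lucasNat` to integral indices, for `e = ±1`. -/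
def lucas (e κ : ℤ) : ℤ → ℤ
  | Int.ofNat n => lucasNat e κ n
  | Int.negSucc n => -(-e) ^ (n + 1) * lucasNat e κ (n + 1)

section lucas

variable {e : ℤ} (κ : ℤ)

theorem lucas_natCast (n : ℕ) : lucas e κ n = lucasNat e κ n := rfl

theorem lucas_zero : lucas e κ 0 = 0 := rfl

theorem lucas_one : lucas e κ 1 = 1 := rfl

theorem lucas_neg_natCast (n : ℕ) : lucas e κ (-n) = -(-e) ^ n * lucasNat e κ n := by
  cases n with
  | zero => simp [lucas_zero, lucasNat]
  | succ n => rfl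

theorem lucas_neg_one : lucas e κ (-1) = e := by
  have := lucas_neg_natCast (e := e) κ 1
  simpa [lucasNat] using this

theorem lucas_succ (he : e * e = 1) (n : ℤ) :
    lucas e κ (n + 1) = κ * lucas e κ n + e * lucas e κ (n - 1) := by
  obtain ⟨n, rfl | rfl⟩ := n.eq_nat_or_neg
  · cases n with
    | zero => simp [lucas_zero, lucas_one, lucas_neg_one, he]
    | succ n =>
      have e1 : (((n + 1 : ℕ) : ℤ) + 1) = ((n + 2 : ℕ) : ℤ) := by push_cast; ring
      have e2 : (((n + 1 : ℕ) : ℤ) - 1) = (n : ℤ) := by push_cast; ring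
      rw [e1, e2]
      rfl
  · cases n with
    | zero => simp [lucas_zero, lucas_one, lucas_neg_one, he]
    | succ n =>
      have e1 : (-((n + 1 : ℕ) : ℤ) + 1) = -(n : ℤ) := by push_cast; ring
      have e2 : (-((n + 1 : ℕ) : ℤ) - 1) = -((n + 2 : ℕ) : ℤ) := by push_cast; ring
      rw [e1, e2, lucas_neg_natCast, lucas_neg_natCast, lucas_neg_natCast]
      have : lucasNat e κ (n + 2) = κ * lucasNat e κ (n + 1) + e * lucasNat e κ n := rfl
      rw [this, pow_succ, pow_add]
      generalize lucasNat e κ (n + 1) = x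
      generalize lucasNat e κ n = y
      generalize (-e) ^ n = z
      linear_combination (e * z * κ * x + z * y + z * y * e ^ 2) * he

end lucas

theorem Int.forall_of_iff_succ {p : ℤ → Prop} (h0 : p 0) (h : ∀ n, p n ↔ p (n + 1)) (n : ℤ) :
    p n := by
  induction n using Int.induction_on with
  | zero => exact h0
  | succ n ih => exact (h _).1 ih
  | pred n ih => exact (h _).2 (by simpa using ih)

theorem mul_self_of_sign {e : ℤ} (he : e = 1 ∨ e = -1) : e * e = 1 := by
  rcases he with rfl | rfl <;> rfl

/-- The colors of the segments of a twist region whose colors at the bottom are the half twists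
`T(v, ε)` and `T(v', ε')⁻¹`. -/
theorem twist_transvection (v v' : ℤ × ℤ) {ε ε' : ℤ} (hε : ε = 1 ∨ ε = -1)
    (hε' : ε' = 1 ∨ ε' = -1) (n : ℤ) :
    twist (transvection v ε) (transvection v ε * (transvection v' ε')⁻¹) n =
      transvection (lucas (ε * ε') (ε' * symp v v') (n + 1) • v +
        (ε * ε' * lucas (ε * ε') (ε' * symp v v') n) • v') (if Even n then ε else -ε') := by
  obtain ⟨e, he⟩ : ∃ e, e = ε * ε' := ⟨_, rfl⟩
  obtain ⟨κ, hκ⟩ : ∃ κ, κ = ε' * symp v v' := ⟨_, rfl⟩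
  have hes : e = 1 ∨ e = -1 := by
    rcases hε with rfl | rfl <;> rcases hε' with rfl | rfl <;> simp [he]
  have hee : e * e = 1 := mul_self_of_sign hes
  rw [← he, ← hκ]
  let u : ℤ → ℤ × ℤ := fun n => lucas e κ (n + 1) • v + (e * lucas e κ n) • v'
  let s : ℤ → ℤ := fun n => if Even n then ε else -ε'
  have hu : ∀ n, u (n + 1) = κ • u n + e • u (n - 1) := by
    intro n
    simp only [u, sub_add_cancel]
    rw [lucas_succ κ hee (n + 1), lucas_succ κ hee n, add_sub_cancel_right]
    ext
    · simp; ring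
    · simp; ring
  have hs : ∀ n, s (n + 1) = s (n - 1) := by
    intro n
    simp only [s, Int.even_add_one, Int.even_sub_one]
  have hs' : ∀ n, s (n + 1) = -e * s n := by
    intro n
    simp only [s, Int.even_add_one]
    by_cases hn : Even n <;>
      rcases hε with rfl | rfl <;> rcases hε' with rfl | rfl <;> simp [he, hn]
  have hu0 : u 0 = v := by simp [u, lucas_zero, lucas_one]
  have hu1 : u (-1) = v' := by
    simp only [u, neg_add_cancel, lucas_zero, lucas_neg_one, hee, zero_smul, one_smul, zero_add]
  have hs0 : s 0 = ε := by simp [s]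
  have hs1 : s (-1) = -ε' := by simp [s]
  -- This conserved quantity turns the linear recursion into conjugation: the transvection along `u
  -- n` moves `u (n - 1)` to `u (n - 1) + e κ u n = e u (n + 1)`.
  have inv : ∀ n, e * s n * symp (u n) (u (n - 1)) = κ := by
    refine Int.forall_of_iff_succ ?_ fun n => ?_
    · rw [zero_sub, hu0, hu1, hs0, he, hκ, mul_right_comm ε, mul_self_of_sign hε, one_mul]
    · have : e * s (n + 1) * symp (u (n + 1)) (u (n + 1 - 1)) = e * s n * symp (u n) (u (n - 1)) := by
        rw [add_sub_cancel_right, hu, hs']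
        simp only [symp, Prod.fst_add, Prod.smul_fst, smul_eq_mul, Prod.snd_add, Prod.smul_snd]
        linear_combination (e * s n * ((u n).1 * (u (n - 1)).2 - (u n).2 * (u (n - 1)).1)) * hee
      rw [this]
  have conj : ∀ n, transvection (u (n + 1)) (s (n + 1)) = transvection (u n) (s n) *
      transvection (u (n - 1)) (s (n - 1)) * (transvection (u n) (s n))⁻¹ := by
    intro n
    rw [transvection_conj, hs, hu, ← inv n, ← transvection_smul hes
      (u (n - 1) + (s n * symp (u n) (u (n - 1))) • u n)]
    congr 1
    ext
    · simp; ring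
    · simp; ring
  have prod : ∀ n, transvection (u n) (s n) * transvection (u (n - 1)) (s (n - 1)) =
      transvection v ε * (transvection v' ε')⁻¹ := by
    refine Int.forall_of_iff_succ ?_ fun n => ?_
    · rw [zero_sub, hu0, hu1, hs0, hs1, transvection_inv]
    · rw [add_sub_cancel_right, conj, inv_mul_cancel_right]
  change twist _ _ n = transvection (u n) (s n)
  revert n
  refine Int.forall_of_iff_succ ?_ fun n => ?_
  · rw [twist_zero, hu0, hs0]
  · rw [twist_succ, ← prod (n + 1), add_sub_cancel_right, mul_inv_eq_iff_eq_mul, mul_right_inj]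
    exact eq_comm

/-! ### Vectors and signs at the two ends of the twist regions -/

section BraidColoring

variable {m : ℕ} [NeZero m] {q : Fin m → ℤ}

/-- The left segments at the bottom and at the top of region `i` have the colors `T(v i, ε i)` and
`T(w i, η i)`, where `v i` is primitive and `ω(v i, w i) = C`. -/
structure IsTransvectionData (q : Fin m → ℤ) (v w : Fin m → ℤ × ℤ) (ε η : Fin m → ℤ) (C : ℤ) :
    Prop where
  sign : ∀ i, ε i = 1 ∨ ε i = -1
  coprime : ∀ i, IsCoprime (v i).1 (v i).2
  symp_eq : ∀ i, symp (v i) (w i) = C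
  nonneg : 0 ≤ C
  left_sign : ∀ i, η i = if Even (q i) then ε i else -ε (i + 1)
  right_sign : ∀ i, η (i + 1) = if Even (q i) then ε (i + 1) else -ε i
  left_vec : ∀ i, ∃ μ : ℤ, (μ = 1 ∨ μ = -1) ∧
    w i = μ • (lucas (ε i * ε (i + 1)) (ε (i + 1) * symp (v i) (v (i + 1))) (q i + 1) • v i +
      (ε i * ε (i + 1) * lucas (ε i * ε (i + 1)) (ε (i + 1) * symp (v i) (v (i + 1))) (q i)) •
        v (i + 1))
  right_vec : ∀ i, ∃ μ : ℤ, (μ = 1 ∨ μ = -1) ∧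
    w (i + 1) = μ • (lucas (ε i * ε (i + 1)) (ε (i + 1) * symp (v i) (v (i + 1))) (q i) • v i +
      (ε i * ε (i + 1) * lucas (ε i * ε (i + 1)) (ε (i + 1) * symp (v i) (v (i + 1))) (q i - 1)) •
        v (i + 1))

theorem topColor_succ {G : Type*} [Group G] {x : Fin m → G} {i : Fin m}
    (h : (x (i + 1))⁻¹ * topColor q x (i + 1) = (x i)⁻¹ * topColor q x i) :
    topColor q x (i + 1) = (twist (x i) (x i * (x (i + 1))⁻¹) (q i - 1))⁻¹ := by
  rw [twist_pred]
  rw [inv_mul_eq_iff_eq_mul] at h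
  rw [h, topColor]
  group

/-- Each region describes two top vectors: `w i` by its left strand and, through the top arc, `w (i
+ 1)` by its right strand. The two descriptions give the same `|ω(v, w)|` at `i` and at `i + 1`. -/
theorem exists_transvectionData {ψ : PretzelGroup q →* BraidGroup 3}
    (hψ : IsSimpleBraidColoring ψ) : ∃ v w ε η C, IsTransvectionData q v w ε η C ∧
      ∀ i, Even (symp (v i) (v (i + 1))) →
        braidToPerm 3 (bottomColor ψ i) = braidToPerm 3 (bottomColor ψ (i + 1)) := by
  choose v ε hε hv hvε using fun i => (hψ ⟨i, 0, StrandSide.left⟩).exists_transvection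
  choose w η hη hw hwη using fun i =>
    (hψ ⟨i, Fin.last _, StrandSide.left⟩).exists_transvection
  have hx : ∀ i, bottomColor (braidToSL.comp ψ) i = transvection (v i) (ε i) := hvε
  have hy : ∀ i, topColor q (bottomColor (braidToSL.comp ψ)) i = transvection (w i) (η i) := by
    intro i
    rw [← hwη, ← MonoidHom.comp_apply, coloring_eq_strandColor]
    simp only [strandColor, Fin.val_last, Int.sign_mul_natAbs, topColor]
  have hl := fun i => (hy i).symm
  have hr := fun i => (hy (i + 1)).symm.trans (topColor_succ (coloring_top (braidToSL.comp ψ) i))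
  simp only [topColor, hx, twist_transvection _ _ (hε _) (hε _)] at hl hr
  have hsgn : ∀ i (n : ℤ), (if Even n then ε i else -ε (i + 1)) = 1 ∨
      (if Even n then ε i else -ε (i + 1)) = -1 := by
    intro i n
    split_ifs
    · exact hε i
    · rcases hε (i + 1) with h | h <;> simp [h]
  choose hl1 a ha hl2 using fun i => eq_of_transvection_eq (hη i) (hsgn i _) (hw i) (hl i)
  simp only [transvection_inv] at hr
  choose hr1 b hb hr2 using fun i => eq_of_transvection_eq (hη (i + 1))
    (by rcases hsgn i (q i - 1) with h | h <;> rw [h] <;> simp) (hw (i + 1)) (hr i)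
  -- A transvection determines its vector only up to sign; this choice makes `ω(v i, w i)`
  -- nonnegative.
  let σ : Fin m → ℤ := fun i => if 0 ≤ symp (v i) (w i) then 1 else -1
  have hσ : ∀ i, σ i = 1 ∨ σ i = -1 := fun i => by
    simp only [σ]; split_ifs <;> simp
  have hσs : ∀ i, symp (v i) (σ i • w i) = |symp (v i) (w i)| := by
    intro i
    have : symp (v i) (σ i • w i) = σ i * symp (v i) (w i) := by simp [symp]; ring
    rw [this]
    simp only [σ]
    split_ifs with h
    · rw [one_mul, abs_of_nonneg h]
    · rw [abs_of_neg (not_le.1 h)]; ring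
  have hmul : ∀ x y : ℤ, (x = 1 ∨ x = -1) → (y = 1 ∨ y = -1) → (x * y = 1 ∨ x * y = -1) := by
    rintro x y (rfl | rfl) (rfl | rfl) <;> simp
  have habs : ∀ x y : ℤ, (x = 1 ∨ x = -1) → |x * y| = |y| := by
    rintro x y (rfl | rfl) <;> simp
  have hconst : ∀ i, symp (v i) (σ i • w i) = symp (v 0) (σ 0 • w 0) := by
    refine Fin.cyclic_induction 0 rfl fun i hi => ?_
    rw [← hi, hσs, hσs, hr2, hl2]
    generalize lucas (ε i * ε (i + 1)) (ε (i + 1) * symp (v i) (v (i + 1))) = F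
    have e1 : ∀ x y : ℤ, symp (v (i + 1)) (b i • (x • v i + y • v (i + 1))) =
        b i * (x * -symp (v i) (v (i + 1))) := by
      intro x y; simp [symp]; ring
    have e2 : ∀ x y : ℤ, symp (v i) (a i • (x • v i + y • v (i + 1))) =
        a i * (y * symp (v i) (v (i + 1))) := by
      intro x y; simp [symp]; ring
    rw [sub_add_cancel, e1, e2, habs _ _ (hb i), habs _ _ (ha i), mul_neg, abs_neg,
      mul_assoc, habs _ _ (hmul _ _ (hε i) (hε (i + 1)))]
  refine ⟨v, fun i => σ i • w i, ε, η, symp (v 0) (σ 0 • w 0), ⟨hε, hv, hconst, ?_, hl1, ?_, ?_, ?_⟩,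
    fun i => braidToPerm_eq_of_even (hε i) (hε (i + 1)) (hv i) (hv (i + 1)) (hvε i) (hvε (i + 1))⟩
  · rw [hσs]; exact abs_nonneg _
  · intro i
    rw [hr1]
    simp only [Int.even_sub_one]
    split_ifs <;> simp_all
  · intro i
    refine ⟨σ i * a i, hmul _ _ (hσ i) (ha i), ?_⟩
    rw [mul_smul, ← hl2]
  · intro i
    refine ⟨σ (i + 1) * b i, hmul _ _ (hσ _) (hb i), ?_⟩
    have := hr2 i
    rw [sub_add_cancel] at this
    rw [mul_smul, ← this]

/-- Both ends of a twist region. -/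
theorem IsTransvectionData.region {v w : Fin m → ℤ × ℤ} {ε η : Fin m → ℤ} {C : ℤ}
    (h : IsTransvectionData q v w ε η C) (hC : C ≠ 0) (i : Fin m) {e κ : ℤ}
    (he : e = ε i * ε (i + 1)) (hκ : κ = ε (i + 1) * symp (v i) (v (i + 1))) :
    ∃ μ : ℤ, (μ = 1 ∨ μ = -1) ∧ C = μ * ε i * κ * lucas e κ (q i) ∧
      w i = μ • (lucas e κ (q i + 1) • v i + (e * lucas e κ (q i)) • v (i + 1)) ∧
      w (i + 1) = (-e * μ) • (lucas e κ (q i) • v i + (e * lucas e κ (q i - 1)) • v (i + 1)) := by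
  obtain ⟨μ, hμ, h1⟩ := h.left_vec i
  obtain ⟨ν, hν, h2⟩ := h.right_vec i
  have h3 := h.symp_eq i
  have h4 := h.symp_eq (i + 1)
  rw [← he, ← hκ] at h1 h2
  have e1 : symp (v i) (w i) = μ * (e * lucas e κ (q i) * symp (v i) (v (i + 1))) := by
    rw [h1]; simp [symp]; ring
  have e2 : symp (v (i + 1)) (w (i + 1)) = -(ν * (lucas e κ (q i) * symp (v i) (v (i + 1)))) := by
    rw [h2]; simp [symp]; ring
  have hee : ε (i + 1) * ε (i + 1) = 1 := mul_self_of_sign (h.sign _)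
  rw [h3] at e1
  rw [h4] at e2
  refine ⟨μ, hμ, ?_, h1, ?_⟩
  · rw [e1, he, hκ]; ring
  · have h5 : lucas e κ (q i) * symp (v i) (v (i + 1)) ≠ 0 := by
      intro h0
      rw [h0] at e2
      simp at e2
      exact hC e2
    have h6 : ν = -e * μ := by
      apply mul_right_cancel₀ h5
      linarith
    rw [h2, h6]

theorem IsTransvectionData.abs_eq {v w : Fin m → ℤ × ℤ} {ε η : Fin m → ℤ} {C : ℤ}
    (h : IsTransvectionData q v w ε η C) (i : Fin m) {e κ : ℤ}
    (he : e = ε i * ε (i + 1)) (hκ : κ = ε (i + 1) * symp (v i) (v (i + 1))) :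
    C = |κ * lucas e κ (q i)| := by
  obtain ⟨μ, hμ, h1⟩ := h.left_vec i
  have h3 := h.symp_eq i
  rw [← he, ← hκ] at h1
  have hee : ε (i + 1) * ε (i + 1) = 1 := mul_self_of_sign (h.sign _)
  have e1 : symp (v i) (w i) = μ * (e * lucas e κ (q i) * symp (v i) (v (i + 1))) := by
    rw [h1]; simp [symp]; ring
  have e2 : C = μ * ε i * (κ * lucas e κ (q i)) := by
    rw [← h3, e1, he, hκ]; ring
  rw [← abs_of_nonneg h.nonneg, e2]
  rcases hμ with rfl | rfl <;> rcases h.sign i with h | h <;> simp [h]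

end BraidColoring

/-! ### The colorings which lift -/

theorem Fin.val_add_one_eq_mod {m : ℕ} [NeZero m] (i : Fin m) : (i + 1).val = (i.val + 1) % m := by
  simp [Fin.val_add]

theorem exists_alternating_signs {m : ℕ} [NeZero m] (hm : Even m) :
    ∃ s : Fin m → ℤˣ, ∀ i, s (i + 1) = -s i := by
  refine ⟨fun i => (-1) ^ i.val, fun i => ?_⟩
  have hi := i.2
  dsimp only
  rw [Fin.val_add_one_eq_mod]
  by_cases h : i.val + 1 < m
  · rw [Nat.mod_eq_of_lt h, pow_succ, mul_neg_one]
  · have h1 : i.val + 1 = m := by omega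
    have h2 : Odd i.val := by
      rw [← h1] at hm
      exact Nat.not_even_iff_odd.1 (Nat.even_add_one.1 hm)
    rw [h1, Nat.mod_self, pow_zero, h2.neg_one_pow, neg_neg]

/-- Alternating signs `1, -1, …` on the indices `1, …, m - 1` end with `-1`, because `m - 1` is
even; index `0` then gets `1`, so the only repetition is from `0` to `1`. -/
theorem exists_almost_alternating_signs {m : ℕ} [NeZero m] (hm : Odd m) :
    ∃ s : Fin m → ℤˣ, s (0 + 1) = s 0 ∧ ∀ i, i ≠ 0 → s (i + 1) = -s i := by
  have key : ∀ i : Fin m, i ≠ 0 → (i + 1).val = i.val + 1 ∨ i + 1 = 0 ∧ i.val + 1 = m := by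
    intro i _
    have hi := i.2
    have h := Fin.val_add_one_eq_mod i
    by_cases h' : i.val + 1 < m
    · left; rw [h, Nat.mod_eq_of_lt h']
    · right
      have h1 : i.val + 1 = m := by omega
      rw [h1, Nat.mod_self] at h
      exact ⟨Fin.ext h, h1⟩
  refine ⟨fun i => if i = 0 then 1 else -(-1) ^ i.val, ?_, fun i hi => ?_⟩
  · by_cases h : (0 + 1 : Fin m) = 0
    · simp [h]
    · have h2 := Fin.val_add_one_eq_mod (0 : Fin m)
      have h1 : 1 < m := by
        by_contra hc
        have : m = 1 := by have := NeZero.pos m; omega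
        subst this
        exact h (Subsingleton.elim _ _)
      rw [Fin.val_zero, zero_add, Nat.mod_eq_of_lt h1] at h2
      dsimp only
      rw [if_neg h, if_pos rfl, zero_add, h2]
      simp
  · dsimp only
    rw [if_neg hi]
    rcases key i hi with h | ⟨h, h'⟩
    · have h1 : i + 1 ≠ 0 := by
        intro h0
        rw [h0, Fin.val_zero] at h
        omega
      rw [if_neg h1, h, pow_succ, mul_neg_one]
    · have h2 : Even i.val := by
        rw [← h'] at hm
        exact Nat.not_odd_iff_even.1 (Nat.odd_add_one.1 hm)
      rw [if_pos h, h2.neg_one_pow, neg_neg]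

section

variable {m : ℕ} [NeZero m] {q : Fin m → ℤ}

theorem mul_pow_three_of_isSwap {a b : Equiv.Perm (Fin 3)} (ha : a.IsSwap) (hb : b.IsSwap) :
    (a * b) ^ 3 = 1 := by
  obtain ⟨x, y, hxy, rfl⟩ := ha
  obtain ⟨x', y', hxy', rfl⟩ := hb
  revert x y x' y'
  decide

theorem lifts_of_three_dvd (hm : Even m) (hq : ∃ i, 3 ∣ q i)
    {φ : PretzelGroup q →* Equiv.Perm (Fin 3)} (hφ : IsSimplePermColoring φ) :
    LiftsToSimpleBraidColoring φ := by
  obtain ⟨h, hh⟩ := exists_braidSection_three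
  obtain ⟨s, hs⟩ := exists_alternating_signs hm
  obtain ⟨i₀, k, hk⟩ := hq
  refine lifts_of_section hφ hh s (hφ.pow_eq_one i₀ ?_) fun i => Or.inl ⟨hs i, Or.inr rfl⟩
  have := mul_pow_three_of_isSwap (hφ ⟨i₀, 0, StrandSide.left⟩) (hφ ⟨i₀ + 1, 0, StrandSide.left⟩)
  rw [hk, zpow_mul]
  change ((bottomColor φ i₀ * bottomColor φ (i₀ + 1)) ^ 3) = 1 at this
  rw [show ((3 : ℤ)) = ((3 : ℕ) : ℤ) from rfl, zpow_natCast, this, one_zpow]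

theorem lifts_of_constant {n : ℕ} {h : Equiv.Perm (Fin n) → BraidGroup n} (hh : IsBraidSection h)
    (hm : Odd m) (hq0 : Even (q 0)) (hq : ∀ i, i ≠ 0 → Odd (q i))
    {φ : PretzelGroup q →* Equiv.Perm (Fin n)} (hφ : IsSimplePermColoring φ)
    (h0 : q 0 = 0 ∨ IsConstantOnRegion φ 0) : LiftsToSimpleBraidColoring φ := by
  obtain ⟨s, hs0, hs⟩ := exists_almost_alternating_signs hm
  have h0' : q 0 = 0 ∨ bottomColor φ 0 = bottomColor φ (0 + 1) := by
    refine h0.imp id fun h => ?_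
    have := h ⟨0, 0, StrandSide.left⟩ ⟨0, 0, StrandSide.right⟩ rfl rfl
    rwa [coloring_bottom, hφ.inv_eq] at this
  refine lifts_of_section hφ hh s (hφ.pow_eq_one 0 ?_) fun i => ?_
  · rcases h0' with h | h
    · rw [h, zpow_zero]
    · rw [← h, hφ.mul_self, one_zpow]
  · by_cases hi : i = 0
    · subst hi
      exact Or.inr ⟨hs0, hq0, h0'⟩
    · exact Or.inl ⟨hs i hi, Or.inl (hq i hi)⟩

theorem bottomColor_ne_of_not_constantOnRegion {n : ℕ} {φ : PretzelGroup q →* Equiv.Perm (Fin n)}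
    (hφ : IsSimplePermColoring φ) {i : Fin m} (h : ¬ IsConstantOnRegion φ i) :
    bottomColor φ i ≠ bottomColor φ (i + 1) := by
  intro h1
  apply h
  have key : ∀ s : PretzelStrand q, s.region = i → φ (pretzelMeridian q s) = bottomColor φ i := by
    rintro s rfl
    obtain ⟨k, hk⟩ := strandColor_eq_twist (bottomColor φ) s
    rw [coloring_eq_strandColor, hk, ← h1, mul_inv_cancel, twist_one _ _ (hφ.mul_self _)]
  intro s s' hs hs'
  rw [key s hs, key s' hs']

theorem exists_bottomColor_ne {n : ℕ} {φ : PretzelGroup q →* Equiv.Perm (Fin n)}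
    (hφ : IsSimplePermColoring φ) (h : ¬ IsConstantColoring φ) :
    ∃ i, bottomColor φ i ≠ bottomColor φ (i + 1) := by
  by_contra! hc
  apply h
  have h1 : ∀ i, bottomColor φ i = bottomColor φ 0 :=
    Fin.cyclic_induction 0 rfl fun i hi => (hc i).symm.trans hi
  have key : ∀ s : PretzelStrand q, φ (pretzelMeridian q s) = bottomColor φ 0 := by
    intro s
    obtain ⟨k, hk⟩ := strandColor_eq_twist (bottomColor φ) s
    rw [coloring_eq_strandColor, hk, h1 s.region, h1 (s.region + 1), mul_inv_cancel, twist_one _ _ (hφ.mul_self _)]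
  intro s s'
  rw [key, key]

end

/-! ### Colorings which do not lift: one even region -/

section lucas

variable {e : ℤ} (κ : ℤ)

/-- Cassini's identity: one step of the recursion multiplies this quadratic form by `-e`. -/
theorem lucas_sq (he : e * e = 1) (n : ℤ) :
    lucas e κ (n + 1) ^ 2 - κ * lucas e κ (n + 1) * lucas e κ n - e * lucas e κ n ^ 2 =
      if Even n then 1 else -e := by
  have step : ∀ n, lucas e κ (n + 1 + 1) ^ 2 - κ * lucas e κ (n + 1 + 1) * lucas e κ (n + 1) -
      e * lucas e κ (n + 1) ^ 2 = -e * (lucas e κ (n + 1) ^ 2 -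
        κ * lucas e κ (n + 1) * lucas e κ n - e * lucas e κ n ^ 2) := by
    intro n
    rw [lucas_succ κ he (n + 1), add_sub_cancel_right]
    ring
  revert n
  refine Int.forall_of_iff_succ ?_ fun n => ?_
  · simp [lucas_zero, lucas_one]
  · rw [step]
    simp only [Int.even_add_one]
    have hne : e ≠ 0 := by rintro rfl; simp at he
    by_cases hn : Even n
    · simp only [hn, if_true, not_true, if_false]
      refine ⟨fun h => by rw [h, mul_one], fun h => ?_⟩
      exact mul_left_cancel₀ (neg_ne_zero.2 hne) (by rw [h, mul_one])
    · simp only [hn, if_false, not_false_iff, if_true]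
      refine ⟨fun h => by rw [h]; linarith, fun h => ?_⟩
      exact mul_left_cancel₀ (neg_ne_zero.2 hne) (by rw [h]; linarith)

theorem lucas_coprime (he : e = 1 ∨ e = -1) (n : ℤ) :
    IsCoprime (lucas e κ (n + 1)) (lucas e κ n) := by
  have h := lucas_sq κ (mul_self_of_sign he) n
  have h1 : (if Even n then 1 else -e) = 1 ∨ (if Even n then 1 else -e) = -1 := by
    split_ifs
    · simp
    · rcases he with rfl | rfl <;> simp
  rcases h1 with h1 | h1 <;> rw [h1] at h
  · exact ⟨lucas e κ (n + 1) - κ * lucas e κ n, -e * lucas e κ n, by linear_combination h⟩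
  · exact ⟨-(lucas e κ (n + 1) - κ * lucas e κ n), e * lucas e κ n, by linear_combination -h⟩

theorem lucas_add_three (he : e * e = 1) (n : ℤ) :
    lucas e κ (n + 3) = (κ ^ 2 + e) * lucas e κ (n + 1) + e * κ * lucas e κ n := by
  have h1 := lucas_succ κ he (n + 1)
  have h2 := lucas_succ κ he (n + 2)
  rw [show n + 1 + 1 = n + 2 by ring, add_sub_cancel_right] at h1
  rw [show n + 2 + 1 = n + 3 by ring, show n + 2 - 1 = n + 1 by ring] at h2
  rw [h2, h1]
  ring

/-- By `lucas_add_three`, three steps multiply the value by the unit `-κ` modulo `κ² - 1`, which is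
divisible by 4. -/
theorem four_dvd_lucas_three_mul {κ : ℤ} (hκ : Odd κ) (k : ℤ) : 4 ∣ lucas (-1) κ (3 * k) := by
  have h4 : (4 : ℤ) ∣ κ ^ 2 + -1 := by
    obtain ⟨j, rfl⟩ := hκ
    exact ⟨j ^ 2 + j, by ring⟩
  have hc : IsCoprime (4 : ℤ) (-1 * κ) := by
    have : IsCoprime (2 : ℤ) κ := (Int.isCoprime_iff_gcd_eq_one.2 (by
      obtain ⟨j, rfl⟩ := hκ; simp))
    have h2 : IsCoprime (2 ^ 2 : ℤ) κ := this.pow_left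
    simpa using h2.neg_right
  revert k
  refine Int.forall_of_iff_succ ?_ fun k => ?_
  · simp [lucas_zero]
  · rw [show 3 * (k + 1) = 3 * k + 3 by ring, lucas_add_three κ (by norm_num),
      dvd_add_right (h4.mul_right _)]
    exact ⟨fun h => h.mul_left _, fun h => hc.dvd_of_dvd_mul_left h⟩

/-- Here `F_{n+6} = F₆ F_{n+1} + F₅ F_n` with `F₆ = κ(κ² + 1)(κ² + 3)` divisible by 4 and `F₅ = κ⁴ +
3κ² + 1` odd. -/
theorem four_dvd_lucas_six_mul {κ : ℤ} (hκ : Odd κ) (k : ℤ) : 4 ∣ lucas 1 κ (6 * k) := by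
  have h4 : (4 : ℤ) ∣ κ * (κ ^ 2 + 1) * (κ ^ 2 + 3) := by
    obtain ⟨j, rfl⟩ := hκ
    exact ⟨(2 * j + 1) * ((2 * j + 1) ^ 2 + 1) * (j ^ 2 + j + 1), by ring⟩
  have hc : IsCoprime (4 : ℤ) (κ ^ 4 + 3 * κ ^ 2 + 1) := by
    have : IsCoprime (2 : ℤ) (κ ^ 4 + 3 * κ ^ 2 + 1) := by
      obtain ⟨j, rfl⟩ := hκ
      exact ⟨-(8 * j ^ 4 + 16 * j ^ 3 + 18 * j ^ 2 + 10 * j + 2), 1, by ring⟩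
    exact this.pow_left (m := 2)
  revert k
  refine Int.forall_of_iff_succ ?_ fun k => ?_
  · simp [lucas_zero]
  · have h1 := lucas_add_three (e := 1) κ (by norm_num) (6 * k)
    have h2 := lucas_add_three (e := 1) κ (by norm_num) (6 * k + 1)
    have h3 := lucas_add_three (e := 1) κ (by norm_num) (6 * k + 3)
    have h5 := lucas_succ (e := 1) κ (by norm_num) (6 * k + 3)
    have h6 := lucas_succ (e := 1) κ (by norm_num) (6 * k + 1)
    ring_nf at h1 h2 h3 h5 h6
    have : lucas 1 κ (6 * (k + 1)) = κ * (κ ^ 2 + 1) * (κ ^ 2 + 3) * lucas 1 κ (6 * k + 1) +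
        (κ ^ 4 + 3 * κ ^ 2 + 1) * lucas 1 κ (6 * k) := by
      ring_nf
      rw [h3, h5, h1, h6]
      ring
    rw [this, dvd_add_right (h4.mul_right _)]
    exact ⟨fun h => h.mul_left _, fun h => hc.dvd_of_dvd_mul_left h⟩

theorem lucasNat_neg (n : ℕ) : lucasNat e (-κ) n = -(-1) ^ n * lucasNat e κ n := by
  induction n using Nat.twoStepInduction with
  | zero => simp [lucasNat]
  | one => simp [lucasNat]
  | more n h1 h2 =>
    have : ∀ κ, lucasNat e κ (n + 2) = κ * lucasNat e κ (n + 1) + e * lucasNat e κ n := fun _ => rfl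
    rw [this, this, h1, h2]
    ring

theorem lucasNat_pos {κ : ℤ} (hκ : 0 < κ) (n : ℕ) : 0 < lucasNat 1 κ (n + 1) := by
  induction n using Nat.twoStepInduction with
  | zero => simp [lucasNat]
  | one => simpa [lucasNat] using hκ
  | more n h1 h2 =>
    have : lucasNat 1 κ (n + 2 + 1) = κ * lucasNat 1 κ (n + 1 + 1) + 1 * lucasNat 1 κ (n + 1) := rfl
    rw [this]
    positivity

theorem lucas_ne_zero {κ : ℤ} (hκ : κ ≠ 0) {n : ℤ} (hn : n ≠ 0) : lucas 1 κ n ≠ 0 := by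
  have h1 : ∀ n : ℕ, n ≠ 0 → lucasNat 1 κ n ≠ 0 := by
    intro n hn
    obtain ⟨n, rfl⟩ := Nat.exists_eq_succ_of_ne_zero hn
    rcases lt_or_gt_of_ne hκ with h | h
    · have h2 := (lucasNat_pos (neg_pos.2 h) n).ne'
      rw [lucasNat_neg] at h2
      exact right_ne_zero_of_mul h2
    · exact (lucasNat_pos h n).ne'
  obtain ⟨n, rfl | rfl⟩ := n.eq_nat_or_neg
  · exact h1 n (by simpa using hn)
  · rw [lucas_neg_natCast]
    exact mul_ne_zero (by simp) (h1 n (by simpa using hn))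

end lucas

/-! ### Ratios of top and bottom vectors modulo an integer -/

/-- Congruence of vectors modulo `n`. -/
def VecModEq (n : ℤ) (a b : ℤ × ℤ) : Prop := n ∣ a.1 - b.1 ∧ n ∣ a.2 - b.2

theorem VecModEq.of_dvd {n k : ℤ} {a b : ℤ × ℤ} (h : VecModEq n a b) (hk : k ∣ n) :
    VecModEq k a b :=
  ⟨hk.trans h.1, hk.trans h.2⟩

theorem VecModEq.smul_congr {n r r' : ℤ} {v w : ℤ × ℤ} (h : VecModEq n w (r • v))
    (hr : n ∣ r - r') : VecModEq n w (r' • v) := by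
  obtain ⟨h1, h2⟩ := h
  simp only [Prod.smul_fst, Prod.smul_snd, smul_eq_mul] at h1 h2
  constructor
  · have := dvd_add h1 (hr.mul_right v.1)
    simp only [Prod.smul_fst, smul_eq_mul]
    rwa [show w.1 - r * v.1 + (r - r') * v.1 = w.1 - r' * v.1 by ring] at this
  · have := dvd_add h2 (hr.mul_right v.2)
    simp only [Prod.smul_snd, smul_eq_mul]
    rwa [show w.2 - r * v.2 + (r - r') * v.2 = w.2 - r' * v.2 by ring] at this

theorem VecModEq.dvd_sub {n r r' : ℤ} {v w : ℤ × ℤ} (hv : IsCoprime v.1 v.2)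
    (h : VecModEq n w (r • v)) (h' : VecModEq n w (r' • v)) : n ∣ r - r' := by
  obtain ⟨h1, h2⟩ := h
  obtain ⟨h1', h2'⟩ := h'
  simp only [Prod.smul_fst, Prod.smul_snd, smul_eq_mul] at h1 h2 h1' h2'
  obtain ⟨a, b, hab⟩ := hv
  have := dvd_add ((_root_.dvd_sub h1' h1).mul_left a) ((_root_.dvd_sub h2' h2).mul_left b)
  have e : a * (w.1 - r' * v.1 - (w.1 - r * v.1)) + b * (w.2 - r' * v.2 - (w.2 - r * v.2)) =
      r - r' := by linear_combination (r - r') * hab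
  rwa [e] at this

section

variable {m : ℕ} [NeZero m] {q : Fin m → ℤ} {v w : Fin m → ℤ × ℤ} {ε η : Fin m → ℤ} {C : ℤ}

/-- Modulo `F_{q i}` the two ends of a region decouple. The ratio of `w` to `v` is carried unchanged
from `i` to `i + 1` if `e = -1`, and negated if `e = 1`. -/
theorem IsTransvectionData.region_congr (h : IsTransvectionData q v w ε η C) (hC : C ≠ 0)
    (i : Fin m) {e κ : ℤ} (he : e = ε i * ε (i + 1))
    (hκ : κ = ε (i + 1) * symp (v i) (v (i + 1))) :
    ∃ μ : ℤ, (μ = 1 ∨ μ = -1) ∧ C = μ * ε i * κ * lucas e κ (q i) ∧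
      VecModEq (lucas e κ (q i)) (w i) ((μ * lucas e κ (q i + 1)) • v i) ∧
      VecModEq (lucas e κ (q i)) (w (i + 1)) ((-e * (μ * lucas e κ (q i + 1))) • v (i + 1)) := by
  obtain ⟨μ, hμ, hCμ, h1, h2⟩ := h.region hC i he hκ
  have hee : e * e = 1 := by
    rw [he, mul_mul_mul_comm, mul_self_of_sign (h.sign _), mul_self_of_sign (h.sign _), one_mul]
  refine ⟨μ, hμ, hCμ, ⟨⟨μ * e * (v (i + 1)).1, ?_⟩, ⟨μ * e * (v (i + 1)).2, ?_⟩⟩,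
    ⟨⟨-e * μ * (v i).1 + e * μ * κ * (v (i + 1)).1, ?_⟩,
      ⟨-e * μ * (v i).2 + e * μ * κ * (v (i + 1)).2, ?_⟩⟩⟩
  · rw [h1]; simp; ring
  · rw [h1]; simp; ring
  · rw [h2, lucas_succ κ hee]; simp; ring
  · rw [h2, lucas_succ κ hee]; simp; ring

/-- Region `0` gives `η = ε` at its left end, and every region passes this on. So each odd region
flips `ε`, and the even number `m - 1` of flips leads from `1` back to `0`. -/
theorem IsTransvectionData.signs (h : IsTransvectionData q v w ε η C) (hm : Odd m)
    (hq0 : Even (q 0)) (hq : ∀ i, i ≠ 0 → Odd (q i)) :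
    ε (0 + 1) = ε 0 ∧ ∀ i, i ≠ 0 → ε (i + 1) = -ε i := by
  have h1 : ∀ i, η i = ε i := by
    refine Fin.cyclic_induction 0 (by rw [h.left_sign, if_pos hq0]) fun i hi => ?_
    by_cases hi0 : i = 0
    · rw [h.right_sign, hi0, if_pos hq0]
    · have hne := Int.not_even_iff_odd.2 (hq i hi0)
      have h2 := h.left_sign i
      have h3 := h.right_sign i
      rw [if_neg hne] at h2 h3
      linarith
  have h2 : ∀ i, i ≠ 0 → ε (i + 1) = -ε i := by
    intro i hi
    have := h.left_sign i
    rw [if_neg (Int.not_even_iff_odd.2 (hq i hi)), h1] at this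
    linarith
  refine ⟨?_, h2⟩
  obtain ⟨s, hs0, hs⟩ := exists_almost_alternating_signs hm
  have hss : ∀ i, (s i : ℤ) * s i = 1 := fun i => by
    rw [← Units.val_mul, Int.units_mul_self, Units.val_one]
  have h3 : ∀ i, ε i = ε (0 + 1) * s (0 + 1) * s i := by
    have h4 : ε (0 + 1) = ε (0 + 1) * s (0 + 1) * s (0 + 1) := by rw [mul_assoc, hss, mul_one]
    refine Fin.cyclic_induction (0 + 1) h4 fun i hi => ?_
    by_cases hi0 : i = 0
    · rw [hi0]; exact h4
    · rw [h2 i hi0, hs i hi0, hi]; simp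
  rw [h3 0, hs0, mul_assoc, hss, mul_one]

/-- The half twists of a lift which are not equal along region `0` are independent along each
region. -/
theorem IsTransvectionData.ne_zero (h : IsTransvectionData q v w ε η C) (hm : Odd m)
    (hq0 : Even (q 0)) (hq : ∀ i, i ≠ 0 → Odd (q i)) (hne : q 0 ≠ 0)
    (h0 : ¬ Even (symp (v 0) (v (0 + 1)))) : C ≠ 0 := by
  have h1 := h.abs_eq 0 rfl rfl
  have he : ε 0 * ε (0 + 1) = 1 := by
    rw [(h.signs hm hq0 hq).1, mul_self_of_sign (h.sign 0)]
  rw [he] at h1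
  rw [h1, abs_ne_zero]
  have h2 : ε (0 + 1) * symp (v 0) (v (0 + 1)) ≠ 0 := by
    refine mul_ne_zero ?_ ?_
    · rcases h.sign (0 + 1) with h | h <;> rw [h] <;> simp
    · intro h3
      rw [h3] at h0
      simp at h0
  exact mul_ne_zero h2 (lucas_ne_zero h2 hne)

theorem odd_sign_mul {a b : ℤ} (ha : a = 1 ∨ a = -1) (hb : ¬ Even b) : Odd (a * b) := by
  rw [Int.not_even_iff_odd] at hb
  rcases ha with rfl | rfl
  · simpa using hb
  · simpa using hb.neg

/-- All moduli are divisible by 4. The ratio `r` modulo 4 survives every region except region `0`,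
which negates it; so `2r ≡ 0` modulo 4, and `F_{q 0 + 1}` would be even, against its coprimality to
`F_{q 0}`. -/
theorem IsTransvectionData.false_of_three_dvd (h : IsTransvectionData q v w ε η C) (hm : Odd m)
    (hq0 : Even (q 0)) (hq : ∀ i, i ≠ 0 → Odd (q i)) (hne : q 0 ≠ 0) (hq3 : ∀ i, 3 ∣ q i)
    (h0 : ∀ i, ¬ Even (symp (v i) (v (i + 1)))) : False := by
  have hC := h.ne_zero hm hq0 hq hne (h0 0)
  obtain ⟨hs0, hs⟩ := h.signs hm hq0 hq
  have hodd := fun i => odd_sign_mul (h.sign (i + 1)) (h0 i)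
  obtain ⟨μ, hμ, -, h1, h2⟩ := h.region_congr hC 0 (e := 1)
    (by rw [hs0, mul_self_of_sign (h.sign 0)]) rfl
  have hd : 4 ∣ lucas 1 (ε (0 + 1) * symp (v 0) (v (0 + 1))) (q 0) := by
    obtain ⟨k, hk⟩ : 6 ∣ q 0 := by
      obtain ⟨a, ha⟩ := hq0
      have := hq3 0
      omega
    rw [hk]
    exact four_dvd_lucas_six_mul (hodd 0) k
  have hcop := lucas_coprime (ε (0 + 1) * symp (v 0) (v (0 + 1))) (Or.inl rfl) (q 0)
  replace h1 := h1.of_dvd hd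
  replace h2 := h2.of_dvd hd
  obtain ⟨r, hr⟩ : ∃ r, r = μ * lucas 1 (ε (0 + 1) * symp (v 0) (v (0 + 1))) (q 0 + 1) := ⟨_, rfl⟩
  rw [← hr] at h1 h2
  have h3 : ∀ i, VecModEq 4 (w i) ((-1 * r) • v i) := by
    refine Fin.cyclic_induction (0 + 1) h2 fun i hi => ?_
    by_cases hi0 : i = 0
    · rw [hi0]; exact h2
    · obtain ⟨ν, hν, -, h4, h5⟩ := h.region_congr hC i (e := -1)
        (by rw [hs i hi0, mul_neg, mul_self_of_sign (h.sign i)]) rfl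
      have hd' : 4 ∣ lucas (-1) (ε (i + 1) * symp (v i) (v (i + 1))) (q i) := by
        obtain ⟨k, hk⟩ := hq3 i
        rw [hk]
        exact four_dvd_lucas_three_mul (hodd i) k
      replace h4 := h4.of_dvd hd'
      replace h5 := h5.of_dvd hd'
      rw [neg_neg, one_mul] at h5
      exact h5.smul_congr (h4.dvd_sub (h.coprime i) hi)
  have h4 := h1.dvd_sub (h.coprime 0) (h3 0)
  have h5 : (2 : ℤ) ∣ lucas 1 (ε (0 + 1) * symp (v 0) (v (0 + 1))) (q 0 + 1) := by
    have : (2 : ℤ) ∣ r := by omega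
    rw [hr] at this
    rcases hμ with rfl | rfl
    · simpa using this
    · simpa using this
  have h6 := hcop.isUnit_of_dvd' h5 (dvd_trans (by norm_num) hd)
  rw [Int.isUnit_iff] at h6
  omega

theorem lucas_neg_one_three (κ : ℤ) : lucas (-1) κ 3 = κ ^ 2 - 1 ∧
    lucas (-1) κ (3 + 1) = κ ^ 3 - 2 * κ ∧ lucas (-1) κ (-3) = -(κ ^ 2 - 1) ∧
    lucas (-1) κ (-3 + 1) = -κ := by
  refine ⟨?_, ?_, ?_, ?_⟩
  · have := lucas_natCast (e := -1) κ 3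
    simp only [lucasNat] at this
    exact this.trans (by ring)
  · have := lucas_natCast (e := -1) κ 4
    simp only [lucasNat] at this
    exact this.trans (by ring)
  · have := lucas_neg_natCast (e := -1) κ 3
    simp only [lucasNat] at this
    exact this.trans (by ring)
  · have := lucas_neg_natCast (e := -1) κ 2
    simp only [lucasNat] at this
    exact this.trans (by ring)

/-- Equality of `|κ(κ² - 1)|` in both regions gives `|κ| = |κ'|`. At `v (j + 1)` the ratio is `-μκ`
seen from the left and `-νκ'` seen from the right, modulo `κ² - 1`, while `C` gives `μκ = -νκ'`. So
`κ² - 1` divides `2κ`, hence 2, which fails for `|κ| ≥ 2`. -/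
theorem IsTransvectionData.false_of_eq_three (h : IsTransvectionData q v w ε η C) (hm : Odd m)
    (hq0 : Even (q 0)) (hq : ∀ i, i ≠ 0 → Odd (q i)) (hne : q 0 ≠ 0)
    (h0 : ¬ Even (symp (v 0) (v (0 + 1)))) {j : Fin m} (hj : q j = q (j + 1)) (hj3 : |q j| = 3) :
    False := by
  have hC := h.ne_zero hm hq0 hq hne h0
  obtain ⟨-, hs⟩ := h.signs hm hq0 hq
  have hj3' : q j = 3 ∨ q j = -3 := by
    rcases abs_cases (q j) with h | h
    · left; omega
    · right; omega
  have hj0 : j ≠ 0 := by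
    rintro rfl
    obtain ⟨k, hk⟩ := hq0
    omega
  have hj1 : j + 1 ≠ 0 := by
    intro h1
    rw [h1] at hj
    obtain ⟨k, hk⟩ := hq0
    omega
  obtain ⟨κ, hκ⟩ : ∃ κ, κ = ε (j + 1) * symp (v j) (v (j + 1)) := ⟨_, rfl⟩
  obtain ⟨κ', hκ'⟩ : ∃ κ', κ' = ε (j + 1 + 1) * symp (v (j + 1)) (v (j + 1 + 1)) := ⟨_, rfl⟩
  obtain ⟨μ, hμ, hCμ, -, h1⟩ := h.region_congr hC j (e := -1)
    (by rw [hs j hj0, mul_neg, mul_self_of_sign (h.sign j)]) hκ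
  obtain ⟨ν, hν, hCν, h2, -⟩ := h.region_congr hC (j + 1) (e := -1)
    (by rw [hs _ hj1, mul_neg, mul_self_of_sign (h.sign _)]) hκ'
  rw [← hj] at hCν h2
  rw [hs j hj0] at hCν
  have hF : ∀ κ : ℤ, ∃ σ : ℤ, (σ = 1 ∨ σ = -1) ∧ lucas (-1) κ (q j) = σ * (κ ^ 2 - 1) ∧
      κ ^ 2 - 1 ∣ lucas (-1) κ (q j + 1) + κ := by
    intro κ
    obtain ⟨a, b, c, d⟩ := lucas_neg_one_three κ
    rcases hj3' with h | h <;> rw [h]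
    · exact ⟨1, by simp, by rw [a]; ring, ⟨κ, by rw [b]; ring⟩⟩
    · exact ⟨-1, by simp, by rw [c]; ring, ⟨0, by rw [d]; ring⟩⟩
  have hF' : ∀ κ κ' : ℤ, κ ^ 2 = κ' ^ 2 → lucas (-1) κ (q j) = lucas (-1) κ' (q j) := by
    intro κ κ' hk
    obtain ⟨a, b, c, d⟩ := lucas_neg_one_three κ
    obtain ⟨a', b', c', d'⟩ := lucas_neg_one_three κ'
    rcases hj3' with h | h <;> rw [h]
    · rw [a, a', hk]
    · rw [c, c', hk]
  obtain ⟨σ, hσ, hσ1, hσ2⟩ := hF κ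
  obtain ⟨τ, hτ, hτ1, hτ2⟩ := hF κ'
  have hprod : κ * (κ ^ 2 - 1) ≠ 0 := by
    intro h3
    apply hC
    rw [hCμ, hσ1]
    linear_combination μ * ε j * σ * h3
  have hk1 : κ ≠ 0 := left_ne_zero_of_mul hprod
  have hk2 : κ ^ 2 - 1 ≠ 0 := right_ne_zero_of_mul hprod
  have hk4 : 2 ≤ |κ| := by
    by_contra hc
    have : |κ| = 0 ∨ |κ| = 1 := by have := abs_nonneg κ; omega
    rcases this with h | h
    · exact hk1 (abs_eq_zero.1 h)
    · exact hk2 (by rw [← sq_abs, h]; norm_num)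
  have hCa : ∀ κ : ℤ, lucas (-1) κ (q j) = κ ^ 2 - 1 ∨ lucas (-1) κ (q j) = -(κ ^ 2 - 1) := by
    intro κ
    obtain ⟨σ, hσ, h, -⟩ := hF κ
    rcases hσ with rfl | rfl
    · left; linarith
    · right; linarith
  have habs : |κ * (κ ^ 2 - 1)| = |κ' * (κ' ^ 2 - 1)| := by
    have e1 := h.abs_eq j (e := -1) (by rw [hs j hj0, mul_neg, mul_self_of_sign (h.sign j)]) hκ
    have e2 := h.abs_eq (j + 1) (e := -1)
      (by rw [hs _ hj1, mul_neg, mul_self_of_sign (h.sign _)]) hκ'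
    rw [← hj] at e2
    rw [e1] at e2
    have e3 : ∀ κ : ℤ, |κ * lucas (-1) κ (q j)| = |κ * (κ ^ 2 - 1)| := by
      intro κ
      rcases hCa κ with h | h <;> rw [h]
      rw [mul_neg, abs_neg]
    rwa [e3, e3] at e2
  have hk5 : |κ| = |κ'| := by
    rw [abs_mul, abs_mul, ← sq_abs κ, ← sq_abs κ'] at habs
    have hb : |κ'| ≠ 0 ∧ |κ'| ≠ 1 := by
      constructor <;> intro h3 <;> rw [h3] at habs <;> simp at habs <;> omega
    have hb' : 2 ≤ |κ'| := by have := abs_nonneg κ'; omega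
    rw [abs_of_nonneg (a := |κ| ^ 2 - 1) (by nlinarith),
      abs_of_nonneg (a := |κ'| ^ 2 - 1) (by nlinarith)] at habs
    generalize |κ| = x at *
    generalize |κ'| = y at *
    have h3 : (x - y) * (x ^ 2 + x * y + y ^ 2 - 1) = 0 := by linear_combination habs
    rcases mul_eq_zero.1 h3 with h4 | h4
    · linarith
    · nlinarith
  have hk6 : κ ^ 2 = κ' ^ 2 := by rw [← sq_abs, hk5, sq_abs]
  rw [← hF' κ κ' hk6] at hCν h2
  have hε : ε j ≠ 0 := by rcases h.sign j with h | h <;> rw [h] <;> simp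
  have hL : lucas (-1) κ (q j) ≠ 0 := by
    rw [hσ1]
    exact mul_ne_zero (by rcases hσ with rfl | rfl <;> simp) hk2
  -- The minus sign comes from `ε (j + 1) = -ε j`.
  have hμν : μ * κ = -(ν * κ') := by
    apply mul_right_cancel₀ hε
    apply mul_right_cancel₀ hL
    linear_combination hCν - hCμ
  have hdvd := h1.dvd_sub (h.coprime (j + 1)) h2
  have hdvd' : κ ^ 2 - 1 ∣ lucas (-1) κ (q j) := ⟨σ, by rw [hσ1]; ring⟩
  replace hdvd := hdvd'.trans hdvd
  rw [← hk6] at hτ2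
  have h3 := dvd_add (dvd_sub hdvd (hσ2.mul_left μ)) (hτ2.mul_left ν)
  have h4 : κ ^ 2 - 1 ∣ 2 * (μ * κ) := by
    rw [← dvd_neg]
    convert h3 using 1
    linear_combination -hμν
  have h5 : κ ^ 2 - 1 ∣ 2 := by
    have h6 : κ ^ 2 - 1 ∣ 2 * κ := by
      rcases hμ with rfl | rfl
      · simpa using h4
      · simpa using h4
    have h7 := dvd_sub (h6.mul_right κ) (Dvd.intro_left 2 rfl)
    rwa [show 2 * κ * κ - 2 * (κ ^ 2 - 1) = 2 by ring] at h7
  have h6 := Int.le_of_dvd (by norm_num) h5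
  rw [← sq_abs] at h6
  nlinarith

end

/-! ### Arithmetic of Fibonacci polynomials -/

theorem lucasNat_add_two (e κ : ℤ) (n : ℕ) :
    lucasNat e κ (n + 2) = κ * lucasNat e κ (n + 1) + e * lucasNat e κ n := rfl

section fib

variable {k : ℤ}

theorem lucasNat_nonneg (hk : 0 < k) (n : ℕ) : 0 ≤ lucasNat 1 k n := by
  cases n with
  | zero => exact le_rfl
  | succ n => exact (lucasNat_pos hk n).le

theorem lucasNat_lt_succ (hk : 0 < k) {n : ℕ} (hn : 2 ≤ n) :
    lucasNat 1 k n < lucasNat 1 k (n + 1) := by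
  obtain ⟨n, rfl⟩ := Nat.exists_eq_add_of_le' hn
  have h1 := lucasNat_add_two 1 k (n + 1)
  have h2 := lucasNat_pos hk n
  have h3 := lucasNat_pos hk (n + 1)
  have h4 : lucasNat 1 k (n + 2) = lucasNat 1 k (n + 1 + 1) := rfl
  have h5 : lucasNat 1 k (n + 2 + 1) = lucasNat 1 k (n + 1 + 2) := rfl
  rw [h5, h1, h4]
  nlinarith

theorem lucasNat_lt_lucasNat (hk : 0 < k) {n n' : ℕ} (hn : 2 ≤ n) (h : n < n') :
    lucasNat 1 k n < lucasNat 1 k n' := by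
  induction n', h using Nat.le_induction with
  | base => exact lucasNat_lt_succ hk hn
  | succ n' h ih => exact ih.trans (lucasNat_lt_succ hk (by omega))

theorem lucasNat_le_lucasNat (hk : 0 < k) {n n' : ℕ} (hn : 2 ≤ n) (h : n ≤ n') :
    lucasNat 1 k n ≤ lucasNat 1 k n' := by
  rcases h.eq_or_lt with rfl | h
  · exact le_rfl
  · exact (lucasNat_lt_lucasNat hk hn h).le

theorem lucasNat_three : lucasNat 1 k 3 = k ^ 2 + 1 := by
  simp only [lucasNat]; ring

theorem lucasNat_five : lucasNat 1 k 5 = k ^ 4 + 3 * k ^ 2 + 1 := by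
  simp only [lucasNat]; ring

theorem lucasNat_seven : lucasNat 1 k 7 = k ^ 6 + 5 * k ^ 4 + 6 * k ^ 2 + 1 := by
  simp only [lucasNat]; ring

theorem lucasNat_nine : lucasNat 1 k 9 = k ^ 8 + 7 * k ^ 6 + 15 * k ^ 4 + 10 * k ^ 2 + 1 := by
  simp only [lucasNat]; ring

/-- Two consecutive Fibonacci polynomials, the larger index `n` being odd. -/
theorem lucasNat_sq {n : ℕ} (hn : Odd n) :
    lucasNat 1 k n ^ 2 = lucasNat 1 k (n - 1) ^ 2 +
      (k * lucasNat 1 k n) * lucasNat 1 k (n - 1) + 1 := by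
  obtain ⟨j, rfl⟩ := hn
  have h := lucas_sq (e := 1) k (by norm_num) ((2 * j + 1 : ℕ) : ℤ)
  have h1 : ¬ Even ((2 * j + 1 : ℕ) : ℤ) := by
    rw [Int.not_even_iff_odd]; exact ⟨j, by push_cast; ring⟩
  rw [if_neg h1, show ((2 * j + 1 : ℕ) : ℤ) + 1 = ((2 * j + 2 : ℕ) : ℤ) by push_cast; ring,
    lucas_natCast, lucas_natCast, lucasNat_add_two] at h
  rw [Nat.add_sub_cancel]
  linear_combination -h

end fib

/-- The numbers `k`, `F = F_Q(k)`, `f = F_{Q-1}(k)` for an odd index `Q ≥ 3`, where `k F = C`. -/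
structure IsFibTriple (C k F f : ℤ) : Prop where
  one_le : 1 ≤ k
  f_pos : 1 ≤ f
  mul_eq : k * F = C
  sq_eq : F ^ 2 = f ^ 2 + C * f + 1
  lt : k * f < F
  le : k ^ 2 + 1 ≤ F

theorem isFibTriple {k : ℤ} (hk : 1 ≤ k) {n : ℕ} (hn : Odd n) (hn3 : 3 ≤ n) :
    IsFibTriple (k * lucasNat 1 k n) k (lucasNat 1 k n) (lucasNat 1 k (n - 1)) := by
  have hk0 : 0 < k := hk
  refine ⟨hk, ?_, rfl, lucasNat_sq hn, ?_, ?_⟩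
  · obtain ⟨j, rfl⟩ := Nat.exists_eq_add_of_le' hn3
    exact lucasNat_pos hk0 (j + 1)
  · obtain ⟨j, rfl⟩ := Nat.exists_eq_add_of_le' hn3
    have := lucasNat_pos hk0 j
    have h1 : lucasNat 1 k (j + 3) = k * lucasNat 1 k (j + 2) + 1 * lucasNat 1 k (j + 1) := rfl
    have h2 : j + 3 - 1 = j + 2 := rfl
    rw [h1, h2]
    linarith
  · rw [← lucasNat_three]
    exact lucasNat_le_lucasNat hk0 (by norm_num) hn3

/-! ### Two Fibonacci triples with the same product -/

section triples

variable {C k F f k' F' f' : ℤ}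

/-- From `k F = k' F'`, the fractions `F / F'` and `k' / k` have the same reduced form `b / a`. -/
theorem exists_gcd_factorization (h : IsFibTriple C k F f) (h' : IsFibTriple C k' F' f') :
    ∃ a b d G : ℤ, 0 < a ∧ 0 < b ∧ 0 < d ∧ 0 < G ∧ IsCoprime a b ∧ F = b * G ∧ F' = a * G ∧
      k = d * a ∧ k' = d * b ∧ G = Int.gcd F F' := by
  have hF : 0 < F := by nlinarith [h.le]
  have hF' : 0 < F' := by nlinarith [h'.le]
  have hk := h.one_le
  have hk' := h'.one_le
  have hG : (0 : ℤ) < Int.gcd F F' := by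
    exact_mod_cast Int.gcd_pos_of_ne_zero_left _ hF.ne'
  obtain ⟨G, hGdef⟩ : ∃ G : ℤ, G = Int.gcd F F' := ⟨_, rfl⟩
  obtain ⟨b, hb⟩ := Int.gcd_dvd_left F F'
  obtain ⟨a, ha⟩ := Int.gcd_dvd_right F F'
  have hcop : IsCoprime a b := by
    have h1 := Int.gcd_eq_gcd_ab F F'
    refine ⟨Int.gcdB F F', Int.gcdA F F', ?_⟩
    apply mul_left_cancel₀ hG.ne'
    linear_combination -h1 - (Int.gcdA F F') * hb - (Int.gcdB F F') * ha
  rw [← hGdef] at hG ha hb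
  have ha0 : 0 < a := by
    rw [ha] at hF'; exact (mul_pos_iff_of_pos_left hG).1 hF'
  have hb0 : 0 < b := by
    rw [hb] at hF; exact (mul_pos_iff_of_pos_left hG).1 hF
  have h1 : k * b = k' * a := by
    apply mul_left_cancel₀ hG.ne'
    have := h.mul_eq.trans h'.mul_eq.symm
    rw [hb, ha] at this
    linear_combination this
  obtain ⟨d, hd⟩ : a ∣ k := hcop.dvd_of_dvd_mul_right ⟨k', by rw [h1, mul_comm]⟩
  have hd0 : 0 < d := by
    have : 0 < a * d := by rw [← hd]; exact hk
    exact (mul_pos_iff_of_pos_left ha0).1 this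
  refine ⟨a, b, d, G, ha0, hb0, hd0, hG, hcop, by rw [hb]; ring, by rw [ha]; ring, by rw [hd]; ring,
    ?_, hGdef⟩
  apply mul_left_cancel₀ ha0.ne'
  rw [hd] at h1
  linear_combination -h1

theorem IsFibTriple.coprime (h : IsFibTriple C k F f) : IsCoprime f F :=
  ⟨-(f + C), F, by linear_combination h.sq_eq⟩

/-- Suppose `f > f'`. Subtracting the two quadratic relations and using that `f` is prime to `G`
gives `G² ∣ 2(f - f')`, hence `G² ≤ 2f`. Then `k f < F` yields `d F' < 2b`, whereas `F' ≥ (d b)² + 1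
≥ 2b`. -/
theorem IsFibTriple.le_of_dvd_sub (h : IsFibTriple C k F f) (h' : IsFibTriple C k' F' f')
    (hd : (Int.gcd F F' : ℤ) ∣ f - f') : f ≤ f' := by
  obtain ⟨a, b, d, G, ha, hb, hd0, hG, hab, hF, hF', hk, hk', hGdef⟩ :=
    exists_gcd_factorization h h'
  rw [← hGdef] at hd
  by_contra hlt
  push Not at hlt
  have hGC : G ∣ C := ⟨d * a * b, by rw [← h.mul_eq, hk, hF]; ring⟩
  have hfG : IsCoprime f G := h.coprime.of_isCoprime_of_dvd_right ⟨b, by rw [hF]; ring⟩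
  obtain ⟨z, hz⟩ := hd
  have e1 : z * (f + f' + C) = G * (b ^ 2 - a ^ 2) := by
    apply mul_left_cancel₀ hG.ne'
    have e2 := h.sq_eq
    have e3 := h'.sq_eq
    rw [hF] at e2
    rw [hF'] at e3
    linear_combination e3 - e2 - (f + f' + C) * hz
  have e2 : G ∣ f * (2 * z) := by
    have h1 : G ∣ z * (f + f' + C) := ⟨_, e1⟩
    have h2 := dvd_sub h1 (hGC.mul_left z)
    have h3 : G ∣ z * (f - f') := ⟨z * z, by rw [hz]; ring⟩
    have h4 := dvd_add h2 h3
    rwa [show z * (f + f' + C) - z * C + z * (f - f') = f * (2 * z) by ring] at h4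
  obtain ⟨y, hy⟩ := hfG.symm.dvd_of_dvd_mul_left e2
  have e3 : 2 * (f - f') = G ^ 2 * y := by
    rw [hz]; linear_combination G * hy
  have hy0 : 0 < y := by
    have : 0 < G ^ 2 * y := by linarith
    exact (mul_pos_iff_of_pos_left (by positivity)).1 this
  have e4 : G ^ 2 ≤ 2 * f := by
    have := h'.f_pos
    nlinarith [sq_nonneg G]
  have e5 : k * G < 2 * b := by
    have := h.lt
    rw [hF] at this
    have : G * (k * G) < G * (2 * b) := by nlinarith [h.one_le]
    exact lt_of_mul_lt_mul_left this hG.le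
  have e6 : d * F' < 2 * b := by
    rw [hF']; rw [hk] at e5; linarith
  have e7 := h'.le
  rw [hk'] at e7
  have e8 : b ≤ d * b := by nlinarith
  nlinarith [sq_nonneg (d * b - 1)]

theorem IsFibTriple.eq_of_dvd_sub (h : IsFibTriple C k F f) (h' : IsFibTriple C k' F' f')
    (hd : (Int.gcd F F' : ℤ) ∣ f - f') : f = f' ∧ F = F' ∧ k = k' := by
  have h1 : f = f' := le_antisymm (h.le_of_dvd_sub h' hd)
    (h'.le_of_dvd_sub h (by rw [Int.gcd_comm]; exact (dvd_sub_comm).1 hd))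
  have hF : 0 < F := by nlinarith [h.le]
  have hF' : 0 < F' := by nlinarith [h'.le]
  have h2 : F = F' := by
    have e1 := h.sq_eq
    rw [h1, ← h'.sq_eq] at e1
    exact (pow_left_inj₀ hF.le hF'.le (by norm_num)).1 e1
  refine ⟨h1, h2, ?_⟩
  apply mul_right_cancel₀ hF.ne'
  rw [h.mul_eq, h2, h'.mul_eq]

/-- If `f = 1`, the quadratic relation reads `F (F - k) = 2`, which forces `k = 1` and `C = F ≤ 2`.
-/
theorem IsFibTriple.mul_ne_one (h : IsFibTriple C k F f) (hC : 5 ≤ C) : f * f' ≠ 1 := by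
  intro h4
  have h5 : f = 1 := by
    rcases Int.mul_eq_one_iff_eq_one_or_neg_one.1 h4 with h5 | h5
    · exact h5.1
    · linarith [h.f_pos, h5.1]
  have e3 := h.sq_eq
  rw [h5] at e3
  have h6 : F * (F - k) = 2 := by rw [← h.mul_eq] at e3; linear_combination e3
  have h7 : F ∣ 2 := ⟨F - k, h6.symm⟩
  have h8 := Int.le_of_dvd (by norm_num) h7
  have h9 := h.le
  have h10 := h.one_le
  have hk : k = 1 := by nlinarith
  have := h.mul_eq
  rw [hk] at this
  linarith

/-- Multiplicativity of the norm form `X² + C X Y + Y²` of `ℤ[ω]`, `ω² = C ω - 1`: the product of `f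
+ ω` and `f' + ω` is `(f f' - 1) + (f + f' + C) ω`. -/
theorem IsFibTriple.sq_mul_sq (h : IsFibTriple C k F f) (h' : IsFibTriple C k' F' f') :
    F ^ 2 * F' ^ 2 = (f * f' - 1) ^ 2 + C * ((f * f' - 1) * (f + f' + C)) + (f + f' + C) ^ 2 := by
  rw [h.sq_eq, h'.sq_eq]; ring

/-- Divisibility forces `x² + n² ≥ t`, so `x n` is at least `√(t - 1)`, and the norm equation gives
`C² < 2 c⁴ t³`. Insert `t ≤ k k'` and `k³ ≤ C`. -/
theorem IsFibTriple.lt_of_norm (h : IsFibTriple C k F f) (hk1' : 1 ≤ k')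
    {c t x n : ℤ} (hC : 0 < C) (hc : 0 < c) (ht : 2 ≤ t) (htk : t ≤ k * k') (hx : 0 < x)
    (hn : 0 < n) (htn : t ∣ x ^ 2 + n ^ 2)
    (hnorm : x ^ 2 + C * (x * n) + n ^ 2 = c ^ 2 * t ^ 2) : C < 2 * c ^ 4 * k' ^ 3 := by
  have ht0 : 0 < t := by linarith
  have ht1 : t ≤ x ^ 2 + n ^ 2 := Int.le_of_dvd (by positivity) htn
  have ht2 : t - 1 ≤ (x * n) ^ 2 := by
    have : 0 ≤ (x ^ 2 - 1) * (n ^ 2 - 1) := mul_nonneg (by nlinarith) (by nlinarith)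
    nlinarith
  have hlt : C * (x * n) < c ^ 2 * t ^ 2 := by
    have : 0 < x ^ 2 := by positivity
    have : 0 < n ^ 2 := by positivity
    linarith
  have h4 : C ^ 2 * (t - 1) < c ^ 4 * t ^ 4 :=
    calc C ^ 2 * (t - 1) ≤ C ^ 2 * (x * n) ^ 2 := by gcongr
      _ = (C * (x * n)) ^ 2 := by ring
      _ < (c ^ 2 * t ^ 2) ^ 2 := by gcongr
      _ = c ^ 4 * t ^ 4 := by ring
  have h5 : C ^ 2 < 2 * c ^ 4 * t ^ 3 := by
    have h6 : t * C ^ 2 < t * (2 * c ^ 4 * t ^ 3) := by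
      have : C ^ 2 * t ≤ C ^ 2 * (2 * (t - 1)) := by gcongr; linarith
      calc t * C ^ 2 ≤ 2 * (C ^ 2 * (t - 1)) := by linarith
        _ < 2 * (c ^ 4 * t ^ 4) := by linarith
        _ = _ := by ring
    exact lt_of_mul_lt_mul_left h6 ht0.le
  have hk1 := h.one_le
  have h7 : t ^ 3 ≤ C * k' ^ 3 := by
    have h8 : k ^ 3 ≤ C := by
      rw [← h.mul_eq]
      calc k ^ 3 = k * k ^ 2 := by ring
        _ ≤ k * F := by gcongr; linarith [h.le]
    calc t ^ 3 ≤ (k * k') ^ 3 := by gcongr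
      _ = k ^ 3 * k' ^ 3 := by ring
      _ ≤ C * k' ^ 3 := by gcongr
  have h9 : C * C < C * (2 * c ^ 4 * k' ^ 3) :=
    calc C * C = C ^ 2 := by ring
      _ < 2 * c ^ 4 * t ^ 3 := h5
      _ ≤ 2 * c ^ 4 * (C * k' ^ 3) := by gcongr
      _ = _ := by ring
  exact lt_of_mul_lt_mul_left h9 hC.le

/-- If `G` divides `f + f'`, then up to a factor `c ≤ 2` both `f + f' + C` and `f f' - 1` are
divisible by `G²`. Cancelling `G⁴` in `sq_mul_sq` leaves a norm equation with right side `c² (a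
b)²`, too small compared with `C`. -/
theorem IsFibTriple.false_of_dvd_add (h : IsFibTriple C k F f) (h' : IsFibTriple C k' F' f')
    (hC : 5 ≤ C) (h1 : k = k' ∨ 4 * k' ^ 3 ≤ C ∧ (2 ∣ F' → 34 * k' ^ 3 ≤ C))
    (hd : (Int.gcd F F' : ℤ) ∣ f + f') : False := by
  obtain ⟨a, b, d, G, ha, hb, hd0, hG, hab, hF, hF', hk, hk', hGdef⟩ :=
    exists_gcd_factorization h h'
  rw [← hGdef] at hd
  have hf := h.f_pos
  have hf' := h'.f_pos
  have hGC : G ∣ C := ⟨d * a * b, by rw [← h.mul_eq, hk, hF]; ring⟩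
  have hfG : IsCoprime f G := h.coprime.of_isCoprime_of_dvd_right ⟨b, by rw [hF]; ring⟩
  obtain ⟨z, hz⟩ : G ∣ f + f' + C := dvd_add hd hGC
  have e1 : z * (f - f') = G * (b ^ 2 - a ^ 2) := by
    apply mul_left_cancel₀ hG.ne'
    have e2 := h.sq_eq
    have e3 := h'.sq_eq
    rw [hF] at e2
    rw [hF'] at e3
    linear_combination e3 - e2 - (f - f') * hz
  have e2 : G ∣ 2 * z := by
    have h2 : G ∣ z * (f - f') := ⟨_, e1⟩
    have h3 := dvd_add h2 (hd.mul_left z)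
    rw [show z * (f - f') + z * (f + f') = f * (2 * z) by ring] at h3
    exact hfG.symm.dvd_of_dvd_mul_left h3
  -- The factor 2 in `e2` can be dropped unless `G` is even.
  obtain ⟨c, hc, n, hn⟩ : ∃ c : ℤ, (c = 1 ∨ c = 2 ∧ 2 ∣ G) ∧ G ∣ c * z := by
    rcases Int.even_or_odd G with hG2 | hG2
    · exact ⟨2, Or.inr ⟨rfl, hG2.two_dvd⟩, e2⟩
    · refine ⟨1, Or.inl rfl, ?_⟩
      rw [one_mul]
      have : IsCoprime G 2 := by
        obtain ⟨j, rfl⟩ := hG2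
        exact ⟨1, -j, by ring⟩
      exact this.dvd_of_dvd_mul_left e2
  have hc0 : 0 < c := by rcases hc with rfl | ⟨rfl, -⟩ <;> norm_num
  have hX : c * (f + f' + C) = G ^ 2 * n := by rw [hz]; linear_combination G * hn
  have hn0 : 0 < n := by
    have : 0 < G ^ 2 * n := by rw [← hX]; positivity
    exact (mul_pos_iff_of_pos_left (by positivity)).1 this
  obtain ⟨x, hx⟩ : ∃ x, x = f * n - c * b ^ 2 := ⟨_, rfl⟩
  have hx1 : c * (f * f' - 1) = G ^ 2 * x := by
    have e3 := h.sq_eq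
    rw [hF] at e3
    rw [hx]
    linear_combination f * hX + c * e3
  have hx0 : 0 < x := by
    have h2 : 0 ≤ G ^ 2 * x := by rw [← hx1]; exact mul_nonneg hc0.le (by nlinarith)
    have h3 : 0 ≤ x := nonneg_of_mul_nonneg_right h2 (by positivity)
    rcases h3.eq_or_lt with h3 | h3
    · rw [← h3, mul_zero] at hx1
      rcases mul_eq_zero.1 hx1 with h4 | h4
      · exact absurd h4 hc0.ne'
      · exact absurd (by linarith) (h.mul_ne_one (f' := f') hC)
    · exact h3
  obtain ⟨t, ht⟩ : ∃ t, t = a * b := ⟨_, rfl⟩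
  have ht0 : 0 < t := ht ▸ mul_pos ha hb
  have hnorm : x ^ 2 + C * (x * n) + n ^ 2 = c ^ 2 * t ^ 2 := by
    apply mul_left_cancel₀ (pow_pos hG 4).ne'
    have e3 := h.sq_mul_sq h'
    rw [hF, hF'] at e3
    rw [ht]
    linear_combination (-(c * (f * f' - 1) + G ^ 2 * x) - C * (c * (f + f' + C))) * hx1 -
      (c * (f + f' + C) + G ^ 2 * n + C * G ^ 2 * x) * hX + (-c ^ 2) * e3
  have htC : t ∣ C := ⟨d * G, by rw [← h.mul_eq, hk, hF, ht]; ring⟩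
  have htn : t ∣ x ^ 2 + n ^ 2 := by
    have : x ^ 2 + n ^ 2 = t * (c ^ 2 * t) - C * (x * n) := by linear_combination hnorm
    rw [this]
    exact dvd_sub (Dvd.intro _ rfl) (htC.mul_right _)
  have ht3 : 2 ≤ t := by
    by_contra h2
    have h3 : t = 1 := by omega
    have hc2 : c ^ 2 ≤ 4 := by rcases hc with rfl | ⟨rfl, -⟩ <;> norm_num
    have hxn : C * 1 ≤ C * (x * n) := by
      have : 1 ≤ x * n := mul_pos hx0 hn0
      gcongr
    rw [h3] at hnorm
    linarith [sq_nonneg x, sq_nonneg n]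
  have hkk : k ≠ k' := by
    intro h2
    have h3 : a = b := by
      apply mul_left_cancel₀ hd0.ne'
      rw [← hk, ← hk', h2]
    rw [h3] at hab
    have := Int.isUnit_iff.1 (isCoprime_self.1 hab)
    have hb1 : b = 1 := by omega
    rw [h3, hb1] at ht
    omega
  obtain ⟨h2, h3⟩ := h1.resolve_left hkk
  have h6 : t ≤ k * k' := by
    have h7 : 1 * t ≤ d * d * t := by
      have : 1 ≤ d * d := mul_pos hd0 hd0
      gcongr
    rw [hk, hk', show d * a * (d * b) = d * d * t by rw [ht]; ring]
    linarith
  have h8 := h.lt_of_norm h'.one_le (by linarith) hc0 ht3 h6 hx0 hn0 htn hnorm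
  have h9 : 0 < k' ^ 3 := pow_pos h'.one_le 3
  rcases hc with rfl | ⟨rfl, hG2⟩
  · linarith
  · have := h3 (by rw [hF']; exact hG2.mul_left a)
    linarith

end triples

/-- The index is determined by the values of the Fibonacci polynomials. -/
theorem fib_index_eq {k k' : ℤ} (hk : 1 ≤ k) (hk' : 1 ≤ k') {n n' : ℕ} (hn : Odd n) (hn' : Odd n')
    (h3 : 3 ≤ n) (h3' : 3 ≤ n') (hC : k * lucasNat 1 k n = k' * lucasNat 1 k' n')
    (hd : (Int.gcd (lucasNat 1 k n) (lucasNat 1 k' n') : ℤ) ∣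
      lucasNat 1 k (n - 1) - lucasNat 1 k' (n' - 1)) : n = n' ∧ k = k' := by
  have t := isFibTriple hk hn h3
  have t' := isFibTriple hk' hn' h3'
  rw [← hC] at t'
  obtain ⟨-, h1, h2⟩ := t.eq_of_dvd_sub t' hd
  subst h2
  refine ⟨?_, rfl⟩
  rcases lt_trichotomy n n' with h | h | h
  · exact absurd h1 (lucasNat_lt_lucasNat hk (by omega) h).ne
  · exact h
  · exact absurd h1 (lucasNat_lt_lucasNat hk (by omega) h).ne'

/-- These bounds beat `2 c⁴ k³` from `IsFibTriple.lt_of_norm` for `c = 1` and, with `34 > 32`, for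
`c = 2`. Evenness excludes the indices 5 and 7, and `F₉(1) = 34`. -/
theorem fib_bounds {k : ℤ} (hk : 1 ≤ k) {n : ℕ} (hn : Odd n) (h3 : 5 ≤ n) :
    4 * k ^ 3 ≤ k * lucasNat 1 k n ∧ (2 ∣ lucasNat 1 k n → 34 * k ^ 3 ≤ k * lucasNat 1 k n) := by
  have hk0 : 0 < k := hk
  have hkk : 1 ≤ k ^ 2 := by nlinarith
  constructor
  · have h1 := lucasNat_le_lucasNat hk0 (by norm_num) h3
    rw [lucasNat_five] at h1
    have h2 : 4 * k ^ 2 ≤ lucasNat 1 k n := by nlinarith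
    calc 4 * k ^ 3 = k * (4 * k ^ 2) := by ring
      _ ≤ _ := by gcongr
  · intro h2
    have h9 : 9 ≤ n := by
      by_contra hc
      have h5 : n = 5 ∨ n = 7 := by
        obtain ⟨j, rfl⟩ := hn
        omega
      rcases h5 with rfl | rfl
      · rw [lucasNat_five] at h2
        have : Odd (k ^ 4 + 3 * k ^ 2 + 1) := by
          rcases Int.even_or_odd' k with ⟨j, rfl | rfl⟩
          · exact ⟨8 * j ^ 4 + 6 * j ^ 2, by ring⟩
          · exact ⟨8 * j ^ 4 + 16 * j ^ 3 + 18 * j ^ 2 + 10 * j + 2, by ring⟩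
        exact (Int.not_even_iff_odd.2 this) (even_iff_two_dvd.2 h2)
      · rw [lucasNat_seven] at h2
        have : Odd (k ^ 6 + 5 * k ^ 4 + 6 * k ^ 2 + 1) := by
          rcases Int.even_or_odd k with h | h
          · exact (((h.pow_of_ne_zero (by norm_num)).add ((h.pow_of_ne_zero
              (by norm_num)).mul_left 5)).add ((h.pow_of_ne_zero (by norm_num)).mul_left 6)).add_one
          · exact ((((h.pow).add_odd ((by decide : Odd (5 : ℤ)).mul h.pow)).add
              ((by decide : Even (6 : ℤ)).mul_right _))).add_one
        exact (Int.not_even_iff_odd.2 this) (even_iff_two_dvd.2 h2)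
    have h1 := lucasNat_le_lucasNat hk0 (by norm_num) h9
    rw [lucasNat_nine] at h1
    have e1 : k ^ 2 ≤ k ^ 4 := by nlinarith
    have e2 : k ^ 4 ≤ k ^ 6 := by nlinarith [sq_nonneg (k ^ 2)]
    have e3 : k ^ 6 ≤ k ^ 8 := by nlinarith [sq_nonneg (k ^ 3)]
    have h2 : 34 * k ^ 2 ≤ lucasNat 1 k n + k ^ 2 := by nlinarith
    have h4 : 34 * k ^ 2 ≤ lucasNat 1 k n := by
      rcases hk.eq_or_lt with rfl | hk2
      · linarith
      · have : 4 ≤ k ^ 2 := by nlinarith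
        have : 4 * k ^ 2 ≤ k ^ 4 := by nlinarith
        nlinarith
    calc 34 * k ^ 3 = k * (34 * k ^ 2) := by ring
      _ ≤ _ := by gcongr

/-- By symmetry one index `≥ 5` suffices for the bounds; if both are 3, `k (k² + 1)` determines `k`.
-/
theorem fib_not_dvd_add {k k' : ℤ} (hk : 1 ≤ k) (hk' : 1 ≤ k') {n n' : ℕ} (hn : Odd n)
    (hn' : Odd n') (h3 : 3 ≤ n) (h3' : 3 ≤ n')
    (hC : k * lucasNat 1 k n = k' * lucasNat 1 k' n') (h5 : 5 ≤ k * lucasNat 1 k n) :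
    ¬ (Int.gcd (lucasNat 1 k n) (lucasNat 1 k' n') : ℤ) ∣
      lucasNat 1 k (n - 1) + lucasNat 1 k' (n' - 1) := by
  intro hd
  have t := isFibTriple hk hn h3
  have t' := isFibTriple hk' hn' h3'
  rw [← hC] at t'
  rcases h3'.eq_or_lt with h | h
  · rcases h3.eq_or_lt with h0 | h0
    · refine t.false_of_dvd_add t' h5 (Or.inl ?_) hd
      rw [← h, ← h0, lucasNat_three, lucasNat_three] at hC
      have : (k - k') * (k ^ 2 + k * k' + k' ^ 2 + 1) = 0 := by linear_combination hC
      rcases mul_eq_zero.1 this with h1 | h1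
      · linarith
      · nlinarith
    · have h0' : 5 ≤ n := by obtain ⟨j, rfl⟩ := hn; omega
      exact t'.false_of_dvd_add t h5 (Or.inr (fib_bounds hk hn h0'))
        (by rw [Int.gcd_comm, add_comm]; exact hd)
  · have h0' : 5 ≤ n' := by obtain ⟨j, rfl⟩ := hn'; omega
    exact t.false_of_dvd_add t' h5 (Or.inr (hC ▸ fib_bounds hk' hn' h0')) hd

/-! ### Antiparallel twist regions -/

section

variable {m : ℕ} [NeZero m] {q : Fin m → ℤ}

/-- The vectors of a lift of a coloring of a pretzel knot all of whose twist regions have an odd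
number of crossings, with `F` and `f` the Fibonacci polynomials of indices `|q i|` and `|q i| - 1`
at `k i`. -/
structure IsAntiparallelData (q : Fin m → ℤ) (v w : Fin m → ℤ × ℤ) (k θ F f : Fin m → ℤ) (C : ℤ) :
    Prop where
  one_le : ∀ i, 1 ≤ k i
  fst_eq : ∀ i, F i = lucasNat 1 (k i) (q i).natAbs
  snd_eq : ∀ i, f i = lucasNat 1 (k i) ((q i).natAbs - 1)
  mul_eq : ∀ i, k i * F i = C
  sign : ∀ i, θ i = 1 ∨ θ i = -1
  coprime : ∀ i, IsCoprime (v i).1 (v i).2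
  symp_ne : ∀ i, symp (v i) (w i) ≠ 0
  pos : ∀ i, 0 < q i → w i = (C + f i) • v i + (θ i * F i) • v (i + 1) ∧
    w (i + 1) = -((θ i * F i) • v i + f i • v (i + 1))
  neg : ∀ i, q i < 0 → w i = (-f i) • v i + (θ i * F i) • v (i + 1) ∧
    w (i + 1) = -((θ i * F i) • v i) + (C + f i) • v (i + 1)

/-- Two consecutive odd regions restore `ε`, so `ε (i + 1) = c ε i` with one constant `c`; the
product over the cycle gives `c ^ m = 1`, and `m` is odd. -/
theorem IsTransvectionData.sign_eq {v w : Fin m → ℤ × ℤ} {ε η : Fin m → ℤ} {C : ℤ}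
    (h : IsTransvectionData q v w ε η C) (hm : Odd m) (hq : ∀ i, Odd (q i)) (i : Fin m) :
    ε (i + 1) = ε i := by
  have h1 : ∀ i, ε (i + 1 + 1) = ε i := by
    intro i
    have h2 := h.left_sign (i + 1)
    have h3 := h.right_sign i
    rw [if_neg (Int.not_even_iff_odd.2 (hq _))] at h2 h3
    linarith
  obtain ⟨c, hc⟩ : ∃ c, c = ε (0 + 1) * ε 0 := ⟨_, rfl⟩
  have h2 : ∀ i, ε (i + 1) * ε i = c := by
    refine Fin.cyclic_induction 0 hc.symm fun i hi => ?_
    rw [h1, mul_comm, hi]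
  have h3 : ∀ i, ε (i + 1) = c * ε i := fun i => by
    rw [← h2 i, mul_assoc, mul_self_of_sign (h.sign i), mul_one]
  have h4 : ∏ i, ε i ≠ 0 := Finset.prod_ne_zero_iff.2 fun i _ => by
    rcases h.sign i with h | h <;> rw [h] <;> simp
  have h5 : c ^ m = 1 := by
    apply mul_right_cancel₀ h4
    rw [one_mul]
    conv_rhs => rw [← Equiv.prod_comp (Equiv.addRight 1)]
    simp [h3, Finset.prod_mul_distrib]
  have hc1 : c = 1 := by
    have h6 : c = 1 ∨ c = -1 := by
      rw [hc]
      rcases h.sign 0 with h1 | h1 <;> rcases h.sign (0 + 1) with h2 | h2 <;> rw [h1, h2] <;> simp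
    rcases h6 with h6 | h6
    · exact h6
    · rw [h6, hm.neg_one_pow] at h5
      norm_num at h5
  rw [h3, hc1, one_mul]

theorem lucas_sign_mul {s k : ℤ} (hs : s = 1 ∨ s = -1) {n : ℕ} (hn : Odd n) :
    lucas 1 (s * k) n = lucasNat 1 k n ∧ lucas 1 (s * k) (n - 1) = s * lucasNat 1 k (n - 1) ∧
      lucas 1 (s * k) (-n) = lucasNat 1 k n ∧
      lucas 1 (s * k) (-n + 1) = -(s * lucasNat 1 k (n - 1)) := by
  obtain ⟨j, rfl⟩ := hn
  have e1 : (((2 * j + 1 : ℕ) : ℤ) - 1) = ((2 * j : ℕ) : ℤ) := by push_cast; ring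
  have e2 : -((2 * j + 1 : ℕ) : ℤ) + 1 = -((2 * j : ℕ) : ℤ) := by push_cast; ring
  rw [e1, e2, lucas_neg_natCast, lucas_neg_natCast, lucas_natCast, lucas_natCast,
    Nat.add_sub_cancel]
  rcases hs with rfl | rfl
  · simp [pow_add, pow_mul]
  · rw [neg_one_mul, lucasNat_neg, lucasNat_neg]
    simp [pow_add, pow_mul]

/-- With the common sign `δ` of all colors and `κ = s k`, positivity of `C` forces `μ = δ s`.
Replacing `w` by `δ • w` removes `δ` from the formulas. -/
theorem IsTransvectionData.exists_antiparallelData {v w : Fin m → ℤ × ℤ} {ε η : Fin m → ℤ} {C : ℤ}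
    (h : IsTransvectionData q v w ε η C) (hm : Odd m) (hq : ∀ i, Odd (q i)) {i₀ : Fin m}
    (h0 : ¬ Even (symp (v i₀) (v (i₀ + 1)))) :
    ∃ w' k θ F f, IsAntiparallelData q v w' k θ F f C := by
  have hε := h.sign_eq hm hq
  obtain ⟨δ, hδ⟩ : ∃ δ, ∀ i, ε i = δ :=
    ⟨ε 0, Fin.cyclic_induction 0 rfl fun i hi => (hε i).trans hi⟩
  have hδs : δ = 1 ∨ δ = -1 := hδ 0 ▸ h.sign 0
  have hδδ := mul_self_of_sign hδs
  have he : ∀ i, 1 = ε i * ε (i + 1) := fun i => by rw [hδ, hδ, hδδ]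
  have hq0 : ∀ i, q i ≠ 0 := fun i hi => by
    have := hq i
    rw [hi] at this
    simp at this
  have hC : C ≠ 0 := by
    rw [h.abs_eq i₀ (he i₀) rfl, abs_ne_zero]
    have h2 : ε (i₀ + 1) * symp (v i₀) (v (i₀ + 1)) ≠ 0 := by
      intro h3
      have := odd_sign_mul (h.sign (i₀ + 1)) h0
      rw [h3] at this
      simp at this
    exact mul_ne_zero h2 (lucas_ne_zero h2 (hq0 i₀))
  have hC0 : 0 < C := lt_of_le_of_ne h.nonneg hC.symm
  have key : ∀ i, ∃ s k : ℤ, (s = 1 ∨ s = -1) ∧ 1 ≤ k ∧ k * lucasNat 1 k (q i).natAbs = C ∧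
      (0 < q i → w i = δ • ((C + lucasNat 1 k ((q i).natAbs - 1)) • v i +
          (s * lucasNat 1 k (q i).natAbs) • v (i + 1)) ∧
        w (i + 1) = δ • -((s * lucasNat 1 k (q i).natAbs) • v i +
          lucasNat 1 k ((q i).natAbs - 1) • v (i + 1))) ∧
      (q i < 0 → w i = δ • ((-lucasNat 1 k ((q i).natAbs - 1)) • v i +
          (s * lucasNat 1 k (q i).natAbs) • v (i + 1)) ∧
        w (i + 1) = δ • (-((s * lucasNat 1 k (q i).natAbs) • v i) +
          (C + lucasNat 1 k ((q i).natAbs - 1)) • v (i + 1))) := by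
    intro i
    obtain ⟨μ, hμ, h1, h2, h3⟩ := h.region hC i (he i) rfl
    obtain ⟨κ, hκ⟩ : ∃ κ, κ = ε (i + 1) * symp (v i) (v (i + 1)) := ⟨_, rfl⟩
    rw [← hκ, hδ] at h1
    rw [← hκ] at h2 h3
    have hκ0 : κ ≠ 0 := by
      rintro rfl
      simp at h1
      exact hC h1
    obtain ⟨s, k, hs, hk, hsk⟩ : ∃ s k : ℤ, (s = 1 ∨ s = -1) ∧ 1 ≤ k ∧ κ = s * k := by
      rcases lt_or_gt_of_ne hκ0 with h4 | h4
      · exact ⟨-1, -κ, Or.inr rfl, by omega, by ring⟩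
      · exact ⟨1, κ, Or.inl rfl, h4, by ring⟩
    have hss := mul_self_of_sign hs
    have hn : Odd (q i).natAbs := Int.natAbs_odd.2 (hq i)
    obtain ⟨l1, l2, l3, l4⟩ := lucas_sign_mul (k := k) hs hn
    have hF : 0 < lucasNat 1 k (q i).natAbs := by
      obtain ⟨j, hj⟩ := hn
      rw [hj]
      exact lucasNat_pos hk _
    have hL : lucas 1 κ (q i) = lucasNat 1 k (q i).natAbs := by
      rw [hsk]
      rcases Int.natAbs_eq (q i) with h4 | h4
      · rwa [← h4] at l1
      · rwa [← h4] at l3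
    have hkF : 0 < k * lucasNat 1 k (q i).natAbs := mul_pos hk hF
    rw [hL, hsk] at h1
    have hμs : μ = δ * s := by
      rcases hμ with rfl | rfl <;> rcases hδs with rfl | rfl <;> rcases hs with rfl | rfl <;>
        first | rfl | (exfalso; linarith)
    have hCk : k * lucasNat 1 k (q i).natAbs = C := by
      rw [h1, hμs]
      linear_combination (-k * lucasNat 1 k (q i).natAbs * s * s) * hδδ -
        (k * lucasNat 1 k (q i).natAbs) * hss
    have hsucc := lucas_succ κ (e := 1) rfl (q i)
    rw [hL] at hsucc h2 h3
    refine ⟨s, k, hs, hk, hCk, fun hpos => ?_, fun hneg => ?_⟩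
    · have h5 : ((q i).natAbs : ℤ) = q i := Int.natAbs_of_nonneg hpos.le
      rw [h5, ← hsk] at l2
      rw [l2] at hsucc h3
      rw [hsucc, hsk] at h2
      generalize lucasNat 1 k (q i).natAbs = F at *
      generalize lucasNat 1 k ((q i).natAbs - 1) = f at *
      rw [h2, h3, hμs, ← hCk]
      constructor
      · ext
        · simp
          linear_combination (δ * (k * F + f) * (v i).1) * hss
        · simp
          linear_combination (δ * (k * F + f) * (v i).2) * hss
      · ext
        · simp
          linear_combination (-δ * f * (v (i + 1)).1) * hss
        · simp
          linear_combination (-δ * f * (v (i + 1)).2) * hss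
    · have h5 : -((q i).natAbs : ℤ) = q i := by omega
      rw [h5, ← hsk] at l4
      rw [l4] at hsucc h2
      have h6 : lucas 1 κ (q i - 1) = -(s * lucasNat 1 k ((q i).natAbs - 1)) -
          κ * lucasNat 1 k (q i).natAbs := by linarith
      rw [h6, hsk] at h3
      generalize lucasNat 1 k (q i).natAbs = F at *
      generalize lucasNat 1 k ((q i).natAbs - 1) = f at *
      rw [h2, h3, hμs, ← hCk]
      constructor
      · ext
        · simp
          linear_combination (-δ * f * (v i).1) * hss
        · simp
          linear_combination (-δ * f * (v i).2) * hss
      · ext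
        · simp
          linear_combination (δ * (k * F + f) * (v (i + 1)).1) * hss
        · simp
          linear_combination (δ * (k * F + f) * (v (i + 1)).2) * hss
  choose s k hs hk hCk hpos hneg using key
  refine ⟨fun i => δ • w i, k, s, fun i => lucasNat 1 (k i) (q i).natAbs,
    fun i => lucasNat 1 (k i) ((q i).natAbs - 1), hk, fun _ => rfl, fun _ => rfl, hCk, hs,
    h.coprime, fun i => ?_, fun i hi => ?_, fun i hi => ?_⟩
  · have : symp (v i) (δ • w i) = δ * C := by
      rw [← h.symp_eq i]; simp [symp]; ring
    rw [this]
    exact mul_ne_zero (by rcases hδs with h | h <;> rw [h] <;> simp) hC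
  · obtain ⟨h1, h2⟩ := hpos i hi
    rw [h1, h2, smul_smul, smul_smul, hδδ, one_smul, one_smul]
    exact ⟨rfl, rfl⟩
  · obtain ⟨h1, h2⟩ := hneg i hi
    rw [h1, h2, smul_smul, smul_smul, hδδ, one_smul, one_smul]
    exact ⟨rfl, rfl⟩

end

/-! ### Twist regions of the same sign -/

section

variable {m : ℕ} [NeZero m] {q : Fin m → ℤ}

/-- A cyclic sequence of maps that preserve the cone `0 ≤ B ≤ A` has no invariant vector on the
boundary ray `B = 0`. -/
theorem false_of_cone {a b σ F f : Fin m → ℤ} {C : ℤ} (hC : 2 ≤ C) (hF : ∀ i, 0 < F i)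
    (hf : ∀ i, 0 ≤ f i) (hσ : ∀ i, σ i = 1 ∨ σ i = -1)
    (ha : ∀ i, F i * a (i + 1) = σ i * ((C + f i) * a i - b i))
    (hb : ∀ i, F i * b (i + 1) = σ i * (a i + f i * b i)) (ha0 : a 0 ≠ 0) (hb0 : b 0 = 0) :
    False := by
  have step : ∀ i (s : ℤ), (s = 1 ∨ s = -1) → 0 < s * a i → 0 ≤ s * b i → s * b i ≤ s * a i →
      ∃ s' : ℤ, (s' = 1 ∨ s' = -1) ∧ 0 < s' * b (i + 1) ∧ s' * b (i + 1) ≤ s' * a (i + 1) := by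
    intro i s hs h1 h2 h3
    have hσσ := mul_self_of_sign (hσ i)
    have hFi := hF i
    have hfi := hf i
    refine ⟨s * σ i, ?_, ?_, ?_⟩
    · rcases hs with rfl | rfl <;> rcases hσ i with h | h <;> simp [h]
    · refine (mul_pos_iff_of_pos_left hFi).1 ?_
      have : F i * (s * σ i * b (i + 1)) = s * a i + f i * (s * b i) := by
        linear_combination (s * σ i) * hb i + (s * (a i + f i * b i)) * hσσ
      rw [this]
      positivity
    · refine le_of_mul_le_mul_left ?_ hFi
      have e1 : F i * (s * σ i * b (i + 1)) = s * a i + f i * (s * b i) := by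
        linear_combination (s * σ i) * hb i + (s * (a i + f i * b i)) * hσσ
      have e2 : F i * (s * σ i * a (i + 1)) = (C + f i) * (s * a i) - s * b i := by
        linear_combination (s * σ i) * ha i + (s * ((C + f i) * a i - b i)) * hσσ
      rw [e1, e2]
      have e3 : f i * (s * b i) ≤ f i * (s * a i) := by gcongr
      -- Here `2 ≤ C` enters: it gives `C a - b ≥ 2a - b ≥ a` on the cone.
      have e4 : 2 * (s * a i) ≤ C * (s * a i) := by gcongr
      linarith
  have key : ∀ i, ∃ s : ℤ, (s = 1 ∨ s = -1) ∧ 0 < s * b i ∧ s * b i ≤ s * a i := by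
    refine Fin.cyclic_induction (0 + 1) ?_ fun i ⟨s, hs, h1, h2⟩ =>
      step i s hs (h1.trans_le h2) h1.le h2
    rcases lt_or_gt_of_ne ha0 with h | h
    · exact step 0 (-1) (Or.inr rfl) (by linarith) (by simp [hb0]) (by rw [hb0]; linarith)
    · exact step 0 1 (Or.inl rfl) (by linarith) (by simp [hb0]) (by rw [hb0]; linarith)
  obtain ⟨s, -, h, -⟩ := key 0
  simp [hb0] at h

variable {v w : Fin m → ℤ × ℤ} {k θ F f : Fin m → ℤ} {C : ℤ}

theorem IsAntiparallelData.fst_pos (h : IsAntiparallelData q v w k θ F f C)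
    (hq : ∀ i, Odd (q i)) (i : Fin m) : 0 < F i := by
  obtain ⟨j, hj⟩ := Int.natAbs_odd.2 (hq i)
  rw [h.fst_eq, hj]
  exact lucasNat_pos (h.one_le i) _

theorem IsAntiparallelData.snd_nonneg (h : IsAntiparallelData q v w k θ F f C) (i : Fin m) :
    0 ≤ f i := by
  rw [h.snd_eq]
  exact lucasNat_nonneg (h.one_le i) _

theorem IsAntiparallelData.sq_eq (h : IsAntiparallelData q v w k θ F f C)
    (hq : ∀ i, Odd (q i)) (i : Fin m) : F i ^ 2 = f i ^ 2 + C * f i + 1 := by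
  rw [← h.mul_eq i, h.fst_eq, h.snd_eq, lucasNat_sq (Int.natAbs_odd.2 (hq i))]

/-- The recursion along a twist region with `0 < q i`. -/
theorem IsAntiparallelData.step_pos (h : IsAntiparallelData q v w k θ F f C)
    (hq : ∀ i, Odd (q i)) {i : Fin m} (hi : 0 < q i) :
    F i • v (i + 1) = (-θ i) • ((C + f i) • v i - w i) ∧
      F i • w (i + 1) = (-θ i) • (v i + f i • w i) := by
  obtain ⟨h1, h2⟩ := h.pos i hi
  have hθ := mul_self_of_sign (h.sign i)
  have hs := h.sq_eq hq i
  rw [h1, h2]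
  refine ⟨Prod.ext ?_ ?_, Prod.ext ?_ ?_⟩
  · simp; linear_combination (-(F i * (v (i + 1)).1)) * hθ
  · simp; linear_combination (-(F i * (v (i + 1)).2)) * hθ
  · simp; linear_combination (-θ i * (v i).1) * hs + (F i * f i * (v (i + 1)).1) * hθ
  · simp; linear_combination (-θ i * (v i).2) * hs + (F i * f i * (v (i + 1)).2) * hθ

/-- The recursion along a twist region with `q i < 0`. -/
theorem IsAntiparallelData.step_neg (h : IsAntiparallelData q v w k θ F f C)
    (hq : ∀ i, Odd (q i)) {i : Fin m} (hi : q i < 0) :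
    F i • w (i + 1) = θ i • ((C + f i) • w i - v i) ∧
      F i • v (i + 1) = θ i • (w i + f i • v i) := by
  obtain ⟨h1, h2⟩ := h.neg i hi
  have hθ := mul_self_of_sign (h.sign i)
  have hs := h.sq_eq hq i
  rw [h1, h2]
  refine ⟨Prod.ext ?_ ?_, Prod.ext ?_ ?_⟩
  · simp
    linear_combination (-θ i * (v i).1) * hs - ((C + f i) * F i * (v (i + 1)).1) * hθ
  · simp
    linear_combination (-θ i * (v i).2) * hs - ((C + f i) * F i * (v (i + 1)).2) * hθ
  · simp; linear_combination (-(F i * (v (i + 1)).1)) * hθ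
  · simp; linear_combination (-(F i * (v (i + 1)).2)) * hθ

theorem symp_smul_left (r : ℤ) (x y : ℤ × ℤ) : symp (r • x) y = r * symp x y := by
  simp [symp]; ring

theorem symp_add_left (x x' y : ℤ × ℤ) : symp (x + x') y = symp x y + symp x' y := by
  simp [symp]; ring

theorem symp_sub_left (x x' y : ℤ × ℤ) : symp (x - x') y = symp x y - symp x' y := by
  simp [symp]; ring

theorem symp_self (x : ℤ × ℤ) : symp x x = 0 := by
  simp [symp]; ring

/-- Pairing the recursion with the fixed vector `w 0` starts it on the ray `B = 0` of the cone. For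
negative entries `v` and `w` exchange their roles. -/
theorem IsAntiparallelData.false_of_same_sign (h : IsAntiparallelData q v w k θ F f C)
    (hq : ∀ i, Odd (q i)) (hC : 2 ≤ C) (hs : (∀ i, 0 < q i) ∨ ∀ i, q i < 0) : False := by
  rcases hs with hs | hs
  · refine false_of_cone (a := fun i => symp (v i) (w 0)) (b := fun i => symp (w i) (w 0))
      (σ := fun i => -θ i) hC (h.fst_pos hq) h.snd_nonneg
      (fun i => by rcases h.sign i with h | h <;> simp [h]) (fun i => ?_) (fun i => ?_)
      (h.symp_ne 0) (symp_self _)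
    · have := congrArg (fun x => symp x (w 0)) (h.step_pos hq (hs i)).1
      simpa only [symp_smul_left, symp_add_left, symp_sub_left] using this
    · have := congrArg (fun x => symp x (w 0)) (h.step_pos hq (hs i)).2
      simpa only [symp_smul_left, symp_add_left, symp_sub_left] using this
  · refine false_of_cone (a := fun i => symp (w i) (v 0)) (b := fun i => symp (v i) (v 0))
      (σ := θ) hC (h.fst_pos hq) h.snd_nonneg h.sign (fun i => ?_) (fun i => ?_)
      ?_ (symp_self _)
    · have := congrArg (fun x => symp x (v 0)) (h.step_neg hq (hs i)).1
      simpa only [symp_smul_left, symp_add_left, symp_sub_left] using this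
    · have := congrArg (fun x => symp x (v 0)) (h.step_neg hq (hs i)).2
      simpa only [symp_smul_left, symp_add_left, symp_sub_left] using this
    · have h1 := h.symp_ne 0
      have h2 : symp (w 0) (v 0) = -symp (v 0) (w 0) := by simp [symp]; ring
      rw [h2]
      exact neg_ne_zero.2 h1

/-- The product `c` of adjacent colors is the same for all `i`, so the colors are `c ^ t * x 0`. If
the coloring is not constant, `c` has order 3, and going around gives `c ^ m = 1`. -/
theorem three_dvd_of_natAbs_eq_one {φ : PretzelGroup q →* Equiv.Perm (Fin 3)}
    (hφ : IsSimplePermColoring φ) (hne : ¬ IsConstantColoring φ)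
    (hq : (∀ i, q i = 1) ∨ ∀ i, q i = -1) : 3 ∣ m := by
  obtain ⟨c, hc⟩ : ∃ c, ∀ i, bottomColor φ (i + 1) = c * bottomColor φ i := by
    have h1 : ∀ i, bottomColor φ (i + 1) * bottomColor φ i =
        bottomColor φ (0 + 1) * bottomColor φ 0 := by
      refine Fin.cyclic_induction 0 rfl fun i hi => ?_
      rw [← hi]
      have h2 := coloring_top φ i
      rw [hφ.topColor_eq, hφ.topColor_eq] at h2
      rcases hq with hq | hq
      · simp only [hq, zpow_one, mul_assoc, inv_mul_cancel_left] at h2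
        exact h2
      · simp only [hq, zpow_neg, zpow_one, mul_inv_rev, hφ.inv_eq, mul_assoc, hφ.mul_self,
          mul_one] at h2
        have h3 := congrArg (·⁻¹) h2
        simpa only [mul_inv_rev, hφ.inv_eq] using h3
    refine ⟨bottomColor φ (0 + 1) * bottomColor φ 0, fun i => ?_⟩
    rw [← h1 i, mul_assoc, hφ.mul_self, mul_one]
  have hc0 : c = bottomColor φ (0 + 1) * bottomColor φ 0 := by
    rw [hc, mul_assoc, hφ.mul_self, mul_one]
  have hc3 : c ^ 3 = 1 := by
    rw [hc0]
    exact mul_pow_three_of_isSwap (hφ _) (hφ _)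
  have hc1 : c ≠ 1 := by
    rintro h
    obtain ⟨i, hi⟩ := exists_bottomColor_ne hφ hne
    rw [hc, h, one_mul] at hi
    exact hi rfl
  have hcm : c ^ m = 1 := by
    have h4 : ∀ t : ℕ, bottomColor φ (Fin.ofNat m t) = c ^ t * bottomColor φ (Fin.ofNat m 0) := by
      intro t
      induction t with
      | zero => simp
      | succ t ih => rw [Fin.ofNat_succ, hc, ih, pow_succ', mul_assoc]
    have h5 := h4 m
    have h6 : Fin.ofNat m m = Fin.ofNat m 0 := by ext; simp
    rw [h6] at h5
    exact mul_eq_right.1 h5.symm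
  rw [← orderOf_eq_prime hc3 hc1]
  exact orderOf_dvd_of_pow_eq_one hcm

end

/-! ### Twist regions of different sizes -/

section

variable {m : ℕ} [NeZero m] {q : Fin m → ℤ} {v w : Fin m → ℤ × ℤ} {k θ F f : Fin m → ℤ} {C : ℤ}

theorem IsAntiparallelData.congr_of_one_lt (h : IsAntiparallelData q v w k θ F f C) {i : Fin m}
    {s : ℤ} (hs : s = 1 ∧ 0 < q i ∨ s = -1 ∧ q i < 0) :
    VecModEq (F i) (w i) ((s * f i) • v i) ∧
      VecModEq (F i) (w (i + 1)) ((-s * f i) • v (i + 1)) := by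
  have hC := h.mul_eq i
  rcases hs with ⟨rfl, hi⟩ | ⟨rfl, hi⟩
  · obtain ⟨h1, h2⟩ := h.pos i hi
    rw [h1, h2, ← hC]
    refine ⟨⟨⟨k i * (v i).1 + θ i * (v (i + 1)).1, ?_⟩, ⟨k i * (v i).2 + θ i * (v (i + 1)).2, ?_⟩⟩,
      ⟨⟨-θ i * (v i).1, ?_⟩, ⟨-θ i * (v i).2, ?_⟩⟩⟩ <;> simp <;> ring
  · obtain ⟨h1, h2⟩ := h.neg i hi
    rw [h1, h2, ← hC]
    refine ⟨⟨⟨θ i * (v (i + 1)).1, ?_⟩, ⟨θ i * (v (i + 1)).2, ?_⟩⟩,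
      ⟨⟨-θ i * (v i).1 + k i * (v (i + 1)).1, ?_⟩,
        ⟨-θ i * (v i).2 + k i * (v (i + 1)).2, ?_⟩⟩⟩ <;> simp <;> ring

/-- Modulo a divisor of `C`, a single crossing acts on the ratio by `r ↦ -1/r`, which fixes the
square roots of `-1`. -/
theorem IsAntiparallelData.congr_of_one (h : IsAntiparallelData q v w k θ F f C) {i : Fin m}
    (hi : (q i).natAbs = 1) {n r : ℤ} (hn : n ∣ C) (hr : n ∣ r ^ 2 + 1)
    (hw : VecModEq n (w i) (r • v i)) : VecModEq n (w (i + 1)) (r • v (i + 1)) := by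
  have hF : F i = 1 := by rw [h.fst_eq, hi]; rfl
  have hf : f i = 0 := by rw [h.snd_eq, hi]; rfl
  have hθ := mul_self_of_sign (h.sign i)
  obtain ⟨c, hc⟩ := hn
  obtain ⟨d, hd⟩ := hr
  obtain ⟨⟨a, ha⟩, ⟨b, hb⟩⟩ := hw
  simp only [Prod.smul_fst, Prod.smul_snd, smul_eq_mul] at ha hb
  rcases Int.natAbs_eq_iff.1 hi with hi' | hi'
  · obtain ⟨h1, h2⟩ := h.pos i (by rw [hi']; norm_num)
    rw [hF, hf] at h1 h2
    rw [h1] at ha hb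
    simp at ha hb
    refine ⟨⟨θ i * r * (c * (v i).1 - a) - θ i * d * (v i).1, ?_⟩,
      ⟨θ i * r * (c * (v i).2 - b) - θ i * d * (v i).2, ?_⟩⟩ <;> rw [h2] <;> simp
    · linear_combination (-θ i * r) * ha + (r * (v (i + 1)).1) * hθ +
        (θ i * r * (v i).1) * hc - (θ i * (v i).1) * hd
    · linear_combination (-θ i * r) * hb + (r * (v (i + 1)).2) * hθ +
        (θ i * r * (v i).2) * hc - (θ i * (v i).2) * hd
  · obtain ⟨h1, h2⟩ := h.neg i (by rw [hi']; norm_num)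
    rw [hF, hf] at h1 h2
    rw [h1] at ha hb
    simp at ha hb
    refine ⟨⟨-θ i * r * a - θ i * d * (v i).1 + c * (v (i + 1)).1, ?_⟩,
      ⟨-θ i * r * b - θ i * d * (v i).2 + c * (v (i + 1)).2, ?_⟩⟩ <;> rw [h2] <;> simp
    · linear_combination (-θ i * r) * ha + (r * (v (i + 1)).1) * hθ +
        (v (i + 1)).1 * hc - (θ i * (v i).1) * hd
    · linear_combination (-θ i * r) * hb + (r * (v (i + 1)).2) * hθ +
        (v (i + 1)).2 * hc - (θ i * (v i).2) * hd

theorem natAbs_eq_one_or_three_le {a : ℤ} (ha : Odd a) : a.natAbs = 1 ∨ 3 ≤ a.natAbs := by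
  obtain ⟨j, hj⟩ := Int.natAbs_odd.2 ha
  omega

/-- All twist regions with more than one crossing have the same size, and they alternate in sign. -/
theorem IsAntiparallelData.step_sign (h : IsAntiparallelData q v w k θ F f C)
    (hq : ∀ i, Odd (q i)) {p : Fin m} (hp : 5 ≤ (q p).natAbs) (hC : 5 ≤ C) {i : Fin m} {t : ℤ}
    (ht : t = 1 ∨ t = -1) (hw : VecModEq (F p) (w i) ((t * f p) • v i)) :
    ((q i).natAbs = 1 ∧ VecModEq (F p) (w (i + 1)) ((t * f p) • v (i + 1))) ∨
      (q i = t * (q p).natAbs ∧ F i = F p ∧ f i = f p ∧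
        VecModEq (F p) (w (i + 1)) ((-t * f p) • v (i + 1))) := by
  have htt := mul_self_of_sign ht
  rcases natAbs_eq_one_or_three_le (hq i) with h1 | h3
  · refine Or.inl ⟨h1, h.congr_of_one h1 ⟨k p, ?_⟩ ⟨F p - k p * f p, ?_⟩ hw⟩
    · rw [← h.mul_eq p]; ring
    · have hs := h.sq_eq hq p
      have hC := h.mul_eq p
      linear_combination (f p ^ 2) * htt - hs + f p * hC
  · right
    obtain ⟨s, hs⟩ : ∃ s : ℤ, s = 1 ∧ 0 < q i ∨ s = -1 ∧ q i < 0 := by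
      rcases lt_trichotomy (q i) 0 with h1 | h1 | h1
      · exact ⟨-1, Or.inr ⟨rfl, h1⟩⟩
      · rw [h1] at h3; simp at h3
      · exact ⟨1, Or.inl ⟨rfl, h1⟩⟩
    obtain ⟨h4, h5⟩ := h.congr_of_one_lt hs
    -- The ratio at `v i` is known modulo `F p` and modulo `F i`; the two values agree modulo the
    -- gcd.
    have hd := VecModEq.dvd_sub (h.coprime i) (hw.of_dvd (Int.gcd_dvd_left (F p) (F i)))
      (h4.of_dvd (Int.gcd_dvd_right (F p) (F i)))
    have hodd := fun i => Int.natAbs_odd.2 (hq i)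
    have hmul : k p * lucasNat 1 (k p) (q p).natAbs = k i * lucasNat 1 (k i) (q i).natAbs := by
      rw [← h.fst_eq, ← h.fst_eq, h.mul_eq, h.mul_eq]
    have hC' : 5 ≤ k p * lucasNat 1 (k p) (q p).natAbs := by rw [← h.fst_eq, h.mul_eq]; exact hC
    have hst : s = t := by
      by_contra hst
      have hst' : s = -t := by
        rcases hs with ⟨rfl, -⟩ | ⟨rfl, -⟩ <;> rcases ht with rfl | rfl <;> simp_all
      apply fib_not_dvd_add (h.one_le p) (h.one_le i) (hodd p) (hodd i) (by omega) h3 hmul hC'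
      rw [← h.fst_eq, ← h.fst_eq, ← h.snd_eq, ← h.snd_eq]
      rw [hst'] at hd
      have := hd.mul_left t
      rwa [show t * (t * f p - -t * f i) = f p + f i by linear_combination (f p + f i) * htt]
        at this
    subst hst
    have hd' : (Int.gcd (F p) (F i) : ℤ) ∣ f p - f i := by
      have := hd.mul_left s
      rwa [show s * (s * f p - s * f i) = f p - f i by linear_combination (f p - f i) * htt]
        at this
    rw [h.fst_eq, h.fst_eq, h.snd_eq, h.snd_eq] at hd'
    obtain ⟨h6, h7⟩ := fib_index_eq (h.one_le p) (h.one_le i) (hodd p) (hodd i) (by omega) h3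
      hmul hd'
    have hF : F i = F p := by rw [h.fst_eq, h.fst_eq, h6, h7]
    have hf : f i = f p := by rw [h.snd_eq, h.snd_eq, h6, h7]
    rw [hF, hf] at h5
    refine ⟨?_, hF, hf, h5⟩
    rcases hs with ⟨rfl, h8⟩ | ⟨rfl, h8⟩ <;> omega

/-- `τ i` is the sign in the ratio `±f p` of `w i` to `v i` modulo `F p`. It is well defined because
`f p` is prime to `F p` and `F p > 2`. -/
theorem IsAntiparallelData.exists_signs (h : IsAntiparallelData q v w k θ F f C)
    (hq : ∀ i, Odd (q i)) {p : Fin m} (hp : 5 ≤ (q p).natAbs) (hC : 5 ≤ C) :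
    ∃ τ : Fin m → ℤ, ∀ i, ((q i).natAbs = 1 ∧ τ (i + 1) = τ i) ∨
      (F i = F p ∧ f i = f p ∧ τ (i + 1) = τ i - 2 * (q i).sign) := by
  have hp0 : q p ≠ 0 := by rintro h0; rw [h0] at hp; simp at hp
  have ex : ∀ i, ∃ t : ℤ, (t = 1 ∨ t = -1) ∧ VecModEq (F p) (w i) ((t * f p) • v i) := by
    refine Fin.cyclic_induction p ?_ fun i ⟨t, ht, hw⟩ => ?_
    · rcases lt_or_gt_of_ne hp0 with h1 | h1
      · exact ⟨-1, Or.inr rfl, (h.congr_of_one_lt (Or.inr ⟨rfl, h1⟩)).1⟩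
      · exact ⟨1, Or.inl rfl, (h.congr_of_one_lt (Or.inl ⟨rfl, h1⟩)).1⟩
    · rcases h.step_sign hq hp hC ht hw with ⟨-, h1⟩ | ⟨-, -, -, h1⟩
      · exact ⟨t, ht, h1⟩
      · exact ⟨-t, by rcases ht with rfl | rfl <;> simp, h1⟩
  choose τ hτ hw using ex
  have hT := isFibTriple (h.one_le p) (Int.natAbs_odd.2 (hq p)) (by omega)
  rw [← h.fst_eq, ← h.snd_eq, h.mul_eq] at hT
  have huniq : ∀ i t, (t = 1 ∨ t = -1) → VecModEq (F p) (w i) ((t * f p) • v i) → τ i = t := by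
    intro i t ht h1
    have h2 : F p ∣ f p * (τ i - t) := by
      have := VecModEq.dvd_sub (h.coprime i) (hw i) h1
      rwa [show τ i * f p - t * f p = f p * (τ i - t) by ring] at this
    have h3 := hT.coprime.symm.dvd_of_dvd_mul_left h2
    have h4 : 2 < F p := by
      have h5 := lucasNat_le_lucasNat (h.one_le p) (by norm_num) hp
      rw [lucasNat_five, ← h.fst_eq] at h5
      have := pow_pos (show 0 < k p from h.one_le p) 4
      have := pow_pos (show 0 < k p from h.one_le p) 2
      linarith
    have h5 : |τ i - t| < F p := by
      refine lt_of_le_of_lt ?_ h4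
      rcases hτ i with h | h <;> rcases ht with h' | h' <;> rw [h, h'] <;> norm_num
    have := Int.eq_zero_of_abs_lt_dvd h3 h5
    linarith
  refine ⟨τ, fun i => ?_⟩
  rcases h.step_sign hq hp hC (hτ i) (hw i) with ⟨h1, h2⟩ | ⟨h1, h2, h3, h4⟩
  · exact Or.inl ⟨h1, huniq _ _ (hτ i) h2⟩
  · refine Or.inr ⟨h2, h3, ?_⟩
    rw [huniq _ (-τ i) (by rcases hτ i with h | h <;> simp [h]) h4, h1, Int.sign_mul]
    have h5 : (((q p).natAbs : ℤ)).sign = 1 := Int.sign_eq_one_of_pos (by omega)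
    rw [h5]
    rcases hτ i with h | h <;> rw [h] <;> simp

/-- The region maps on pairs `(v, w)` are, up to scalars, `f + M` or their inverses for the one
matrix `M` sending `(x, y)` to `(C x - y, x)`. The form `α x - y` is an eigenvector of `M` with
eigenvalue `α`, so its size changes by `((α + f) / F) ^ (±1)` at each region. -/
theorem IsAntiparallelData.false_of_five_le (h : IsAntiparallelData q v w k θ F f C) (hm : Odd m)
    (hq : ∀ i, Odd (q i)) {p : Fin m} (hp : 5 ≤ (q p).natAbs) : False := by
  have hC : 5 ≤ C := by
    have h5 := lucasNat_le_lucasNat (h.one_le p) (by norm_num) hp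
    rw [lucasNat_five, ← h.fst_eq] at h5
    have h1 := pow_pos (show 0 < k p from h.one_le p) 4
    have h2 := pow_pos (show 0 < k p from h.one_le p) 2
    calc (5 : ℤ) = 1 * 5 := rfl
      _ ≤ k p * F p := by
        have := h.one_le p
        gcongr
        linarith
      _ = C := h.mul_eq p
  obtain ⟨τ, hτ⟩ := h.exists_signs hq hp hC
  obtain ⟨α, hα1, hα⟩ : ∃ α : ℝ, 1 < α ∧ α ^ 2 = C * α - 1 := by
    have hC' : (5 : ℝ) ≤ C := by exact_mod_cast hC
    have h1 : (0 : ℝ) ≤ (C : ℝ) ^ 2 - 4 := by nlinarith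
    refine ⟨(C + √((C : ℝ) ^ 2 - 4)) / 2, ?_, ?_⟩
    · have := Real.sqrt_nonneg ((C : ℝ) ^ 2 - 4)
      linarith
    · have := Real.sq_sqrt h1
      linear_combination this / 4
  have hα0 : 0 < α := by linarith
  -- One of the two coordinates of `v` and `w` has `α x 0 - y 0 ≠ 0`, since `v 0` and `w 0` are
  -- independent.
  obtain ⟨x, y, hxy⟩ : ∃ x y : Fin m → ℤ, α * x 0 - y 0 ≠ 0 ∧ ∀ i,
      (0 < q i → F i * x (i + 1) = -θ i * ((C + f i) * x i - y i) ∧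
        F i * y (i + 1) = -θ i * (x i + f i * y i)) ∧
      (q i < 0 → F i * y (i + 1) = θ i * ((C + f i) * y i - x i) ∧
        F i * x (i + 1) = θ i * (y i + f i * x i)) := by
    have h1 : α * (v 0).1 - (w 0).1 ≠ 0 ∨ α * (v 0).2 - (w 0).2 ≠ 0 := by
      by_contra! hcon
      apply h.symp_ne 0
      have : ((symp (v 0) (w 0) : ℤ) : ℝ) = 0 := by
        simp only [symp]
        push_cast
        linear_combination ((v 0).2 : ℝ) * hcon.1 - ((v 0).1 : ℝ) * hcon.2
      exact_mod_cast this
    rcases h1 with h1 | h1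
    · refine ⟨fun i => (v i).1, fun i => (w i).1, h1, fun i => ⟨fun hi => ?_, fun hi => ?_⟩⟩
      · obtain ⟨h2, h3⟩ := h.step_pos hq hi
        exact ⟨by simpa [mul_add] using congrArg Prod.fst h2, by simpa [mul_add] using congrArg Prod.fst h3⟩
      · obtain ⟨h2, h3⟩ := h.step_neg hq hi
        exact ⟨by simpa [mul_add] using congrArg Prod.fst h2, by simpa [mul_add] using congrArg Prod.fst h3⟩
    · refine ⟨fun i => (v i).2, fun i => (w i).2, h1, fun i => ⟨fun hi => ?_, fun hi => ?_⟩⟩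
      · obtain ⟨h2, h3⟩ := h.step_pos hq hi
        exact ⟨by simpa [mul_add] using congrArg Prod.snd h2, by simpa [mul_add] using congrArg Prod.snd h3⟩
      · obtain ⟨h2, h3⟩ := h.step_neg hq hi
        exact ⟨by simpa [mul_add] using congrArg Prod.snd h2, by simpa [mul_add] using congrArg Prod.snd h3⟩
  obtain ⟨hz0, hxy⟩ := hxy
  have hF : ∀ i, (0 : ℝ) < F i := fun i => by exact_mod_cast h.fst_pos hq i
  have hαf : ∀ i, 0 < α + f i := fun i => by
    have : (0 : ℝ) ≤ f i := by exact_mod_cast h.snd_nonneg i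
    linarith
  have hθ : ∀ i, |(θ i : ℝ)| = 1 := fun i => by rcases h.sign i with h | h <;> simp [h]
  have step : ∀ i, (0 < q i → F i * |α * x (i + 1) - y (i + 1)| = (α + f i) * |α * x i - y i|) ∧
      (q i < 0 → (α + f i) * |α * x (i + 1) - y (i + 1)| = F i * |α * x i - y i|) := by
    refine fun i => ⟨fun hi => ?_, fun hi => ?_⟩
    · obtain ⟨h1, h2⟩ := (hxy i).1 hi
      have h1' : (F i : ℝ) * x (i + 1) = -θ i * ((C + f i) * x i - y i) := by exact_mod_cast h1
      have h2' : (F i : ℝ) * y (i + 1) = -θ i * (x i + f i * y i) := by exact_mod_cast h2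
      have h3 : (F i : ℝ) * (α * x (i + 1) - y (i + 1)) =
          -θ i * ((α + f i) * (α * x i - y i)) := by
        linear_combination α * h1' - h2' + (θ i * x i : ℝ) * hα
      have h4 := congrArg abs h3
      rwa [abs_mul, abs_mul, abs_mul, abs_neg, hθ, one_mul, abs_of_pos (hF i),
        abs_of_pos (hαf i)] at h4
    · obtain ⟨h1, h2⟩ := (hxy i).2 hi
      have h1' : (F i : ℝ) * y (i + 1) = θ i * ((C + f i) * y i - x i) := by exact_mod_cast h1
      have h2' : (F i : ℝ) * x (i + 1) = θ i * (y i + f i * x i) := by exact_mod_cast h2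
      have hs : (F i : ℝ) ^ 2 = f i ^ 2 + C * f i + 1 := by exact_mod_cast h.sq_eq hq i
      have h3 : (α + f i) * (α * x (i + 1) - y (i + 1)) = θ i * (F i * (α * x i - y i)) := by
        apply mul_left_cancel₀ (hF i).ne'
        linear_combination (α + f i) * (α * h2' - h1') +
          (θ i * (f i * x i + y i) : ℝ) * hα - (θ i * (α * x i - y i) : ℝ) * hs
      have h4 := congrArg abs h3
      rwa [abs_mul, abs_mul, abs_mul, hθ, one_mul, abs_of_pos (hF i),
        abs_of_pos (hαf i)] at h4
  have hz : ∀ i, 0 < |α * x i - y i| := by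
    refine Fin.cyclic_induction 0 (abs_pos.2 hz0) fun i hi => ?_
    rcases lt_trichotomy (q i) 0 with h1 | h1 | h1
    · refine (mul_pos_iff_of_pos_left (hαf i)).1 ?_
      rw [(step i).2 h1]
      exact mul_pos (hF i) hi
    · have := hq i
      rw [h1] at this
      simp at this
    · refine (mul_pos_iff_of_pos_left (hF i)).1 ?_
      rw [(step i).1 h1]
      exact mul_pos (hαf i) hi
  have hlog : ∀ i, Real.log |α * x (i + 1) - y (i + 1)| - Real.log |α * x i - y i| =
      (q i).sign * (Real.log (α + f i) - Real.log (F i)) := by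
    intro i
    have hz1 := hz i
    have hz2 := hz (i + 1)
    rcases lt_trichotomy (q i) 0 with h1 | h1 | h1
    · have h2 := congrArg Real.log ((step i).2 h1)
      rw [Real.log_mul (hαf i).ne' hz2.ne', Real.log_mul (hF i).ne' hz1.ne'] at h2
      rw [Int.sign_eq_neg_one_of_neg h1]
      push_cast
      linarith
    · have := hq i
      rw [h1] at this
      simp at this
    · have h2 := congrArg Real.log ((step i).1 h1)
      rw [Real.log_mul (hαf i).ne' hz1.ne', Real.log_mul (hF i).ne' hz2.ne'] at h2
      rw [Int.sign_eq_one_of_pos h1]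
      push_cast
      linarith
  -- A single crossing contributes `± log α`. A larger region adds a fixed multiple of the increment
  -- of `τ`, and these increments telescope around the knot.
  have hlog' : ∀ i, ((q i).sign : ℝ) * (Real.log (α + f i) - Real.log (F i)) =
      (q i).sign * Real.log α - (τ (i + 1) - τ i : ℝ) *
        ((Real.log (α + f p) - Real.log (F p) - Real.log α) / 2) := by
    intro i
    rcases hτ i with ⟨h1, h2⟩ | ⟨h1, h2, h3⟩
    · have e1 : F i = 1 := by rw [h.fst_eq, h1]; rfl
      have e2 : f i = 0 := by rw [h.snd_eq, h1]; rfl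
      rw [h2, e1, e2]
      simp
    · rw [h1, h2, h3]
      push_cast
      ring
  have hcyc : ∀ g : Fin m → ℝ, ∑ i, (g (i + 1) - g i) = 0 := fun g => by
    rw [Finset.sum_sub_distrib, sub_eq_zero]
    exact Equiv.sum_comp (Equiv.addRight 1) g
  have hsum := hcyc fun i => Real.log |α * x i - y i|
  simp only [hlog, hlog'] at hsum
  rw [Finset.sum_sub_distrib, ← Finset.sum_mul, ← Finset.sum_mul, hcyc fun i => (τ i : ℝ), zero_mul,
    sub_zero] at hsum
  have hs0 : ∑ i, (q i).sign = 0 := by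
    have := (mul_eq_zero.1 hsum).resolve_right (Real.log_pos hα1).ne'
    exact_mod_cast this
  -- A sum of `m` signs `±1` is congruent to `m` modulo 2, so it cannot vanish.
  have h2 : (2 : ℤ) ∣ ∑ i, ((q i).sign - 1) := Finset.dvd_sum fun i _ => by
    rcases Int.sign_trichotomy (q i) with h | h | h
    · simp [h]
    · have := hq i
      rw [Int.sign_eq_zero_iff_zero.1 h] at this
      simp at this
    · simp [h]
  rw [Finset.sum_sub_distrib, hs0] at h2
  simp at h2
  obtain ⟨j, rfl⟩ := hm
  omega

end

/-! ### The main theorem -/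

section

variable {m : ℕ} [NeZero m] {q : Fin m → ℤ}

theorem not_even_symp_of_bottomColor_ne {φ : PretzelGroup q →* Equiv.Perm (Fin 3)}
    {ψ : PretzelGroup q →* BraidGroup 3} (hψ : (braidToPerm 3).comp ψ = φ) {v : Fin m → ℤ × ℤ}
    (hv : ∀ i, Even (symp (v i) (v (i + 1))) →
      braidToPerm 3 (bottomColor ψ i) = braidToPerm 3 (bottomColor ψ (i + 1))) {i : Fin m}
    (hi : bottomColor φ i ≠ bottomColor φ (i + 1)) : ¬ Even (symp (v i) (v (i + 1))) := by
  intro h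
  apply hi
  rw [← hψ]
  exact hv i h

theorem not_lifts_of_odd (hm : Odd m) (hq : ∀ i, Odd (q i))
    (h : (∃ p, 3 < |q p|) ∨
      (((∀ i, 0 < q i) ∨ (∀ i, q i < 0)) ∧ ¬ (3 ∣ m ∧ ∀ p, |q p| = 1)))
    {φ : PretzelGroup q →* Equiv.Perm (Fin 3)} (hφ : IsSimplePermColoring φ)
    (hne : ¬ IsConstantColoring φ) : ¬ LiftsToSimpleBraidColoring φ := by
  rintro ⟨ψ, hψ, hψφ⟩
  obtain ⟨v, w, ε, η, C, hd, hv⟩ := exists_transvectionData hψ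
  obtain ⟨i₀, hi₀⟩ := exists_bottomColor_ne hφ hne
  obtain ⟨w', k, θ, F, f, ha⟩ :=
    hd.exists_antiparallelData hm hq (not_even_symp_of_bottomColor_ne hψφ hv hi₀)
  rcases h with ⟨p, hp⟩ | ⟨hs, hone⟩
  · refine ha.false_of_five_le hm hq (p := p) ?_
    rw [Int.abs_eq_natAbs] at hp
    obtain ⟨j, hj⟩ := hq p
    omega
  · by_cases h1 : ∀ p, |q p| = 1
    · refine hone ⟨three_dvd_of_natAbs_eq_one hφ hne ?_, h1⟩
      rcases hs with hs | hs
      · exact Or.inl fun i => by rw [← abs_of_pos (hs i), h1]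
      · exact Or.inr fun i => by rw [← h1 i, abs_of_neg (hs i), neg_neg]
    · push Not at h1
      obtain ⟨p, hp⟩ := h1
      rw [Int.abs_eq_natAbs] at hp
      refine ha.false_of_same_sign hq ?_ hs
      have hp' : 3 ≤ (q p).natAbs := by
        rcases natAbs_eq_one_or_three_le (hq p) with h | h
        · omega
        · exact h
      have hT := isFibTriple (ha.one_le p) (Int.natAbs_odd.2 (hq p)) hp'
      rw [← ha.fst_eq, ha.mul_eq] at hT
      have h1 := hT.one_le
      rw [← hT.mul_eq]
      nlinarith [hT.le]

end

theorem mainTheorem8 (m : ℕ) [NeZero m] (q : Fin m → ℤ) :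
    -- all `q i` and `m` odd
    (Odd m → (∀ i, Odd (q i)) →
      (((∃ j, (q j = q (j + 1) ∨ q j = -q (j + 1)) ∧ 3 ≤ |q j|) ∧ ∃ p, 3 < |q p|) ∨
        (((∀ i, 0 < q i) ∨ (∀ i, q i < 0)) ∧ ¬ (3 ∣ m ∧ ∀ p, |q p| = 1))) →
      ∀ φ : PretzelGroup q →* Equiv.Perm (Fin 3),
        IsSimplePermColoring φ → ¬ IsConstantColoring φ → ¬ LiftsToSimpleBraidColoring φ) ∧
    -- `m` and the first entry even, the other entries odd
    (Even m → Even (q 0) → (∀ i, i ≠ 0 → Odd (q i)) → (∃ i, 3 ∣ q i) →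
      ∀ φ : PretzelGroup q →* Equiv.Perm (Fin 3),
        IsSimplePermColoring φ → LiftsToSimpleBraidColoring φ) ∧
    -- the first entry even, the other entries and `m` odd
    (Odd m → Even (q 0) → (∀ i, i ≠ 0 → Odd (q i)) →
      (∀ φ : PretzelGroup q →* Equiv.Perm (Fin 3), IsSimplePermColoring φ →
        (q 0 = 0 ∨ IsConstantOnRegion φ 0) → LiftsToSimpleBraidColoring φ) ∧
      (∀ φ : PretzelGroup q →* Equiv.Perm (Fin 4), IsSimplePermColoring φ →
        (q 0 = 0 ∨ IsConstantOnRegion φ 0) → LiftsToSimpleBraidColoring φ) ∧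
      (q 0 ≠ 0 → (∀ i, 3 ∣ q i) →
        ∀ φ : PretzelGroup q →* Equiv.Perm (Fin 3), IsSimplePermColoring φ →
          (∀ i, ¬ IsConstantOnRegion φ i) → ¬ LiftsToSimpleBraidColoring φ) ∧
      ((∃ j, q j = q (j + 1) ∧ |q j| = 3) →
        ∀ φ : PretzelGroup q →* Equiv.Perm (Fin 3), IsSimplePermColoring φ →
          (LiftsToSimpleBraidColoring φ ↔ (q 0 = 0 ∨ IsConstantOnRegion φ 0)))) := by
  refine ⟨fun hm hq h φ hφ hne => ?_, fun hm _ _ hq φ hφ => lifts_of_three_dvd hm hq hφ,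
    fun hm hq0 hq => ?_⟩
  · exact not_lifts_of_odd hm hq (h.imp_left And.right) hφ hne
  · obtain ⟨s₃, hs₃⟩ := exists_braidSection_three
    obtain ⟨s₄, hs₄⟩ := exists_braidSection_four
    refine ⟨fun φ hφ => lifts_of_constant hs₃ hm hq0 hq hφ,
      fun φ hφ => lifts_of_constant hs₄ hm hq0 hq hφ, fun hne hq3 φ hφ hc => ?_,
      fun ⟨j, hj, hj3⟩ φ hφ => ⟨fun ⟨ψ, hψ, hψφ⟩ => ?_, lifts_of_constant hs₃ hm hq0 hq hφ⟩⟩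
    · rintro ⟨ψ, hψ, hψφ⟩
      obtain ⟨v, w, ε, η, C, hd, hv⟩ := exists_transvectionData hψ
      exact hd.false_of_three_dvd hm hq0 hq hne hq3 fun i =>
        not_even_symp_of_bottomColor_ne hψφ hv (bottomColor_ne_of_not_constantOnRegion hφ (hc i))
    · by_contra! hcon
      obtain ⟨v, w, ε, η, C, hd, hv⟩ := exists_transvectionData hψ
      exact hd.false_of_eq_three hm hq0 hq hcon.1 (not_even_symp_of_bottomColor_ne hψφ hv
        (bottomColor_ne_of_not_constantOnRegion hφ hcon.2)) hj hj3
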